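/- **Setting.** Let $a:\mathbb R\to\mathbb R$ be smooth such that $a':\mathbb R\to\mathbb R$ is a diffeomorphism (so $a''\neq0$ everywhere), and let $q:\mathbb R^3\to\mathbb C$ be smooth and compactly supported with $q(\xi,\xi,\xi)\in\mathbb R$ for all $\xi$. With $D=-i\partial_x$ and the unitary Fourier transform $\hat u(\xi)=(2\pi)^{-1/2}\int e^{-ix\xi}u(x)\,dx$, let $A(D)$, $A'(D)$ be the Fourier multipliers with symbols $a$, $a'$, let $Q$ be given by $$\widehat{Q(u,\bar u,u)}(\xi)=\frac1{2\pi}\iint q(\xi_1,\xi_2,\xi-\xi_1+\xi_2)\,\hat u(\xi_1)\,\overline{\hat u(\xi_2)}\,\hat u(\xi-\xi_1+\xi_2)\,d\xi_1\,d\xi_2 ,$$ and consider the equation $$i\partial_tu-A(D)u=Q(u,\bar u,u).\qquad(*)$$ Put $L=x-tA'(D)$ and $\|u(t)\|_X^2=\|u(t)\|_{L^2}^2+\|Lu(t)\|_{L^2}^2$. For $v\in\mathbb R$ let $\xi_v$ be the solution of $a'(\xi_v)=v$ and let $\phi(v)=v\xi_v-a(\xi_v)$. Fix $\chi\in C_c^\infty(\mathbb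 R)$ with $\int\chi=1$ and define $$\mathbf u_v(t,x)=|a''(\xi_v)|^{-1/2}\,\chi(y)\,e^{it\phi(x/t)},\quad y=\frac{x-vt}{t^{1/2}|a''(\xi_v)|^{1/2}},\qquad \gamma(t,v)=\langle u(t),\mathbf u_v(t)\rangle_{L^2}=\int u(t,x)\,\overline{\mathbf u_v(t,x)}\,dx .$$ Let $K\subset\mathbb R$ be a set of velocities. Assume that either $K$ is compact, or $a$ is uniformly dispersive, meaning that $|a''|$ is bounded below by a positive constant and $a^{(j)}$ is bounded for every $j\ge2$; in the second case $K$ is arbitrary, for instance $K=\mathbb R$. **Proposition.** For all $R,A,M$ there is a constant $B$, depending only on $a,q,\chi,K,R,A,M$, such that the following holds for all $C>0$ and $0<\varepsilon\le1$ with $C\varepsilon\le M$, and for all $T$. Let $u$ solve $(*)$ in $L^2$ for $0<t<T$, with $\hat u(t)$ supported in $[-R,R]$, and suppose that $$\|u(t)\|_X\le A\,\varepsilon\,\langle t\rangle^{C^2\varepsilon^2},\qquad 1\le t<T,\qquad \langle t\rangle=(1+t^2)^{1/2}.$$ Then for all $1\le t<T$ and all $v\in\mathbb R$ the function $\gamma$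 is differentiable in $t$ and $$\dot\gamma(t,v)=-i\,q(\xi_v,\xi_v,\xi_v)\,t^{-1}\,\gamma(t,v)\,|\gamma(t,v)|^2+f(t,v),$$ where $f(t,\cdot)$ is measurable and, for $1\le t<T$, $$\sup_{v\in K}|f(t,v)|\le B\,\varepsilon\,t^{-\frac54+3C^2\varepsilon},\qquad \|f(t,\cdot)\|_{L^2_v(K)}\le B\,\varepsilon\,t^{-\frac32+3C^2\varepsilon}.$$ -/

import Mathlib

open MeasureTheory Set
open scoped ENNReal ContDiff FourierTransform

noncomputable section

namespace WavePacket

/-- The space `L²(ℝ; ℂ)`. -/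
abbrev L2 : Type := Lp (α := ℝ) ℂ 2 volume

/-- The unitary Fourier transform `û(ξ) = (2π)^{-1/2} ∫ e^{-ixξ} u(x) dx` on `L²`, so that
`D = -i ∂ₓ` becomes multiplication by `ξ`.  (Mathlib's `𝓕` uses the kernel `e^{-2πixη}`, `ξ = 2πη`.) -/
def hat (u : L2) (ξ : ℝ) : ℂ :=
  ((Real.sqrt (2 * Real.pi))⁻¹ : ℝ) * (𝓕 u : L2) (ξ / (2 * Real.pi))

/-- `u` is frequency localized in `[-R, R]`. -/
def FreqLocalized (R : ℝ) (u : L2) : Prop :=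
  ∀ᵐ ξ : ℝ, R < |ξ| → hat u ξ = 0

/-- `g = m(D) u` in `L²`: the graph of the Fourier multiplier with real symbol `m`. -/
def IsMultiplier (m : ℝ → ℝ) (u g : L2) : Prop :=
  hat g =ᵐ[volume] fun ξ => (m ξ : ℂ) * hat u ξ

/-- `g = Q(u, ū, u)` in `L²`, where `Q` is the translation invariant cubic form with symbol `q`. -/
def IsCubicForm (q : ℝ → ℝ → ℝ → ℂ) (u g : L2) : Prop :=
  hat g =ᵐ[volume] fun ξ => ((2 * Real.pi)⁻¹ : ℝ) *
    ∫ ξ₁ : ℝ, ∫ ξ₂ : ℝ, q ξ₁ ξ₂ (ξ - ξ₁ + ξ₂) *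
      (hat u ξ₁ * (starRingEnd ℂ) (hat u ξ₂) * hat u (ξ - ξ₁ + ξ₂))

/-- Dispersion relations: `a` is real and smooth, and `a' : ℝ → ℝ` is a diffeomorphism. -/
structure IsDispersive (a : ℝ → ℝ) : Prop where
  smooth : ContDiff ℝ ∞ a
  bijective : Function.Bijective (deriv a)
  nondegenerate : ∀ ξ, deriv (deriv a) ξ ≠ 0

/-- Uniform dispersion on the whole line: `|a''|` is bounded below by a positive constant, and all
derivatives of `a` of order at least two are bounded. -/
structure IsUniformlyDispersive (a : ℝ → ℝ) : Prop where
  lower : ∃ c : ℝ, 0 < c ∧ ∀ ξ, c ≤ |deriv (deriv a) ξ|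
  upper : ∀ j : ℕ, 2 ≤ j → ∃ c : ℝ, ∀ ξ, |iteratedDeriv j a ξ| ≤ c

/-- Symbols of the nonlinearity: smooth, compactly supported, and real on the diagonal. -/
structure IsCubicSymbol (q : ℝ → ℝ → ℝ → ℂ) : Prop where
  smooth : ContDiff ℝ ∞ (fun p : ℝ × ℝ × ℝ => q p.1 p.2.1 p.2.2)
  compactSupport : HasCompactSupport (fun p : ℝ × ℝ × ℝ => q p.1 p.2.1 p.2.2)
  conservative : ∀ ξ, (q ξ ξ ξ).im = 0

/-- `u` solves `i ∂ₜ u - A(D) u = Q(u, ū, u)` in `L²` for `0 < t < T`. -/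
def IsSolution (a : ℝ → ℝ) (q : ℝ → ℝ → ℝ → ℂ) (T : ℝ) (u : ℝ → L2) : Prop :=
  ∀ t ∈ Ioo (0 : ℝ) T, ∃ du Au Qu : L2,
    HasDerivAt u du t ∧ IsMultiplier a (u t) Au ∧ IsCubicForm q (u t) Qu ∧
      Complex.I • du - Au = Qu

/-- The norm `‖u‖_X = (‖u‖²_{L²} + ‖L u‖²_{L²})^{1/2}` at time `t`, with `L = x - t A'(D)`.
The infimum is over the at most one `g = A'(D) u`, and the value is `∞` if there is none. -/
def xNorm (a : ℝ → ℝ) (t : ℝ) (u : L2) : ℝ≥0∞ :=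
  ⨅ (g : L2) (_ : IsMultiplier (deriv a) u g),
    (eLpNorm u 2 volume ^ 2 +
      eLpNorm (fun x : ℝ => (x : ℂ) * u x - (t : ℂ) * g x) 2 volume ^ 2) ^ (1 / 2 : ℝ)

/-- The frequency `ξ_v` with group velocity `v`, i.e. `a'(ξ_v) = v`. -/
def freq (a : ℝ → ℝ) (v : ℝ) : ℝ := Function.invFun (deriv a) v

/-- The phase `φ(v) = v ξ_v - a(ξ_v)`. -/
def phase (a : ℝ → ℝ) (v : ℝ) : ℝ := v * freq a v - a (freq a v)

/-- The wave packet `𝐮_v(t, x) = |a''(ξ_v)|^{-1/2} χ(y) e^{itφ(x/t)}`,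
`y = (x - vt) / (t^{1/2} |a''(ξ_v)|^{1/2})`. -/
def packet (a : ℝ → ℝ) (χ : ℝ → ℂ) (v t x : ℝ) : ℂ :=
  ((Real.sqrt |deriv (deriv a) (freq a v)|)⁻¹ : ℝ) *
    χ ((x - v * t) / (Real.sqrt t * Real.sqrt |deriv (deriv a) (freq a v)|)) *
    Complex.exp (Complex.I * ((t * phase a (x / t) : ℝ) : ℂ))

/-- The asymptotic profile `γ(t, v) = ⟨u(t), 𝐮_v(t)⟩ = ∫ u(t, x) conj(𝐮_v(t, x)) dx`. -/
def profile (a : ℝ → ℝ) (χ : ℝ → ℂ) (u : ℝ → L2) (t v : ℝ) : ℂ :=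
  ∫ x : ℝ, u t x * (starRingEnd ℂ) (packet a χ v t x)

end WavePacket

end

/-! A function u with frequencies in [-R,R] and Lu in L² has, near x at time t, essentially the
single frequency ξ_{x/t}. The transform of Lu is (i∂_ξ - t a'(ξ))û, so integrating by parts in ξ
turns an operator with symbol (a'(ξ) - x/t) n(x/t, ξ) into t⁻¹ times bounded operators applied to Lu
and u (`FreqData.op_vanishing_eq`). Since a'(ξ) - y is ξ - ξ_y times a mean of a'', which is bounded
away from zero, every symbol vanishing at ξ = ξ_{x/t} gains t⁻¹ in L²
(`IsDispersive.exists_vanishing_const`). The operator bounds behind this come from `l2Bound_op`,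
which uses only Plancherel and the bounded frequency band.

Linear part. Taylor expansion of a at ξ_{x/t} writes A(D)u as a(ξ_{x/t})u plus terms with vanishing
symbols. The leading term cancels the time derivative of the phase, by the eikonal equation for φ.
What is left is an exact x-derivative plus terms t^{-1/2} D, t^{-1/2} S, t⁻¹ T with D, S, T given by
vanishing symbols (`IsDispersive.integral_linear_eq`). So the error is dominated by the integral,
over a window of size √t around vt, of a function with L² norm O(t^{-3/2}) that does not depend on
v.

Cubic part. Writing q as a superposition of characters makes Q a superposition of products of
translates of u. A translate by s is e^{-isξ_{x/t}} u up to an operator with vanishing symbol, hence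
Q(u,ū,u) is q(ξ,ξ,ξ)|u|²u at ξ = ξ_{x/t} up to O(t⁻²) in L²; the pointwise decay |u| ≲ t^{-1/2}
comes from the same estimate for ξ - ξ_{x/t}. Freezing ξ_{x/t} to ξ_v and replacing the average of
|u|²u by the cube of the average cost O(t^{-3/2}) in the same windowed sense
(`IsDispersive.exists_cubic_bound`).

A window of size √t costs t^{1/4} in supremum by Cauchy–Schwarz and nothing in L²_v by Minkowski:
these are the exponents -5/4 and -3/2. The X norm enters as N + N³ ≲ ε t^{3C²ε}.

For compact K and general a, both u and the packets with v in K see a only on a bounded frequency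
interval, so a may be replaced by a uniformly dispersive function agreeing with it there. -/

namespace WavePacket

/-! ### Fourier inversion and Plancherel in the unitary normalization -/

/-- The inverse of the unitary Fourier transform, for integrable functions. -/
noncomputable def synth (k : ℝ → ℂ) (x : ℝ) : ℂ :=
  ((Real.sqrt (2 * Real.pi))⁻¹ : ℝ) * ∫ ξ : ℝ, k ξ * Complex.exp (Complex.I * ((x * ξ : ℝ) : ℂ))

theorem two_pi_pos : (0 : ℝ) < 2 * Real.pi := by positivity

/-- Fubini with a symmetric kernel. Integrability of both factors suffices, so one of them may be
the transform of an L² function. -/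
theorem integral_fourierInv_smul {f g : ℝ → ℂ} (hf : Integrable f) (hg : Integrable g) :
    ∫ ξ, (𝓕⁻ f) ξ * g ξ = ∫ x, f x * (𝓕⁻ g) x := by
  have := VectorFourier.integral_fourierIntegral_smul_eq_flip (μ := (volume : Measure ℝ))
    (ν := (volume : Measure ℝ)) (L := - (innerₗ ℝ : ℝ →ₗ[ℝ] ℝ →ₗ[ℝ] ℝ))
    (e := Real.fourierChar) (f := f) (g := g) Real.continuous_fourierChar
    (by simp only [LinearMap.neg_apply, innerₗ_apply_apply]; fun_prop) hf hg
  simp only [smul_eq_mul] at this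
  have h1 : ∀ ξ, (𝓕⁻ f) ξ = VectorFourier.fourierIntegral Real.fourierChar volume
      (-(innerₗ ℝ : ℝ →ₗ[ℝ] ℝ →ₗ[ℝ] ℝ)) f ξ := fun ξ => by
    simp only [Real.fourierInv_eq, VectorFourier.fourierIntegral,
      LinearMap.neg_apply, innerₗ_apply_apply, neg_neg]
  simp only [h1]
  rw [this]
  refine integral_congr_ae (Filter.Eventually.of_forall fun x => ?_)
  simp only [VectorFourier.fourierIntegral]
  congr 1
  refine integral_congr_ae (Filter.Eventually.of_forall fun y => ?_)
  change Real.fourierChar (- - (inner ℝ x y)) • g y = Real.fourierChar (- - (inner ℝ y x)) • g y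
  rw [real_inner_comm y x]

/-- Both sides are locally integrable, so it is enough to test against smooth compactly supported
functions. There the identity is inversion for tempered distributions, after which Fubini moves the
kernel from the test function to `𝓕 u`. -/
theorem coeFn_eq_fourierInv (u : L2) (hi : Integrable (𝓕 u : L2)) :
    u =ᵐ[volume] 𝓕⁻ (⇑(𝓕 u : L2)) := by
  have hu : LocallyIntegrable u volume :=
    (Lp.memLp u).locallyIntegrable (by norm_num)
  have hc : Continuous (𝓕⁻ (⇑(𝓕 u : L2))) := by
    have := VectorFourier.fourierIntegral_continuous (μ := (volume : Measure ℝ))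
      (L := - (innerₗ ℝ : ℝ →ₗ[ℝ] ℝ →ₗ[ℝ] ℝ)) (e := Real.fourierChar) (f := (𝓕 u : L2)) Real.continuous_fourierChar
      (by simp only [LinearMap.neg_apply, innerₗ_apply_apply]; fun_prop) hi
    convert this using 1
    ext x
    simp only [Real.fourierInv_eq, VectorFourier.fourierIntegral,
      LinearMap.neg_apply, innerₗ_apply_apply, neg_neg]
  refine ae_eq_of_integral_contDiff_smul_eq hu hc.locallyIntegrable fun g hg hgc => ?_
  have hgc' : HasCompactSupport (fun x => (g x : ℂ)) := hgc.comp_left (g := fun x : ℝ => (x : ℂ)) rfl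
  let φ : SchwartzMap ℝ ℂ := hgc'.toSchwartzMap (Complex.ofRealCLM.contDiff.comp hg)
  have h1 : (Lp.toTemperedDistribution u) φ = (Lp.toTemperedDistribution (𝓕 u : L2)) (𝓕⁻ φ) := by
    have := Lp.fourierInv_toTemperedDistribution_eq (𝓕 u : L2)
    rw [FourierTransform.fourierInv_fourier_eq] at this
    rw [← this, TemperedDistribution.fourierInv_apply]
  rw [Lp.toTemperedDistribution_apply, Lp.toTemperedDistribution_apply] at h1
  have hφ : ∀ x, φ x = (g x : ℂ) := fun x => rfl
  simp only [smul_eq_mul, SchwartzMap.fourierInv_coe, hφ] at h1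
  rw [integral_fourierInv_smul φ.integrable hi] at h1
  simpa [hφ] using h1

theorem map_div_two_pi :
    Measure.map (fun ξ : ℝ => ξ / (2 * Real.pi)) volume = ENNReal.ofReal (2 * Real.pi) • volume := by
  have h2 := Real.map_volume_mul_right (a := (2 * Real.pi)⁻¹) (by positivity)
  simp only [div_eq_mul_inv]
  rw [h2, inv_inv, abs_of_pos two_pi_pos]

theorem quasiMeasurePreserving_div_two_pi :
    Measure.QuasiMeasurePreserving (fun ξ : ℝ => ξ / (2 * Real.pi)) volume volume :=
  ⟨by fun_prop, by rw [map_div_two_pi]; exact Measure.smul_absolutelyContinuous⟩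

theorem hat_ae_eq {f : L2} {k : ℝ → ℂ} (h : (𝓕 f : L2) =ᵐ[volume] k) :
    hat f =ᵐ[volume] fun ξ => ((Real.sqrt (2 * Real.pi))⁻¹ : ℝ) * k (ξ / (2 * Real.pi)) := by
  filter_upwards [quasiMeasurePreserving_div_two_pi.ae_eq_comp h] with ξ hξ
  simp only [hat]
  congr 1

theorem fourier_eq_hat (u : L2) (η : ℝ) :
    (𝓕 u : L2) η = (Real.sqrt (2 * Real.pi) : ℝ) * hat u (2 * Real.pi * η) := by
  have : (Real.sqrt (2 * Real.pi) : ℂ) ≠ 0 := by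
    exact_mod_cast (Real.sqrt_pos.2 two_pi_pos).ne'
  have h2 : 2 * Real.pi * η / (2 * Real.pi) = η := by field_simp
  simp only [hat, h2]
  push_cast
  field_simp

theorem aestronglyMeasurable_hat (u : L2) : AEStronglyMeasurable (hat u) volume :=
  ((Lp.aestronglyMeasurable (𝓕 u : L2)).comp_quasiMeasurePreserving
    quasiMeasurePreserving_div_two_pi).const_mul _

theorem eLpNorm_hat (u : L2) : eLpNorm (hat u) 2 volume = eLpNorm u 2 volume := by
  have h1 : eLpNorm (fun ξ : ℝ => (𝓕 u : L2) (ξ / (2 * Real.pi))) 2 volume =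
      ENNReal.ofReal (2 * Real.pi) ^ (1 / 2 : ℝ) * eLpNorm (𝓕 u : L2) 2 volume := by
    have := eLpNorm_map_measure (p := 2) (μ := volume) (f := fun ξ : ℝ => ξ / (2 * Real.pi))
      (g := (𝓕 u : L2)) ?_ (by fun_prop)
    · rw [map_div_two_pi, eLpNorm_smul_measure_of_ne_top (by norm_num)] at this
      simpa [Function.comp_def] using this.symm
    · rw [map_div_two_pi]
      exact (Lp.aestronglyMeasurable _).smul_measure _
  have h2 : eLpNorm (𝓕 u : L2) 2 volume = eLpNorm u 2 volume := by
    have := Lp.norm_fourier_eq u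
    rw [Lp.norm_def, Lp.norm_def] at this
    exact (ENNReal.toReal_eq_toReal_iff' (Lp.eLpNorm_ne_top _) (Lp.eLpNorm_ne_top _)).1 this
  have h3 : hat u = ((Real.sqrt (2 * Real.pi))⁻¹ : ℝ) •
      (fun ξ : ℝ => (𝓕 u : L2) (ξ / (2 * Real.pi))) := by
    ext ξ; simp [hat]
  rw [h3, eLpNorm_const_smul, h1, h2, ← mul_assoc]
  have h4 : ‖(Real.sqrt (2 * Real.pi))⁻¹‖ₑ * ENNReal.ofReal (2 * Real.pi) ^ (1 / 2 : ℝ) = 1 := by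
    rw [ENNReal.ofReal_rpow_of_nonneg two_pi_pos.le (by norm_num), ← Real.sqrt_eq_rpow,
      Real.enorm_of_nonneg (by positivity), ← ENNReal.ofReal_mul (by positivity),
      inv_mul_cancel₀ (Real.sqrt_pos.2 two_pi_pos).ne', ENNReal.ofReal_one]
  rw [h4, one_mul]

theorem memLp_hat (u : L2) : MemLp (hat u) 2 volume :=
  ⟨aestronglyMeasurable_hat u, by rw [eLpNorm_hat]; exact (Lp.memLp u).2⟩

/-- Allows a function given on the frequency side to be treated as the transform of an L² element,
so that Parseval and Plancherel apply to it. -/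
theorem exists_hat_eq {k : ℝ → ℂ} (hk : MemLp k 2 volume) : ∃ u : L2, hat u =ᵐ[volume] k := by
  have h2 : MemLp (fun η : ℝ => (Real.sqrt (2 * Real.pi) : ℂ) * k (2 * Real.pi * η)) 2 volume := by
    refine MemLp.const_mul ?_ _
    have h3 := Real.map_volume_mul_left (a := 2 * Real.pi) (by positivity)
    have : MemLp k 2 (Measure.map (fun η : ℝ => 2 * Real.pi * η) volume) := by
      rw [h3]; exact hk.smul_measure ENNReal.ofReal_ne_top
    exact this.comp_of_map (by fun_prop)
  refine ⟨𝓕⁻ h2.toLp, ?_⟩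
  have h3 := hat_ae_eq (f := 𝓕⁻ h2.toLp)
    (k := fun η : ℝ => (Real.sqrt (2 * Real.pi) : ℂ) * k (2 * Real.pi * η)) (by
    rw [FourierTransform.fourier_fourierInv_eq]; exact h2.coeFn_toLp)
  filter_upwards [h3] with ξ hξ
  rw [hξ]
  have : (Real.sqrt (2 * Real.pi) : ℂ) ≠ 0 := by
    exact_mod_cast (Real.sqrt_pos.2 two_pi_pos).ne'
  have h4 : 2 * Real.pi * (ξ / (2 * Real.pi)) = ξ := by field_simp
  rw [h4]
  push_cast
  field_simp

/-- Fourier inversion for square integrable functions with integrable transform. -/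
theorem coeFn_eq_synth_hat (u : L2) (hi : Integrable (hat u)) : u =ᵐ[volume] synth (hat u) := by
  have hf : (𝓕 u : L2) = fun η => (Real.sqrt (2 * Real.pi) : ℂ) * hat u (2 * Real.pi * η) :=
    funext fun η => fourier_eq_hat u η
  have hi' : Integrable (𝓕 u : L2) := by
    rw [hf]
    exact (hi.comp_mul_left' two_pi_pos.ne').const_mul _
  refine (coeFn_eq_fourierInv u hi').trans (Filter.Eventually.of_forall fun x => ?_)
  simp only [synth]
  rw [Real.fourierInv_eq', hf]
  have h0 := Measure.integral_comp_mul_left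
    (fun ξ : ℝ => hat u ξ * Complex.exp (Complex.I * ((x * ξ : ℝ) : ℂ))) (2 * Real.pi)
  have h1 : (fun v : ℝ => Complex.exp (((2 * Real.pi * inner ℝ v x : ℝ) : ℂ) * Complex.I) •
      ((Real.sqrt (2 * Real.pi) : ℂ) * hat u (2 * Real.pi * v))) = fun v =>
      (Real.sqrt (2 * Real.pi) : ℂ) * (hat u (2 * Real.pi * v) *
        Complex.exp (Complex.I * ((x * (2 * Real.pi * v) : ℝ) : ℂ))) := by
    ext v
    simp only [smul_eq_mul, RCLike.inner_apply, conj_trivial]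
    rw [show ((2 * Real.pi * (x * v) : ℝ) : ℂ) * Complex.I =
      Complex.I * ((x * (2 * Real.pi * v) : ℝ) : ℂ) by push_cast; ring]
    ring
  rw [h1, integral_const_mul, h0, abs_of_pos (inv_pos.2 two_pi_pos), Complex.real_smul, ← mul_assoc]
  congr 1
  have h5 : Real.sqrt (2 * Real.pi) ≠ 0 := (Real.sqrt_pos.2 two_pi_pos).ne'
  have h6 := Real.mul_self_sqrt two_pi_pos.le
  norm_cast
  rw [← mul_right_inj' h5, mul_inv_cancel₀ h5, ← mul_assoc, h6, mul_inv_cancel₀ two_pi_pos.ne']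

theorem synth_congr {k k' : ℝ → ℂ} (h : k =ᵐ[volume] k') : synth k = synth k' := by
  ext x
  simp only [synth]
  congr 1
  refine integral_congr_ae ?_
  filter_upwards [h] with ξ hξ
  rw [hξ]

theorem coeFn_eq_synth {u : L2} {k : ℝ → ℂ} (hk : hat u =ᵐ[volume] k) (hi : Integrable k) :
    u =ᵐ[volume] synth k := by
  rw [← synth_congr hk]
  exact coeFn_eq_synth_hat u (hi.congr hk.symm)

/-- Plancherel's theorem for integrable and square integrable functions. -/
theorem eLpNorm_synth {k : ℝ → ℂ} (hk : MemLp k 2 volume) (hi : Integrable k) :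
    eLpNorm (synth k) 2 volume = eLpNorm k 2 volume := by
  obtain ⟨u, hu⟩ := exists_hat_eq hk
  rw [← eLpNorm_congr_ae (coeFn_eq_synth hu hi), ← eLpNorm_hat u, eLpNorm_congr_ae hu]

theorem integral_conj_hat_mul_hat (f g : L2) :
    ∫ ξ, (starRingEnd ℂ) (hat f ξ) * hat g ξ = ∫ x, (starRingEnd ℂ) (f x) * g x := by
  have h := Lp.inner_fourier_eq f g
  rw [L2.inner_def, L2.inner_def] at h
  simp only [RCLike.inner_apply'] at h
  rw [← h]
  simp only [hat]
  have h0 := Measure.integral_comp_div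
    (fun a => (starRingEnd ℂ) ((𝓕 f : L2) a) * (𝓕 g : L2) a) (2 * Real.pi)
  rw [abs_of_pos two_pi_pos] at h0
  rw [← one_smul ℝ (∫ a, _ * (𝓕 g : L2) a), ← inv_mul_cancel₀ two_pi_pos.ne', mul_smul,
    ← h0, ← integral_smul]
  refine integral_congr_ae (Filter.Eventually.of_forall fun ξ => ?_)
  have h6 : ((Real.sqrt (2 * Real.pi))⁻¹ : ℝ) * (Real.sqrt (2 * Real.pi))⁻¹ = (2 * Real.pi)⁻¹ := by
    rw [← mul_inv, Real.mul_self_sqrt two_pi_pos.le]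
  simp only [map_mul, Complex.conj_ofReal, Complex.real_smul]
  rw [← h6]
  push_cast
  ring

/-- Multiplication by `x` corresponds to `i ∂_ξ`, in the weak sense. -/
theorem integral_mul_hat_eq_of_mul_id {u y : L2} (hy : y =ᵐ[volume] fun x : ℝ => (x : ℂ) * u x)
    {p p' : ℝ → ℂ} (hp : ∀ ξ, HasDerivAt p (p' ξ) ξ) (hp' : Continuous p')
    (hc : HasCompactSupport p) :
    ∫ ξ, p ξ * hat y ξ = -Complex.I * ∫ ξ, p' ξ * hat u ξ := by
  have hpc : Continuous p := continuous_iff_continuousAt.2 fun ξ => (hp ξ).continuousAt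
  have hderiv : deriv p = p' := funext fun ξ => (hp ξ).deriv
  have hc' : HasCompactSupport p' := hderiv ▸ hc.deriv
  have cc : ∀ {k : ℝ → ℂ}, HasCompactSupport k → HasCompactSupport (fun ξ => (starRingEnd ℂ) (k ξ)) :=
    fun h => h.comp_left (map_zero _)
  have ccc : ∀ {k : ℝ → ℂ}, Continuous k → Continuous (fun ξ => (starRingEnd ℂ) (k ξ)) :=
    fun h => Complex.continuous_conj.comp h
  obtain ⟨P, hP⟩ := exists_hat_eq ((ccc hpc).memLp_of_hasCompactSupport (cc hc) :
    MemLp (fun ξ => (starRingEnd ℂ) (p ξ)) 2 volume)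
  obtain ⟨P', hP'⟩ := exists_hat_eq ((ccc hp').memLp_of_hasCompactSupport (cc hc') :
    MemLp (fun ξ => (starRingEnd ℂ) (p' ξ)) 2 volume)
  have hPs := coeFn_eq_synth hP ((ccc hpc).integrable_of_hasCompactSupport (cc hc))
  have hPs' := coeFn_eq_synth hP' ((ccc hp').integrable_of_hasCompactSupport (cc hc'))
  -- The classical integration by parts is done on the test function, which is C¹ with compact
  -- support; Parseval then transfers it to `hat y` and `hat u`, which have no regularity.
  have key : ∀ x : ℝ, synth (fun ξ => (starRingEnd ℂ) (p' ξ)) x =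
      -(Complex.I * x) * synth (fun ξ => (starRingEnd ℂ) (p ξ)) x := by
    intro x
    have he : ∀ ξ : ℝ, HasDerivAt (fun ξ : ℝ => Complex.exp (Complex.I * ((x * ξ : ℝ) : ℂ)))
        (Complex.exp (Complex.I * ((x * ξ : ℝ) : ℂ)) * (Complex.I * x)) ξ := by
      intro ξ
      have h1 : HasDerivAt (fun ξ : ℝ => ((x * ξ : ℝ) : ℂ)) (x : ℂ) ξ := by
        simpa using ((hasDerivAt_id ξ).const_mul x).ofReal_comp
      exact (h1.const_mul Complex.I).cexp
    have hcj : ∀ ξ, HasDerivAt (fun ξ => (starRingEnd ℂ) (p ξ)) ((starRingEnd ℂ) (p' ξ)) ξ :=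
      fun ξ => (hp ξ).star
    have hce : Continuous (fun ξ : ℝ => Complex.exp (Complex.I * ((x * ξ : ℝ) : ℂ))) := by fun_prop
    have i1 : Integrable (fun ξ => (starRingEnd ℂ) (p ξ) *
        Complex.exp (Complex.I * ((x * ξ : ℝ) : ℂ))) :=
      ((ccc hpc).mul hce).integrable_of_hasCompactSupport (cc hc).mul_right
    have i2 : Integrable (fun ξ => (starRingEnd ℂ) (p' ξ) *
        Complex.exp (Complex.I * ((x * ξ : ℝ) : ℂ))) :=
      ((ccc hp').mul hce).integrable_of_hasCompactSupport (cc hc').mul_right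
    have i3 : Integrable (fun ξ => (starRingEnd ℂ) (p ξ) *
        (Complex.exp (Complex.I * ((x * ξ : ℝ) : ℂ)) * (Complex.I * x))) := by
      simpa [mul_assoc] using i1.mul_const (Complex.I * x)
    have := integral_eq_zero_of_hasDerivAt_of_integrable
      (fun ξ => (hcj ξ).mul (he ξ)) (i2.add i3) i1
    rw [integral_add i2 i3] at this
    simp only [synth]
    rw [eq_neg_of_add_eq_zero_left this, ← mul_assoc, mul_comm (-(Complex.I * x)), mul_assoc]
    congr 1
    rw [← integral_const_mul, ← integral_neg]
    refine integral_congr_ae (Filter.Eventually.of_forall fun ξ => ?_)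
    simp only
    ring
  have e1 : ∫ ξ, p ξ * hat y ξ = ∫ x, (starRingEnd ℂ) (P x) * y x := by
    rw [← integral_conj_hat_mul_hat]
    refine integral_congr_ae ?_
    filter_upwards [hP] with ξ hξ
    rw [hξ, Complex.conj_conj]
  have e2 : ∫ ξ, p' ξ * hat u ξ = ∫ x, (starRingEnd ℂ) (P' x) * u x := by
    rw [← integral_conj_hat_mul_hat]
    refine integral_congr_ae ?_
    filter_upwards [hP'] with ξ hξ
    rw [hξ, Complex.conj_conj]
  rw [e1, e2, ← integral_const_mul]
  refine integral_congr_ae ?_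
  filter_upwards [hPs, hPs', hy] with x h1 h2 h3
  rw [h1, h2, h3, key]
  simp only [map_mul, map_neg, Complex.conj_I, Complex.conj_ofReal]
  linear_combination ((x : ℂ) * (starRingEnd ℂ) (synth (fun ξ => (starRingEnd ℂ) (p ξ)) x) * u x) *
    Complex.I_mul_I

/-! ### The X norm on the frequency side -/

/-- A frequency profile `h` supported in `[-R, R]` such that `ℓ = i ∂_ξ h - t a' h` (weakly) is
square integrable with support in `[-R, R]`; here `d` stands for `a'`. -/
structure FreqData (R t : ℝ) (d : ℝ → ℝ) (h ℓ : ℝ → ℂ) : Prop where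
  memLp : MemLp h 2 volume
  memLp' : MemLp ℓ 2 volume
  supp : ∀ ξ, R < |ξ| → h ξ = 0
  supp' : ∀ ξ, R < |ξ| → ℓ ξ = 0
  ibp : ∀ p p' : ℝ → ℂ, (∀ ξ, HasDerivAt p (p' ξ) ξ) → Continuous p' →
    ∫ ξ, p ξ * (ℓ ξ + t * d ξ * h ξ) = -Complex.I * ∫ ξ, p' ξ * h ξ

theorem memLp_integrable_of_supp {R : ℝ} {k : ℝ → ℂ} (hk : MemLp k 2 volume)
    (hs : ∀ ξ, R < |ξ| → k ξ = 0) : Integrable k := by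
  have h1 : IntegrableOn k (Icc (-R) R) := by
    have : MemLp k 2 (volume.restrict (Icc (-R) R)) := hk.restrict _
    exact this.integrable (by norm_num)
  refine (integrableOn_iff_integrable_of_support_subset fun ξ hξ => ?_).1 h1
  rw [mem_Icc, ← abs_le]
  by_contra hcon
  exact hξ (hs ξ (not_le.1 hcon))

theorem hat_add (f g : L2) : hat (f + g) =ᵐ[volume] fun ξ => hat f ξ + hat g ξ := by
  have : (𝓕 (f + g) : L2) =ᵐ[volume] (fun ξ => (𝓕 f : L2) ξ + (𝓕 g : L2) ξ) := by
    rw [FourierTransform.fourier_add]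
    exact Lp.coeFn_add _ _
  refine (hat_ae_eq this).trans (Filter.Eventually.of_forall fun ξ => ?_)
  simp only [hat]
  ring

theorem hat_smul (c : ℂ) (f : L2) : hat (c • f) =ᵐ[volume] fun ξ => c * hat f ξ := by
  have : (𝓕 (c • f) : L2) =ᵐ[volume] (fun ξ => c * (𝓕 f : L2) ξ) := by
    rw [FourierTransform.fourier_smul]
    exact Lp.coeFn_smul _ _
  refine (hat_ae_eq this).trans (Filter.Eventually.of_forall fun ξ => ?_)
  simp only [hat]
  ring

/-- Since g and xu - tg are in L², so is xu, and its transform is weakly i∂_ξ û. Weak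
differentiation does not enlarge supports, so the transform of Lu also lives in [-R,R]. Cutting both
transforms off sharply makes the support conditions hold everywhere rather than almost everywhere.
-/
theorem exists_freqData_of_multiplier {R t : ℝ} (hR : 0 ≤ R) {d : ℝ → ℝ} {u g : L2}
    (hu : FreqLocalized R u) (hg : IsMultiplier d u g)
    (hL : MemLp (fun x : ℝ => (x : ℂ) * u x - (t : ℂ) * g x) 2 volume) :
    ∃ h ℓ, FreqData R t d h ℓ ∧ hat u =ᵐ[volume] h ∧ hat hL.toLp =ᵐ[volume] ℓ := by
  have hS : MeasurableSet (Icc (-R) R) := measurableSet_Icc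
  have hnm : ∀ {ξ : ℝ}, R < |ξ| → ξ ∉ Icc (-R) R := fun {ξ} h => by
    rw [mem_Icc, ← abs_le]; exact not_le.2 h
  set w : L2 := hL.toLp with hw
  set y : L2 := w + (t : ℂ) • g with hy
  have hyx : y =ᵐ[volume] fun x : ℝ => (x : ℂ) * u x := by
    filter_upwards [Lp.coeFn_add w ((t : ℂ) • g), Lp.coeFn_smul (t : ℂ) g, hL.coeFn_toLp]
      with x h1 h2 h3
    rw [hy, h1, Pi.add_apply, h2, hw, h3]
    simp
  have haty : hat y =ᵐ[volume] fun ξ => hat w ξ + t * d ξ * hat u ξ := by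
    filter_upwards [hat_add w ((t : ℂ) • g), hat_smul (t : ℂ) g, hg] with ξ h1 h2 h3
    rw [hy, h1, h2, h3, mul_assoc]
  have hz : ∀ᵐ ξ : ℝ, ξ ∈ {ξ : ℝ | R < |ξ|} → hat y ξ = 0 := by
    refine IsOpen.ae_eq_zero_of_integral_contDiff_smul_eq_zero
      (isOpen_lt continuous_const continuous_abs)
      (((memLp_hat y).locallyIntegrable (by norm_num)).locallyIntegrableOn _) fun b hb hbc hbs => ?_
    have hb1 : ∀ ξ, HasDerivAt (fun ξ => (b ξ : ℂ)) ((deriv b ξ : ℝ) : ℂ) ξ := fun ξ =>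
      ((hb.differentiable (by simp)) ξ).hasDerivAt.ofReal_comp
    have := integral_mul_hat_eq_of_mul_id hyx hb1
      (Complex.continuous_ofReal.comp (hb.continuous_deriv (by simp)))
      (hbc.comp_left (g := fun x : ℝ => (x : ℂ)) rfl)
    simp only [Complex.real_smul]
    rw [this]
    have : ∫ ξ, ((deriv b ξ : ℝ) : ℂ) * hat u ξ = 0 := by
      refine integral_eq_zero_of_ae ?_
      filter_upwards [hu] with ξ hξ
      by_cases h : R < |ξ|
      · simp [hξ h]
      · have : ξ ∉ tsupport (deriv b) := fun hx => h (hbs (tsupport_deriv_subset hx))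
        simp [image_eq_zero_of_notMem_tsupport this]
    rw [this, mul_zero]
  have hwz : ∀ᵐ ξ : ℝ, R < |ξ| → hat w ξ = 0 := by
    filter_upwards [hz, haty, hu] with ξ h1 h2 h3 h
    have := h1 h
    rw [h2, h3 h] at this
    simpa using this
  have eqi : ∀ {k : ℝ → ℂ}, (∀ᵐ ξ : ℝ, R < |ξ| → k ξ = 0) → k =ᵐ[volume] (Icc (-R) R).indicator k := by
    intro k hk
    filter_upwards [hk] with ξ hξ
    by_cases h : R < |ξ|
    · rw [hξ h, indicator_of_notMem (hnm h)]
    · rw [indicator_of_mem (by rw [mem_Icc, ← abs_le]; exact not_lt.1 h)]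
  refine ⟨(Icc (-R) R).indicator (hat u), (Icc (-R) R).indicator (hat w),
    ⟨(memLp_hat u).indicator hS, (memLp_hat w).indicator hS,
      fun ξ h => indicator_of_notMem (hnm h) _, fun ξ h => indicator_of_notMem (hnm h) _, ?_⟩,
      eqi hu, eqi hwz⟩
  intro p p' hp hp'
  -- The test function p need not have compact support. Multiplication by a bump equal to 1 near
  -- [-R,R] changes neither integral: û and the transform of xu vanish outside the band, and the
  -- derivative of the bump vanishes on it.
  let ζ : ContDiffBump (0 : ℝ) := ⟨R + 1, R + 2, by linarith, by linarith⟩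
  have hζd : ∀ ξ, HasDerivAt (fun ξ => (ζ ξ : ℂ)) ((deriv ζ ξ : ℝ) : ℂ) ξ := fun ξ =>
    ((ζ.contDiff (n := 1)).differentiable (by simp) ξ).hasDerivAt.ofReal_comp
  have hpc : Continuous p := continuous_iff_continuousAt.2 fun ξ => (hp ξ).continuousAt
  have hζ1 : ∀ ξ, ¬ R < |ξ| → ζ ξ = 1 := fun ξ h =>
    ζ.one_of_mem_closedBall (by simp [ζ]; linarith)
  have hζ0 : ∀ ξ, ¬ R < |ξ| → deriv ζ ξ = 0 := by
    intro ξ h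
    have : (ζ : ℝ → ℝ) =ᶠ[nhds ξ] fun _ => 1 :=
      ζ.eventuallyEq_one_of_mem_ball (by simp [ζ]; linarith)
    rw [this.deriv_eq]; simp
  have := integral_mul_hat_eq_of_mul_id hyx (fun ξ => (hζd ξ).mul (hp ξ))
    (by
      have := ζ.continuous
      have h2 : Continuous (deriv ζ) := (ζ.contDiff (n := 1)).continuous_deriv (by simp)
      fun_prop)
    ((ζ.hasCompactSupport.comp_left (g := fun x : ℝ => (x : ℂ)) rfl).mul_right)
  convert this using 1
  · refine integral_congr_ae ?_
    filter_upwards [haty, hz, eqi hu, eqi hwz] with ξ h1 h2 h3 h4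
    rw [← h3, ← h4]
    by_cases h : R < |ξ|
    · have h5 := h2 h
      rw [h1] at h5
      simp only [Pi.mul_apply]
      rw [h1, h5]; simp
    · simp only [Pi.mul_apply]
      rw [hζ1 ξ h, h1]; simp
  · congr 1
    refine integral_congr_ae ?_
    filter_upwards [hu, eqi hu] with ξ h2 h3
    rw [← h3]
    by_cases h : R < |ξ|
    · rw [h2 h]; simp
    · rw [hζ0 ξ h, hζ1 ξ h]; simp

/-- Frequency side description of a frequency localized function with finite `X` norm. -/
theorem exists_freqData {R t N : ℝ} (hR : 0 ≤ R) {a : ℝ → ℝ} {u : L2}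
    (hu : FreqLocalized R u) (hX : xNorm a t u ≤ ENNReal.ofReal N) :
    ∃ h ℓ, FreqData R t (deriv a) h ℓ ∧ hat u =ᵐ[volume] h ∧
      eLpNorm h 2 volume ≤ ENNReal.ofReal N ∧ eLpNorm ℓ 2 volume ≤ ENNReal.ofReal N := by
  -- An infimum over the empty family is ∞, so a finite X norm supplies A'(D)u; it is unique because
  -- it is recovered from its band-limited transform, and the infimum is then its single value.
  have hne : ∃ g, IsMultiplier (deriv a) u g := by
    by_contra hcon
    push Not at hcon
    have : xNorm a t u = (⊤ : ℝ≥0∞) := by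
      simp only [xNorm]
      simp [hcon]
    rw [this] at hX
    exact absurd hX (by simp)
  obtain ⟨g, hg⟩ := hne
  have hint : ∀ g', IsMultiplier (deriv a) u g' → Integrable (hat g') := by
    intro g' hg'
    have : hat g' =ᵐ[volume] (Icc (-R) R).indicator (hat g') := by
      filter_upwards [hg', hu] with ξ h1 h2
      by_cases h : R < |ξ|
      · rw [h1, h2 h, indicator_of_notMem (by rw [mem_Icc, ← abs_le]; exact not_le.2 h)]
        simp
      · rw [indicator_of_mem (by rw [mem_Icc, ← abs_le]; exact not_lt.1 h)]
    refine Integrable.congr (memLp_integrable_of_supp (R := R)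
      ((memLp_hat g').indicator measurableSet_Icc) fun ξ h => ?_) this.symm
    exact indicator_of_notMem (by rw [mem_Icc, ← abs_le]; exact not_le.2 h) _
  have huniq : ∀ g', IsMultiplier (deriv a) u g' → g' = g := by
    intro g' hg'
    refine Lp.ext ?_
    have h1 : hat g' =ᵐ[volume] hat g := hg'.trans hg.symm
    exact (coeFn_eq_synth h1 (hint g hg)).trans (coeFn_eq_synth Filter.EventuallyEq.rfl (hint g hg)).symm
  have hval : (eLpNorm u 2 volume ^ 2 + eLpNorm (fun x : ℝ => (x : ℂ) * u x - (t : ℂ) * g x) 2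
      volume ^ 2) ^ (1 / 2 : ℝ) ≤ ENNReal.ofReal N := by
    refine le_trans (le_iInf₂ fun g' hg' => ?_) hX
    rw [huniq g' hg']
  have hroot : ∀ e : ℝ≥0∞, (e ^ 2) ^ (1 / 2 : ℝ) = e := by
    intro e
    rw [← ENNReal.rpow_natCast, ← ENNReal.rpow_mul]
    norm_num
  have h1 : eLpNorm u 2 volume ≤ ENNReal.ofReal N := by
    refine le_trans ?_ hval
    conv_lhs => rw [← hroot (eLpNorm u 2 volume)]
    exact ENNReal.rpow_le_rpow le_self_add (by norm_num)
  have h2 : eLpNorm (fun x : ℝ => (x : ℂ) * u x - (t : ℂ) * g x) 2 volume ≤ ENNReal.ofReal N := by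
    refine le_trans ?_ hval
    conv_lhs => rw [← hroot (eLpNorm _ 2 volume)]
    exact ENNReal.rpow_le_rpow le_add_self (by norm_num)
  have hL : MemLp (fun x : ℝ => (x : ℂ) * u x - (t : ℂ) * g x) 2 volume := by
    refine ⟨?_, h2.trans_lt ENNReal.ofReal_lt_top⟩
    have := Lp.aestronglyMeasurable u
    have := Lp.aestronglyMeasurable g
    have h3 : Continuous (fun x : ℝ => (x : ℂ)) := Complex.continuous_ofReal
    have := h3.aestronglyMeasurable (μ := (volume : Measure ℝ))
    fun_prop
  obtain ⟨h, ℓ, hd, e1, e2⟩ := exists_freqData_of_multiplier (t := t) hR hu hg hL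
  refine ⟨h, ℓ, hd, e1, ?_, ?_⟩
  · rw [← eLpNorm_congr_ae e1, eLpNorm_hat]; exact h1
  · rw [← eLpNorm_congr_ae e2, eLpNorm_hat, eLpNorm_congr_ae hL.coeFn_toLp]; exact h2

/-! ### Minkowski's inequality and quantitative L² bounds -/

theorem eLpNorm_two_sq {α E : Type*} [MeasurableSpace α] [NormedAddCommGroup E] {μ : Measure α}
    (F : α → E) : eLpNorm F 2 μ ^ 2 = ∫⁻ x, ‖F x‖ₑ ^ 2 ∂μ := by
  have := eLpNorm_nnreal_pow_eq_lintegral (μ := μ) (f := F) (p := 2) (by norm_num)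
  simpa using this

/-- Cauchy–Schwarz for the measure κ dν, obtained by splitting κ f as √κ · (√κ f). -/
theorem sq_lintegral_mul_le {Z : Type*} [MeasurableSpace Z] {ν : Measure Z} {κ f : Z → ℝ≥0∞}
    (hκ : AEMeasurable κ ν) (hf : AEMeasurable f ν) :
    (∫⁻ z, κ z * f z ∂ν) ^ 2 ≤ (∫⁻ z, κ z ∂ν) * ∫⁻ z, κ z * f z ^ 2 ∂ν := by
  have hr : ∀ e : ℝ≥0∞, e ^ (1 / 2 : ℝ) * e ^ (1 / 2 : ℝ) = e := fun e => by
    rw [← ENNReal.rpow_add_of_nonneg _ _ (by norm_num) (by norm_num)]; norm_num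
  have hr2 : ∀ e : ℝ≥0∞, (e ^ (1 / 2 : ℝ)) ^ (2 : ℝ) = e := fun e => by
    rw [← ENNReal.rpow_mul]; norm_num
  have h := ENNReal.lintegral_mul_le_Lp_mul_Lq ν (p := 2) (q := 2)
    ⟨by norm_num, by norm_num, by norm_num⟩ (hκ.pow_const (1 / 2 : ℝ))
    ((hκ.pow_const (1 / 2 : ℝ)).mul hf)
  simp only [Pi.mul_apply] at h
  have e1 : ∀ z, κ z ^ (1 / 2 : ℝ) * (κ z ^ (1 / 2 : ℝ) * f z) = κ z * f z := fun z => by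
    rw [← mul_assoc, hr]
  have e2 : ∀ z, (κ z ^ (1 / 2 : ℝ) * f z) ^ (2 : ℝ) = κ z * f z ^ 2 := fun z => by
    rw [ENNReal.mul_rpow_of_nonneg _ _ (by norm_num), hr2]
    norm_num
  simp only [e1, e2, hr2] at h
  calc _ ≤ _ := pow_le_pow_left' h 2
    _ = _ := by
      rw [← ENNReal.rpow_natCast, ENNReal.mul_rpow_of_nonneg _ _ (by norm_num)]
      simp only [Nat.cast_ofNat, hr2]

/-- Minkowski's integral inequality for a weighted family, in Cauchy–Schwarz form. -/
theorem eLpNorm_integral_mul_le {Z : Type*} [MeasurableSpace Z] {ν : Measure Z} [SFinite ν]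
    {κ : Z → ℝ} {F : Z → ℝ → ℂ} (hκ : AEStronglyMeasurable κ ν)
    (hF : AEStronglyMeasurable (Function.uncurry F) (ν.prod volume)) {c : Z → ℝ} {A B : ℝ}
    (hA0 : 0 ≤ A)
    (hc : ∀ z, eLpNorm (F z) 2 volume ≤ ENNReal.ofReal (c z))
    (hA : ∫⁻ z, ‖κ z‖ₑ ∂ν ≤ ENNReal.ofReal A)
    (hB : ∫⁻ z, ‖κ z‖ₑ * ENNReal.ofReal (c z) ^ 2 ∂ν ≤ ENNReal.ofReal B) :
    eLpNorm (fun x => ∫ z, κ z * ‖F z x‖ ∂ν) 2 volume ≤ ENNReal.ofReal (Real.sqrt (A * B)) := by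
  have hFs : AEStronglyMeasurable (fun p : ℝ × Z => F p.2 p.1) (volume.prod ν) := hF.prod_swap
  have hsec : ∀ᵐ x : ℝ, AEStronglyMeasurable (fun z => F z x) ν := hFs.prodMk_left
  have h1 : eLpNorm (fun x => ∫ z, κ z * ‖F z x‖ ∂ν) 2 volume ^ 2 ≤
      ENNReal.ofReal A * ENNReal.ofReal B := by
    rw [eLpNorm_two_sq]
    calc ∫⁻ x, ‖∫ z, κ z * ‖F z x‖ ∂ν‖ₑ ^ 2
        ≤ ∫⁻ x, ENNReal.ofReal A * ∫⁻ z, ‖κ z‖ₑ * ‖F z x‖ₑ ^ 2 ∂ν := by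
          refine lintegral_mono_ae ?_
          filter_upwards [hsec] with x hx
          calc ‖∫ z, κ z * ‖F z x‖ ∂ν‖ₑ ^ 2 ≤ (∫⁻ z, ‖κ z * ‖F z x‖‖ₑ ∂ν) ^ 2 :=
                pow_le_pow_left' (enorm_integral_le_lintegral_enorm _) 2
            _ = (∫⁻ z, ‖κ z‖ₑ * ‖F z x‖ₑ ∂ν) ^ 2 := by simp only [enorm_mul, enorm_norm]
            _ ≤ _ := sq_lintegral_mul_le hκ.enorm hx.enorm
            _ ≤ _ := by gcongr
      _ = ENNReal.ofReal A * ∫⁻ x, ∫⁻ z, ‖κ z‖ₑ * ‖F z x‖ₑ ^ 2 ∂ν := by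
          rw [lintegral_const_mul' _ _ ENNReal.ofReal_ne_top]
      _ = ENNReal.ofReal A * ∫⁻ z, ∫⁻ x, ‖κ z‖ₑ * ‖F z x‖ₑ ^ 2 ∂volume ∂ν := by
          rw [lintegral_lintegral_swap]
          exact ((hκ.enorm.comp_quasiMeasurePreserving
            Measure.quasiMeasurePreserving_snd).mul (hFs.enorm.pow_const 2))
      _ ≤ ENNReal.ofReal A * ∫⁻ z, ‖κ z‖ₑ * ENNReal.ofReal (c z) ^ 2 ∂ν := by
          gcongr with z
          rw [lintegral_const_mul' _ _ (by simp), ← eLpNorm_two_sq]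
          gcongr
          exact hc z
      _ ≤ _ := by gcongr
  rw [← ENNReal.ofReal_mul hA0] at h1
  rw [Real.sqrt_eq_rpow]
  -- No sign is imposed on B; when A * B < 0 the estimate already forces the left side to be zero.
  by_cases hAB : 0 ≤ A * B
  · rw [← ENNReal.ofReal_rpow_of_nonneg hAB (by norm_num)]
    calc _ = (eLpNorm (fun x => ∫ z, κ z * ‖F z x‖ ∂ν) 2 volume ^ 2) ^ (1 / 2 : ℝ) := by
          rw [← ENNReal.rpow_natCast, ← ENNReal.rpow_mul]
          norm_num
      _ ≤ _ := ENNReal.rpow_le_rpow h1 (by norm_num)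
  · rw [ENNReal.ofReal_of_nonpos (not_le.1 hAB).le] at h1
    have : eLpNorm (fun x => ∫ z, κ z * ‖F z x‖ ∂ν) 2 volume = 0 := by
      simpa using h1
    rw [this]; simp

/-- `F` is measurable with `L²` norm at most `c`. -/
def L2Bound (F : ℝ → ℂ) (c : ℝ) : Prop :=
  AEStronglyMeasurable F volume ∧ eLpNorm F 2 volume ≤ ENNReal.ofReal c

theorem L2Bound.memLp {F : ℝ → ℂ} {c : ℝ} (h : L2Bound F c) : MemLp F 2 volume :=
  ⟨h.1, h.2.trans_lt ENNReal.ofReal_lt_top⟩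

theorem L2Bound.mono {F : ℝ → ℂ} {c c' : ℝ} (h : L2Bound F c) (hc : c ≤ c') : L2Bound F c' :=
  ⟨h.1, h.2.trans (ENNReal.ofReal_le_ofReal hc)⟩

theorem L2Bound.add {F G : ℝ → ℂ} {c d : ℝ} (hF : L2Bound F c) (hG : L2Bound G d) (hc : 0 ≤ c)
    (hd : 0 ≤ d) : L2Bound (fun x => F x + G x) (c + d) :=
  ⟨hF.1.add hG.1, by
    rw [ENNReal.ofReal_add hc hd]
    exact (eLpNorm_add_le hF.1 hG.1 (by norm_num)).trans (add_le_add hF.2 hG.2)⟩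

theorem L2Bound.of_le {F G : ℝ → ℂ} {b c : ℝ} (hF : L2Bound F c) (hG : AEStronglyMeasurable G volume)
    (hb : 0 ≤ b) (h : ∀ x, ‖G x‖ ≤ b * ‖F x‖) : L2Bound G (b * c) :=
  ⟨hG, by
    rw [ENNReal.ofReal_mul hb]
    exact (eLpNorm_le_mul_eLpNorm_of_ae_le_mul (Filter.Eventually.of_forall h) 2).trans
      (by gcongr; exact hF.2)⟩

theorem L2Bound.const_mul {F : ℝ → ℂ} {c : ℝ} (hF : L2Bound F c) (b : ℂ) :
    L2Bound (fun x => b * F x) (‖b‖ * c) :=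
  hF.of_le (hF.1.const_mul b) (norm_nonneg b) fun x => by rw [norm_mul]

/-! ### Operators with x-dependent symbols on band-limited functions -/

/-- The operator with symbol `σ` applied to the function with Fourier transform `h`. -/
noncomputable def op (h : ℝ → ℂ) (σ : ℝ → ℝ → ℂ) (x : ℝ) : ℂ :=
  synth (fun ξ => σ x ξ * h ξ) x

theorem aestronglyMeasurable_synth {Y : Type*} [MeasurableSpace Y] {μ : Measure Y} [SFinite μ]
    {F : Y → ℝ → ℂ} {g : Y → ℝ} (hF : AEStronglyMeasurable (Function.uncurry F) (μ.prod volume))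
    (hg : Measurable g) :
    AEStronglyMeasurable (fun p => synth (F p) (g p)) μ := by
  have : AEStronglyMeasurable (fun p : Y × ℝ => F p.1 p.2 *
      Complex.exp (Complex.I * ((g p.1 * p.2 : ℝ) : ℂ))) (μ.prod volume) := by
    refine hF.mul (Measurable.aestronglyMeasurable ?_)
    fun_prop
  exact (this.integral_prod_right').const_mul _

theorem aestronglyMeasurable_op {h : ℝ → ℂ} {σ : ℝ → ℝ → ℂ} (hh : AEStronglyMeasurable h volume)
    (hσ : Continuous (Function.uncurry σ)) : AEStronglyMeasurable (op h σ) volume := by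
  refine aestronglyMeasurable_synth (F := fun x ξ => σ x ξ * h ξ) ?_ measurable_id
  exact hσ.aestronglyMeasurable.mul
    (hh.comp_quasiMeasurePreserving Measure.quasiMeasurePreserving_snd)

theorem norm_cexp_I_mul (x : ℝ) : ‖Complex.exp (Complex.I * (x : ℂ))‖ = 1 := by
  rw [mul_comm]; exact Complex.norm_exp_ofReal_mul_I x

theorem l2Bound_synth {k : ℝ → ℂ} {N : ℝ} (hk : MemLp k 2 volume) (hi : Integrable k)
    (hN : eLpNorm k 2 volume ≤ ENNReal.ofReal N) : L2Bound (synth k) N := by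
  refine ⟨?_, by rw [eLpNorm_synth hk hi]; exact hN⟩
  exact aestronglyMeasurable_synth (F := fun _ ξ => k ξ) (g := fun x => x)
    (hk.1.comp_quasiMeasurePreserving Measure.quasiMeasurePreserving_snd) measurable_id

theorem Integrable.mul_cexp {k : ℝ → ℂ} (hk : Integrable k) (x : ℝ) :
    Integrable (fun ξ : ℝ => k ξ * Complex.exp (Complex.I * ((x * ξ : ℝ) : ℂ))) := by
  refine hk.mul_bdd (c := 1) (Continuous.aestronglyMeasurable (by fun_prop))
    (Filter.Eventually.of_forall fun ξ => (norm_cexp_I_mul _).le)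

/-- A symbol is recovered from its left end point and sharp frequency projections. -/
theorem op_eq_add_integral {R : ℝ} {h : ℝ → ℂ} (hh : Integrable h)
    (hs : ∀ ξ, R < |ξ| → h ξ = 0) {σ σ₁ : ℝ → ℝ → ℂ} (hσ₁ : Continuous (Function.uncurry σ₁))
    (hd : ∀ x ξ, HasDerivAt (σ x) (σ₁ x ξ) ξ) (x : ℝ) :
    op h σ x = σ x (-R) * synth h x +
      ∫ η in Icc (-R) R, σ₁ x η * synth ((Ici η).indicator h) x := by
  have hc1 : Continuous (σ₁ x) := hσ₁.comp (by fun_prop : Continuous fun ξ : ℝ => (x, ξ))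
  set e : ℝ → ℂ := fun ξ => Complex.exp (Complex.I * ((x * ξ : ℝ) : ℂ)) with he
  have hhe : Integrable (fun ξ => h ξ * e ξ) := Integrable.mul_cexp hh x
  -- The fundamental theorem of calculus on [-R,ξ], with the constraint η ≤ ξ moved from the domain
  -- of integration onto h as a sharp frequency projection.
  have hrep : ∀ ξ, σ x ξ * h ξ * e ξ = σ x (-R) * (h ξ * e ξ) +
      ∫ η in Icc (-R) R, σ₁ x η * ((Ici η).indicator h ξ * e ξ) := by
    intro ξ
    by_cases hξ : R < |ξ|
    · have : ∀ η, (Ici η).indicator h ξ = 0 := fun η => by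
        by_cases h2 : ξ ∈ Ici η
        · rw [indicator_of_mem h2, hs ξ hξ]
        · rw [indicator_of_notMem h2]
      simp [this, hs ξ hξ]
    · have hξ' := abs_le.1 (not_lt.1 hξ)
      have h1 : ∀ η, σ₁ x η * ((Ici η).indicator h ξ * e ξ) =
          (Iic ξ).indicator (σ₁ x) η * (h ξ * e ξ) := by
        intro η
        by_cases h2 : η ≤ ξ
        · rw [indicator_of_mem (mem_Ici.2 h2), indicator_of_mem (mem_Iic.2 h2)]
        · rw [indicator_of_notMem (by simpa using h2), indicator_of_notMem (by simpa using h2)]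
          simp
      simp only [h1]
      rw [integral_mul_const, setIntegral_indicator measurableSet_Iic,
        show Icc (-R) R ∩ Iic ξ = Icc (-R) ξ by
          ext η; simp only [mem_inter_iff, mem_Icc, mem_Iic]
          exact ⟨fun h => ⟨h.1.1, h.2⟩, fun h => ⟨⟨h.1, h.2.trans hξ'.2⟩, h.2⟩⟩,
        integral_Icc_eq_integral_Ioc, ← intervalIntegral.integral_of_le hξ'.1,
        intervalIntegral.integral_eq_sub_of_hasDerivAt (fun η _ => hd x η)
          (hc1.intervalIntegrable _ _)]
      ring
  have hprod : Integrable (Function.uncurry fun ξ η => σ₁ x η * ((Ici η).indicator h ξ * e ξ))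
      (volume.prod (volume.restrict (Icc (-R) R))) := by
    have hb : Integrable (fun p : ℝ × ℝ => (h p.1 * e p.1) * σ₁ x p.2)
        (volume.prod (volume.restrict (Icc (-R) R))) :=
      hhe.mul_prod (hc1.integrableOn_Icc)
    have hS : MeasurableSet {p : ℝ × ℝ | p.2 ≤ p.1} := measurableSet_le measurable_snd measurable_fst
    refine (hb.indicator hS).congr (Filter.Eventually.of_forall fun p => ?_)
    simp only [Function.uncurry, indicator, mem_ofPred_eq, mem_Ici]
    split_ifs
    · ring
    · simp
  simp only [op, synth]
  have hI1 : Integrable (fun ξ => σ x (-R) * (h ξ * e ξ)) := hhe.const_mul _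
  have hI2 : Integrable (fun ξ => ∫ η in Icc (-R) R, σ₁ x η * ((Ici η).indicator h ξ * e ξ)) :=
    hprod.integral_prod_left
  rw [integral_congr_ae (Filter.Eventually.of_forall hrep), integral_add hI1 hI2,
    integral_const_mul, mul_add, integral_integral_swap hprod]
  simp only [integral_const_mul]
  congr 1
  · rw [he]; ring
  · rw [← integral_const_mul]
    refine integral_congr_ae (Filter.Eventually.of_forall fun η => ?_)
    simp only
    ring

/-- No almost orthogonality is needed on a bounded band. The operator is multiplication by σ(x,-R)
plus an integral over η in [-R,R] of multiplications by σ₁(x,η) composed with sharp projections. The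
projections are contractions by Plancherel and the multipliers are bounded, so one bounded
ξ-derivative suffices, with no bound on x-derivatives. -/
theorem l2Bound_op {R N B₀ B₁ : ℝ} (hR : 0 ≤ R) (hN0 : 0 ≤ N) {h : ℝ → ℂ}
    (hh : MemLp h 2 volume) (hs : ∀ ξ, R < |ξ| → h ξ = 0)
    (hN : eLpNorm h 2 volume ≤ ENNReal.ofReal N) {σ σ₁ : ℝ → ℝ → ℂ}
    (hσ : Continuous (Function.uncurry σ)) (hσ₁ : Continuous (Function.uncurry σ₁))
    (hd : ∀ x ξ, HasDerivAt (σ x) (σ₁ x ξ) ξ) (h0 : ∀ x ξ, ‖σ x ξ‖ ≤ B₀)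
    (h1 : ∀ x ξ, ‖σ₁ x ξ‖ ≤ B₁) : L2Bound (op h σ) ((B₀ + 2 * R * B₁) * N) := by
  have hi := memLp_integrable_of_supp hh hs
  have hB0 : 0 ≤ B₀ := (norm_nonneg _).trans (h0 0 0)
  have hB1 : 0 ≤ B₁ := (norm_nonneg _).trans (h1 0 0)
  refine ⟨aestronglyMeasurable_op hh.1 hσ, ?_⟩
  have hP : ∀ η, L2Bound (synth ((Ici η).indicator h)) N := fun η =>
    l2Bound_synth (hh.indicator measurableSet_Ici) (hi.indicator measurableSet_Ici)
      ((eLpNorm_indicator_le h).trans hN)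
  set ν : Measure ℝ := volume.restrict (Icc (-R) R) with hν
  have hνu : ν univ = ENNReal.ofReal (2 * R) := by
    rw [hν, Measure.restrict_apply_univ, Real.volume_Icc]; congr 1; ring
  have : IsFiniteMeasure ν := ⟨by rw [hνu]; exact ENNReal.ofReal_lt_top⟩
  have hjm : AEStronglyMeasurable (Function.uncurry fun η x => synth ((Ici η).indicator h) x)
      (ν.prod volume) := by
    refine aestronglyMeasurable_synth (Y := ℝ × ℝ) (F := fun p ξ => (Ici p.1).indicator h ξ)
      (g := Prod.snd) ?_ measurable_snd
    have hS : MeasurableSet {p : (ℝ × ℝ) × ℝ | p.1.1 ≤ p.2} :=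
      measurableSet_le (by fun_prop) (by fun_prop)
    have := (hh.1.comp_quasiMeasurePreserving
      (Measure.quasiMeasurePreserving_snd (μ := ν.prod (volume : Measure ℝ)))).indicator hS
    refine this.congr (Filter.Eventually.of_forall fun p => ?_)
    simp [indicator, Function.uncurry]
  -- Minkowski with constant weight over an η-interval of length 2R: the superposed projections have
  -- norm at most 2RN.
  have hM := eLpNorm_integral_mul_le (ν := ν) (κ := fun _ => 1)
    (F := fun η x => synth ((Ici η).indicator h) x) (c := fun _ => N) (A := 2 * R)
    (B := 2 * R * N ^ 2) aestronglyMeasurable_const hjm (by positivity)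
    (fun η => (hP η).2) (by simp [hνu]) (by
      simp only [enorm_one, one_mul, lintegral_const, hνu]
      rw [← ENNReal.ofReal_pow hN0, ← ENNReal.ofReal_mul (by positivity)]
      exact ENNReal.ofReal_le_ofReal (by linarith))
  have hsq : Real.sqrt (2 * R * (2 * R * N ^ 2)) = 2 * R * N := by
    rw [show 2 * R * (2 * R * N ^ 2) = (2 * R * N) ^ 2 by ring, Real.sqrt_sq (by positivity)]
  rw [hsq] at hM
  have hfin : ∀ᵐ x : ℝ, Integrable (fun η => synth ((Ici η).indicator h) x) ν := by
    have hjm' : AEStronglyMeasurable (fun p : ℝ × ℝ => synth ((Ici p.2).indicator h) p.1)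
      (volume.prod ν) := hjm.prod_swap
    filter_upwards [hjm'.prodMk_left] with x hx
    refine Integrable.of_bound hx ((Real.sqrt (2 * Real.pi))⁻¹ * ∫ ξ, ‖h ξ‖)
      (Filter.Eventually.of_forall fun η => ?_)
    simp only [synth, norm_mul, Complex.norm_real, Real.norm_of_nonneg
      (inv_nonneg.2 (Real.sqrt_nonneg (2 * Real.pi)))]
    gcongr
    refine norm_integral_le_of_norm_le hi.norm (Filter.Eventually.of_forall fun ξ => ?_)
    rw [norm_mul, norm_cexp_I_mul, mul_one]
    exact norm_indicator_le_norm_self _ _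
  have hdom : ∀ᵐ x : ℝ, ‖op h σ x‖ ≤ ‖((B₀ * ‖synth h x‖ : ℝ) : ℂ) +
      ((B₁ * ∫ η, 1 * ‖synth ((Ici η).indicator h) x‖ ∂ν : ℝ) : ℂ)‖ := by
    filter_upwards [hfin] with x hx
    rw [op_eq_add_integral hi hs hσ₁ hd x, ← Complex.ofReal_add, Complex.norm_real]
    have hpos : 0 ≤ ∫ η, 1 * ‖synth ((Ici η).indicator h) x‖ ∂ν :=
      integral_nonneg fun η => by positivity
    rw [Real.norm_of_nonneg (by positivity)]
    refine (norm_add_le _ _).trans (add_le_add ?_ ?_)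
    · rw [norm_mul]; gcongr; exact h0 _ _
    · rw [← integral_const_mul]
      refine norm_integral_le_of_norm_le ((hx.norm.const_mul 1).const_mul B₁)
        (Filter.Eventually.of_forall fun η => ?_)
      rw [norm_mul, one_mul]; gcongr; exact h1 _ _
  have hm2 : AEStronglyMeasurable (fun x => ∫ η, 1 * ‖synth ((Ici η).indicator h) x‖ ∂ν)
      volume := by
    have hjm' : AEStronglyMeasurable (fun p : ℝ × ℝ => 1 * ‖synth ((Ici p.2).indicator h) p.1‖)
      (volume.prod ν) := hjm.prod_swap.norm.const_mul 1
    exact hjm'.integral_prod_right'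
  have hS0 : L2Bound (synth h) N := l2Bound_synth hh hi hN
  have hX : L2Bound (fun x => ((B₀ * ‖synth h x‖ : ℝ) : ℂ)) (B₀ * N) :=
    hS0.of_le (Complex.continuous_ofReal.comp_aestronglyMeasurable (hS0.1.norm.const_mul _)) hB0
      fun x => by rw [Complex.norm_real, Real.norm_of_nonneg (by positivity)]
  have hM' : L2Bound (fun x => ((∫ η, 1 * ‖synth ((Ici η).indicator h) x‖ ∂ν : ℝ) : ℂ))
      (2 * R * N) := by
    refine ⟨Complex.continuous_ofReal.comp_aestronglyMeasurable hm2, ?_⟩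
    refine le_trans (le_of_eq ?_) hM
    exact eLpNorm_congr_norm_ae (Filter.Eventually.of_forall fun x => by simp)
  have hY : L2Bound (fun x => ((B₁ * ∫ η, 1 * ‖synth ((Ici η).indicator h) x‖ ∂ν : ℝ) : ℂ))
      (B₁ * (2 * R * N)) :=
    hM'.of_le (Complex.continuous_ofReal.comp_aestronglyMeasurable (hm2.const_mul _)) hB1
      fun x => by
        rw [Complex.norm_real, Complex.norm_real, norm_mul, Real.norm_of_nonneg hB1]
  refine (eLpNorm_mono_ae hdom).trans (((hX.add hY (by positivity) (by positivity)).2).trans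
    (le_of_eq ?_))
  congr 1; ring

/-! ### Integrals over windows moving with velocity v -/

/-- The integral of `‖F‖` over the window of half width `δ` around `v t`. -/
noncomputable def window (F : ℝ → ℂ) (t δ v : ℝ) : ℝ :=
  ∫ x in Icc (v * t - δ) (v * t + δ), ‖F x‖

theorem integrableOn_window {F : ℝ → ℂ} (hF : MemLp F 2 volume) (a b : ℝ) :
    IntegrableOn F (Icc a b) :=
  (hF.restrict (Icc a b)).integrable (by norm_num)

theorem integral_Icc_norm_le {F : ℝ → ℂ} {N : ℝ} (hF : L2Bound F N) (hN : 0 ≤ N) {a b : ℝ}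
    (hab : a ≤ b) : ∫ x in Icc a b, ‖F x‖ ≤ Real.sqrt (b - a) * N := by
  have hi := integrableOn_window hF.memLp a b
  rw [integral_norm_eq_lintegral_enorm hi.1]
  refine ENNReal.toReal_le_of_le_ofReal (by positivity) ?_
  have h1 := eLpNorm_le_eLpNorm_mul_rpow_measure_univ (μ := volume.restrict (Icc a b)) (p := 1)
    (q := 2) (f := F) (by norm_num) hi.1
  rw [eLpNorm_one_eq_lintegral_enorm] at h1
  refine h1.trans ?_
  rw [mul_comm, ENNReal.ofReal_mul (Real.sqrt_nonneg _), Real.sqrt_eq_rpow,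
    ← ENNReal.ofReal_rpow_of_nonneg (by linarith) (by norm_num)]
  gcongr
  · simp only [Measure.restrict_apply_univ, Real.volume_Icc]
    norm_num
  · exact (eLpNorm_restrict_le _ _ _ _).trans hF.2

/-- Cauchy–Schwarz on the window. With δ of size √t the factor is t^{1/4}, the whole difference
between the decay rates -5/4 and -3/2. -/
theorem window_le {F : ℝ → ℂ} {N : ℝ} (hF : L2Bound F N) (hN : 0 ≤ N) {δ : ℝ} (hδ : 0 ≤ δ)
    (t v : ℝ) : window F t δ v ≤ Real.sqrt (2 * δ) * N := by
  have := integral_Icc_norm_le hF hN (a := v * t - δ) (b := v * t + δ) (by linarith)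
  rwa [show v * t + δ - (v * t - δ) = 2 * δ by ring] at this

theorem window_eq_integral_shift (F : ℝ → ℂ) (t δ v : ℝ) :
    window F t δ v = ∫ s in Icc (-δ) δ, 1 * ‖F (v * t + s)‖ := by
  have := integral_indicator (f := fun x => ‖F x‖) (μ := volume)
    (measurableSet_Icc (a := v * t - δ) (b := v * t + δ))
  rw [window, ← this, ← integral_indicator measurableSet_Icc,
    ← integral_add_left_eq_self _ (v * t)]
  refine integral_congr_ae (Filter.Eventually.of_forall fun s => ?_)
  simp only [indicator, mem_Icc, one_mul]
  congr 1
  refine propext ⟨fun h => ⟨by linarith [h.1], by linarith [h.2]⟩,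
    fun h => ⟨by linarith [h.1], by linarith [h.2]⟩⟩

theorem eLpNorm_comp_affine {F : ℝ → ℂ} (hF : AEStronglyMeasurable F volume) {t : ℝ} (ht : 0 < t)
    (s : ℝ) : eLpNorm (fun v => F (v * t + s)) 2 volume =
      ENNReal.ofReal (t ^ (-(1 / 2) : ℝ)) * eLpNorm F 2 volume := by
  have hmap : Measure.map (fun v : ℝ => v * t + s) volume = ENNReal.ofReal t⁻¹ • volume := by
    have h1 : (fun v : ℝ => v * t + s) = (fun x => x + s) ∘ fun v => v * t := rfl
    rw [h1, ← Measure.map_map (by fun_prop) (by fun_prop), Real.map_volume_mul_right ht.ne',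
      Measure.map_smul, map_add_right_eq_self, abs_of_pos (inv_pos.2 ht)]
  have := eLpNorm_map_measure (p := 2) (μ := volume) (f := fun v : ℝ => v * t + s) (g := F)
    (by rw [hmap]; exact hF.smul_measure _) (by fun_prop)
  rw [hmap, eLpNorm_smul_measure_of_ne_top (by norm_num)] at this
  rw [show (fun v => F (v * t + s)) = F ∘ (fun v : ℝ => v * t + s) from rfl, ← this,
    ENNReal.ofReal_rpow_of_nonneg (by positivity) (by norm_num), smul_eq_mul,
    Real.inv_rpow ht.le, Real.rpow_neg ht.le]
  norm_num

/-- As a function of v the window integral is a superposition over |s| ≤ δ of translates |F(vt +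
s)|, each of L²_v norm t^{-1/2}‖F‖ by scaling. Minkowski gives 2δ t^{-1/2}‖F‖, so nothing is lost
when δ is of size √t. -/
theorem eLpNorm_window_le {F : ℝ → ℂ} {N : ℝ} (hF : L2Bound F N) (hN : 0 ≤ N) {δ t : ℝ}
    (hδ : 0 ≤ δ) (ht : 0 < t) :
    eLpNorm (window F t δ) 2 volume ≤ ENNReal.ofReal (2 * δ * (t ^ (-(1 / 2) : ℝ) * N)) := by
  set ν : Measure ℝ := volume.restrict (Icc (-δ) δ) with hν
  have hνu : ν univ = ENNReal.ofReal (2 * δ) := by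
    rw [hν, Measure.restrict_apply_univ, Real.volume_Icc]; congr 1; ring
  have : IsFiniteMeasure ν := ⟨by rw [hνu]; exact ENNReal.ofReal_lt_top⟩
  -- F is measurable only up to null sets, so (s,v) ↦ vt + s must pull null sets back to null sets
  -- before F can be composed with it.
  have hq : Measure.QuasiMeasurePreserving (fun p : ℝ × ℝ => p.2 * t + p.1) (ν.prod volume)
      volume := by
    refine ⟨by fun_prop, ?_⟩
    refine Measure.AbsolutelyContinuous.mk fun S hS h0 => ?_
    rw [Measure.map_apply (by fun_prop) hS, Measure.measure_prod_null (hS.preimage (by fun_prop))]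
    refine Filter.Eventually.of_forall fun s => ?_
    change volume ((fun v : ℝ => v * t + s) ⁻¹' S) = 0
    have hmap : Measure.map (fun v : ℝ => v * t + s) volume = ENNReal.ofReal t⁻¹ • volume := by
      have h1 : (fun v : ℝ => v * t + s) = (fun x => x + s) ∘ fun v => v * t := rfl
      rw [h1, ← Measure.map_map (by fun_prop) (by fun_prop), Real.map_volume_mul_right ht.ne',
        Measure.map_smul, map_add_right_eq_self, abs_of_pos (inv_pos.2 ht)]
    rw [← Measure.map_apply (by fun_prop) hS, hmap]
    simp [h0]
  have hM := eLpNorm_integral_mul_le (ν := ν) (κ := fun _ => 1)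
    (F := fun s v => F (v * t + s)) (c := fun _ => t ^ (-(1 / 2) : ℝ) * N) (A := 2 * δ)
    (B := 2 * δ * (t ^ (-(1 / 2) : ℝ) * N) ^ 2) aestronglyMeasurable_const
    (hF.1.comp_quasiMeasurePreserving hq) (by positivity)
    (fun s => by
      rw [eLpNorm_comp_affine hF.1 ht, ENNReal.ofReal_mul (by positivity)]
      gcongr; exact hF.2) (by simp [hνu]) (by
      simp only [enorm_one, one_mul, lintegral_const, hνu]
      rw [← ENNReal.ofReal_pow (by positivity), ← ENNReal.ofReal_mul (by positivity)]
      exact ENNReal.ofReal_le_ofReal (by linarith))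
  have hsq : Real.sqrt (2 * δ * (2 * δ * (t ^ (-(1 / 2) : ℝ) * N) ^ 2)) =
      2 * δ * (t ^ (-(1 / 2) : ℝ) * N) := by
    rw [show 2 * δ * (2 * δ * (t ^ (-(1 / 2) : ℝ) * N) ^ 2) =
      (2 * δ * (t ^ (-(1 / 2) : ℝ) * N)) ^ 2 by ring, Real.sqrt_sq (by positivity)]
  rw [hsq] at hM
  refine le_trans (le_of_eq ?_) hM
  congr 1
  ext v
  rw [window_eq_integral_shift]

/-! ### Symbols built from averages over segments, and the gain t⁻¹ for vanishing symbols -/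

section

/-- The weighted average of `G` over the segment from `p` to `ξ`. -/
noncomputable def segAvg (w : ℝ → ℝ) (G : ℝ → ℂ) (p ξ : ℝ) : ℂ :=
  ∫ s in (0 : ℝ)..1, (w s : ℂ) * G (p + s * (ξ - p))

theorem continuous_segAvg {w : ℝ → ℝ} {G : ℝ → ℂ} (hw : Continuous w) (hG : Continuous G) :
    Continuous (fun z : ℝ × ℝ => segAvg w G z.1 z.2) := by
  unfold segAvg
  refine intervalIntegral.continuous_parametric_intervalIntegral_of_continuous' ?_ 0 1
  fun_prop

theorem norm_segAvg_le {w : ℝ → ℝ} {G : ℝ → ℂ} {B : ℝ} (hw : ∀ s ∈ Icc (0 : ℝ) 1, |w s| ≤ 1)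
    (hB : ∀ ξ, ‖G ξ‖ ≤ B) (p ξ : ℝ) : ‖segAvg w G p ξ‖ ≤ B := by
  have := intervalIntegral.norm_integral_le_of_norm_le_const (a := (0 : ℝ)) (b := 1) (C := B)
    (f := fun s => (w s : ℂ) * G (p + s * (ξ - p))) ?_
  · simpa [segAvg] using this
  · intro s hs
    rw [uIoc_of_le zero_le_one] at hs
    rw [norm_mul, Complex.norm_real]
    calc _ ≤ 1 * B := by
          gcongr
          · exact hw s ⟨hs.1.le, hs.2⟩
          · exact hB _
      _ = B := one_mul B

/-- Treats both end points of the segment at once: moving either one displaces the intermediate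
point at speed at most 1, which gives the domination. -/
theorem hasDerivAt_segment_integral {w : ℝ → ℝ} {G G' : ℝ → ℂ} {B : ℝ} {ℓ ℓ' : ℝ → ℝ → ℝ}
    (hw : Continuous w) (hG : ∀ ξ, HasDerivAt G (G' ξ) ξ) (hG' : Continuous G')
    (hB : ∀ ξ, ‖G' ξ‖ ≤ B) (hℓ : Continuous (Function.uncurry ℓ))
    (hℓ' : Continuous (Function.uncurry ℓ'))
    (hd : ∀ z s, HasDerivAt (fun z => ℓ z s) (ℓ' z s) z)
    (hb : ∀ z, ∀ s ∈ Icc (0 : ℝ) 1, |ℓ' z s| ≤ 1) (z : ℝ) :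
    HasDerivAt (fun z => ∫ s in (0 : ℝ)..1, (w s : ℂ) * G (ℓ z s))
      (∫ s in (0 : ℝ)..1, (w s : ℂ) * (ℓ' z s * G' (ℓ z s))) z := by
  have hGc : Continuous G := continuous_iff_continuousAt.2 fun ξ => (hG ξ).continuousAt
  have hs : ∀ z, Continuous (fun s => ℓ z s) := fun z =>
    hℓ.comp (by fun_prop : Continuous fun s : ℝ => (z, s))
  have hs' : ∀ z, Continuous (fun s => ℓ' z s) := fun z =>
    hℓ'.comp (by fun_prop : Continuous fun s : ℝ => (z, s))
  refine (intervalIntegral.hasDerivAt_integral_of_dominated_loc_of_deriv_le (𝕜 := ℝ) (E := ℂ)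
    (μ := volume) (s := univ) (F := fun z s => (w s : ℂ) * G (ℓ z s))
    (F' := fun z s => (w s : ℂ) * (ℓ' z s * G' (ℓ z s)))
    (bound := fun s => |w s| * B)
    Filter.univ_mem (Filter.Eventually.of_forall fun z => ?_) ?_ ?_ ?_ ?_ ?_).2
  · have := hs z
    exact Continuous.aestronglyMeasurable (by fun_prop)
  · have := hs z
    exact Continuous.intervalIntegrable (by fun_prop) _ _
  · have := hs z
    have := hs' z
    exact Continuous.aestronglyMeasurable (by fun_prop)
  · refine Filter.Eventually.of_forall fun s hs x _ => ?_
    rw [uIoc_of_le zero_le_one] at hs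
    rw [norm_mul, norm_mul, Complex.norm_real, Complex.norm_real]
    refine mul_le_mul_of_nonneg_left ?_ (norm_nonneg _)
    calc _ ≤ 1 * B := by
          gcongr
          · exact hb x s ⟨hs.1.le, hs.2⟩
          · exact hB _
      _ = B := one_mul B
  · exact Continuous.intervalIntegrable (by fun_prop) _ _
  · refine Filter.Eventually.of_forall fun s _ x _ => ?_
    refine HasDerivAt.const_mul _ ?_
    exact HasDerivAt.congr_deriv ((hG (ℓ x s)).scomp x (hd x s)) (Complex.real_smul ..)

theorem hasDerivAt_segAvg_right {w : ℝ → ℝ} {G G' : ℝ → ℂ} {B : ℝ}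
    (hw : Continuous w) (hG : ∀ ξ, HasDerivAt G (G' ξ) ξ) (hG' : Continuous G')
    (hB : ∀ ξ, ‖G' ξ‖ ≤ B) (p ξ : ℝ) :
    HasDerivAt (segAvg w G p) (segAvg (fun s => s * w s) G' p ξ) ξ := by
  have := hasDerivAt_segment_integral (ℓ := fun ξ s => p + s * (ξ - p)) (ℓ' := fun _ s => s) hw hG
    hG' hB (by simp only [Function.uncurry_def]; fun_prop)
    (by simp only [Function.uncurry_def]; fun_prop)
    (fun z s => by simpa using (((hasDerivAt_id z).sub_const p).const_mul s).const_add p)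
    (fun z s hs => by rw [abs_of_nonneg hs.1]; exact hs.2) ξ
  refine HasDerivAt.congr_deriv this ?_
  simp only [segAvg]
  congr 1
  ext s
  push_cast
  ring

theorem hasDerivAt_segAvg_left {w : ℝ → ℝ} {G G' : ℝ → ℂ} {B : ℝ}
    (hw : Continuous w) (hG : ∀ ξ, HasDerivAt G (G' ξ) ξ) (hG' : Continuous G')
    (hB : ∀ ξ, ‖G' ξ‖ ≤ B) (p ξ : ℝ) :
    HasDerivAt (fun p => segAvg w G p ξ) (segAvg (fun s => (1 - s) * w s) G' p ξ) p := by
  have := hasDerivAt_segment_integral (ℓ := fun p s => p + s * (ξ - p)) (ℓ' := fun _ s => 1 - s) hw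
    hG hG' hB (by simp only [Function.uncurry_def]; fun_prop)
    (by simp only [Function.uncurry_def]; fun_prop)
    (fun z s => by
      have := (hasDerivAt_id z).add (((hasDerivAt_id z).const_sub ξ).const_mul s)
      exact HasDerivAt.congr_deriv this (by simp; ring))
    (fun z s hs => by rw [abs_of_nonneg (by linarith [hs.2])]; linarith [hs.1]) p
  refine HasDerivAt.congr_deriv this ?_
  simp only [segAvg]
  congr 1
  ext s
  push_cast
  ring

/-- Integration by parts along the segment. -/
theorem segAvg_deriv_weight {w w' : ℝ → ℝ} {G G' : ℝ → ℂ} (hw : ∀ s, HasDerivAt w (w' s) s)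
    (hw' : Continuous w') (hG : ∀ ξ, HasDerivAt G (G' ξ) ξ) (hG' : Continuous G') (p ξ : ℝ) :
    (ξ - p) * segAvg w G' p ξ = w 1 * G ξ - w 0 * G p - segAvg w' G p ξ := by
  have hwc : Continuous w := continuous_iff_continuousAt.2 fun ξ => (hw ξ).continuousAt
  have hGc : Continuous G := continuous_iff_continuousAt.2 fun ξ => (hG ξ).continuousAt
  have hd : ∀ s : ℝ, HasDerivAt (fun s : ℝ => (w s : ℂ) * G (p + s * (ξ - p)))
      ((w' s : ℂ) * G (p + s * (ξ - p)) +
        (w s : ℂ) * ((ξ - p : ℝ) * G' (p + s * (ξ - p)))) s := by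
    intro s
    have h1 : HasDerivAt (fun s : ℝ => p + s * (ξ - p)) (ξ - p) s := by
      simpa using ((hasDerivAt_id s).mul_const (ξ - p)).const_add p
    have h2 := (hG (p + s * (ξ - p))).scomp s h1
    exact (hw s).ofReal_comp.mul (HasDerivAt.congr_deriv h2 (Complex.real_smul ..))
  have h := intervalIntegral.integral_eq_sub_of_hasDerivAt (a := (0 : ℝ)) (b := 1)
    (fun s _ => hd s) (Continuous.intervalIntegrable (by fun_prop) _ _)
  rw [intervalIntegral.integral_add (Continuous.intervalIntegrable (by fun_prop) _ _)
    (Continuous.intervalIntegrable (by fun_prop) _ _)] at h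
  have e : ∫ s in (0 : ℝ)..1, (w s : ℂ) * ((ξ - p : ℝ) * G' (p + s * (ξ - p))) =
      (ξ - p) * segAvg w G' p ξ := by
    simp only [segAvg]
    rw [← intervalIntegral.integral_const_mul]
    congr 1
    ext s
    push_cast
    ring
  rw [e] at h
  simp only [one_mul, zero_mul, add_zero, add_sub_cancel] at h
  simp only [segAvg] at h ⊢
  linear_combination h

/-- Symbols `σ(y, ξ)` with two bounded `ξ`-derivatives. -/
def IsSymbol (B : ℝ) (σ : ℝ → ℝ → ℂ) : Prop :=
  ∃ σ₁ σ₂ : ℝ → ℝ → ℂ, Continuous (Function.uncurry σ) ∧ Continuous (Function.uncurry σ₁) ∧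
    Continuous (Function.uncurry σ₂) ∧ (∀ y ξ, HasDerivAt (σ y) (σ₁ y ξ) ξ) ∧
    (∀ y ξ, HasDerivAt (σ₁ y) (σ₂ y ξ) ξ) ∧ (∀ y ξ, ‖σ y ξ‖ ≤ B) ∧ (∀ y ξ, ‖σ₁ y ξ‖ ≤ B) ∧
    ∀ y ξ, ‖σ₂ y ξ‖ ≤ B

theorem IsSymbol.nonneg {B : ℝ} {σ : ℝ → ℝ → ℂ} (h : IsSymbol B σ) : 0 ≤ B := by
  obtain ⟨σ₁, σ₂, -, -, -, -, -, h0, -⟩ := h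
  exact (norm_nonneg _).trans (h0 0 0)

/-- The factor 4 counts the Leibniz terms of the second derivative. -/
theorem IsSymbol.mul {B B' : ℝ} {σ τ : ℝ → ℝ → ℂ} (hσ : IsSymbol B σ) (hτ : IsSymbol B' τ) :
    IsSymbol (4 * B * B') (fun y ξ => σ y ξ * τ y ξ) := by
  have hB := hσ.nonneg
  have hB' := hτ.nonneg
  obtain ⟨σ₁, σ₂, c0, c1, c2, d1, d2, b0, b1, b2⟩ := hσ
  obtain ⟨τ₁, τ₂, c0', c1', c2', d1', d2', b0', b1', b2'⟩ := hτ
  have hm : ∀ {z w : ℂ}, ‖z‖ ≤ B → ‖w‖ ≤ B' → ‖z * w‖ ≤ B * B' := fun h1 h2 => by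
    rw [norm_mul]; gcongr
  have hBB : 0 ≤ B * B' := mul_nonneg hB hB'
  refine ⟨fun y ξ => σ₁ y ξ * τ y ξ + σ y ξ * τ₁ y ξ,
    fun y ξ => (σ₂ y ξ * τ y ξ + σ₁ y ξ * τ₁ y ξ) + (σ₁ y ξ * τ₁ y ξ + σ y ξ * τ₂ y ξ),
    c0.mul c0', (c1.mul c0').add (c0.mul c1'),
    ((c2.mul c0').add (c1.mul c1')).add ((c1.mul c1').add (c0.mul c2')),
    fun y ξ => (d1 y ξ).mul (d1' y ξ),
    fun y ξ => ((d2 y ξ).mul (d1' y ξ)).add ((d1 y ξ).mul (d2' y ξ)),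
    fun y ξ => (hm (b0 y ξ) (b0' y ξ)).trans (by linarith), fun y ξ => ?_, fun y ξ => ?_⟩
  · exact (norm_add_le _ _).trans
      ((add_le_add (hm (b1 y ξ) (b0' y ξ)) (hm (b0 y ξ) (b1' y ξ))).trans (by linarith))
  · exact (norm_add_le _ _).trans ((add_le_add
      ((norm_add_le _ _).trans (add_le_add (hm (b2 y ξ) (b0' y ξ)) (hm (b1 y ξ) (b1' y ξ))))
      ((norm_add_le _ _).trans (add_le_add (hm (b1 y ξ) (b1' y ξ)) (hm (b0 y ξ) (b2' y ξ))))).trans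
      (by linarith))

theorem IsSymbol.inv {B c : ℝ} {σ : ℝ → ℝ → ℂ} (hσ : IsSymbol B σ) (hc : 0 < c)
    (h : ∀ y ξ, c ≤ ‖σ y ξ‖) :
    IsSymbol (c⁻¹ + B * (c⁻¹) ^ 2 + (B * (c⁻¹) ^ 2 + 2 * B ^ 2 * (c⁻¹) ^ 3))
      (fun y ξ => (σ y ξ)⁻¹) := by
  have hB := hσ.nonneg
  obtain ⟨σ₁, σ₂, c0, c1, c2, d1, d2, b0, b1, b2⟩ := hσ
  have hne : ∀ y ξ, σ y ξ ≠ 0 := fun y ξ => norm_pos_iff.1 (hc.trans_le (h y ξ))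
  have hi : ∀ y ξ, ‖(σ y ξ)⁻¹‖ ≤ c⁻¹ := fun y ξ => by
    rw [norm_inv]; exact inv_anti₀ hc (h y ξ)
  have cinv : Continuous (Function.uncurry fun y ξ => (σ y ξ)⁻¹) := by
    exact c0.inv₀ fun z => hne z.1 z.2
  have dinv : ∀ y ξ, HasDerivAt (fun ξ => (σ y ξ)⁻¹) (-σ₁ y ξ * ((σ y ξ)⁻¹) ^ 2) ξ := by
    intro y ξ
    refine ((d1 y ξ).inv (hne y ξ)).congr_deriv ?_
    rw [inv_pow]; rfl
  have hci : 0 ≤ c⁻¹ := by positivity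
  have k1 : Continuous fun z : ℝ × ℝ => σ₁ z.1 z.2 := c1
  have k2 : Continuous fun z : ℝ × ℝ => σ₂ z.1 z.2 := c2
  have k0 : Continuous fun z : ℝ × ℝ => (σ z.1 z.2)⁻¹ := cinv
  have cs1 : Continuous fun z : ℝ × ℝ => -σ₁ z.1 z.2 * ((σ z.1 z.2)⁻¹) ^ 2 := by fun_prop
  have cs2 : Continuous fun z : ℝ × ℝ => -σ₂ z.1 z.2 * ((σ z.1 z.2)⁻¹) ^ 2 +
      -σ₁ z.1 z.2 * (2 * (σ z.1 z.2)⁻¹ * (-σ₁ z.1 z.2 * ((σ z.1 z.2)⁻¹) ^ 2)) := by fun_prop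
  refine ⟨fun y ξ => -σ₁ y ξ * ((σ y ξ)⁻¹) ^ 2,
    fun y ξ => -σ₂ y ξ * ((σ y ξ)⁻¹) ^ 2 +
      -σ₁ y ξ * (2 * (σ y ξ)⁻¹ * (-σ₁ y ξ * ((σ y ξ)⁻¹) ^ 2)),
    cinv, cs1, cs2, dinv,
    fun y ξ => ?_, fun y ξ => (hi y ξ).trans ?_, fun y ξ => ?_, fun y ξ => ?_⟩
  · refine ((d2 y ξ).neg.mul ((dinv y ξ).pow 2)).congr_deriv ?_
    simp
  · have : 0 ≤ B * (c⁻¹) ^ 2 + (B * (c⁻¹) ^ 2 + 2 * B ^ 2 * (c⁻¹) ^ 3) := by positivity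
    linarith
  · have : ‖-σ₁ y ξ * ((σ y ξ)⁻¹) ^ 2‖ ≤ B * (c⁻¹) ^ 2 := by
      rw [norm_mul, norm_neg, norm_pow]
      gcongr
      · exact b1 y ξ
      · exact hi y ξ
    have h2 : 0 ≤ B * (c⁻¹) ^ 2 + 2 * B ^ 2 * (c⁻¹) ^ 3 := by positivity
    linarith
  · have h1 : ‖-σ₂ y ξ * ((σ y ξ)⁻¹) ^ 2‖ ≤ B * (c⁻¹) ^ 2 := by
      rw [norm_mul, norm_neg, norm_pow]
      gcongr
      · exact b2 y ξ
      · exact hi y ξ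
    have h2 : ‖-σ₁ y ξ * (2 * (σ y ξ)⁻¹ * (-σ₁ y ξ * ((σ y ξ)⁻¹) ^ 2))‖ ≤
        B * (2 * c⁻¹ * (B * (c⁻¹) ^ 2)) := by
      simp only [norm_mul, norm_neg, norm_pow, Complex.norm_ofNat]
      gcongr
      · exact b1 y ξ
      · exact hi y ξ
      · exact b1 y ξ
      · exact hi y ξ
    have h3 : 0 ≤ B * (c⁻¹) ^ 2 := by positivity
    refine (norm_add_le _ _).trans ((add_le_add h1 h2).trans ?_)
    nlinarith

theorem IsSymbol.mul_left {B b : ℝ} {σ : ℝ → ℝ → ℂ} (hσ : IsSymbol B σ) {g : ℝ → ℂ}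
    (hg : Continuous g) (hb : ∀ y, ‖g y‖ ≤ b) : IsSymbol (b * B) (fun y ξ => g y * σ y ξ) := by
  have hb0 : 0 ≤ b := (norm_nonneg _).trans (hb 0)
  obtain ⟨σ₁, σ₂, c0, c1, c2, d1, d2, b0, b1, b2⟩ := hσ
  have hg' : Continuous (fun z : ℝ × ℝ => g z.1) := hg.comp continuous_fst
  refine ⟨fun y ξ => g y * σ₁ y ξ, fun y ξ => g y * σ₂ y ξ, hg'.mul c0, hg'.mul c1, hg'.mul c2,
    fun y ξ => (d1 y ξ).const_mul _, fun y ξ => (d2 y ξ).const_mul _, fun y ξ => ?_, fun y ξ => ?_,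
    fun y ξ => ?_⟩
  all_goals
    rw [norm_mul]
    gcongr
    · exact hb y
    · first | exact b0 y ξ | exact b1 y ξ | exact b2 y ξ

/-- Each ξ-derivative differentiates G and multiplies the weight by s, which keeps it at most 1 in
absolute value. The bound B for G, G', G'' therefore passes to the average unchanged, uniformly in
the base point. -/
theorem isSymbol_segAvg {w : ℝ → ℝ} {G G' G'' : ℝ → ℂ} {B : ℝ} (hw : Continuous w)
    (hw1 : ∀ s ∈ Icc (0 : ℝ) 1, |w s| ≤ 1) (hG : ∀ ξ, HasDerivAt G (G' ξ) ξ)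
    (hG' : ∀ ξ, HasDerivAt G' (G'' ξ) ξ) (hG'' : Continuous G'')
    (h0 : ∀ ξ, ‖G ξ‖ ≤ B) (h1 : ∀ ξ, ‖G' ξ‖ ≤ B) (h2 : ∀ ξ, ‖G'' ξ‖ ≤ B) {θ : ℝ → ℝ}
    (hθ : Continuous θ) : IsSymbol B (fun y ξ => segAvg w G (θ y) ξ) := by
  have hc : Continuous G := continuous_iff_continuousAt.2 fun ξ => (hG ξ).continuousAt
  have hc' : Continuous G' := continuous_iff_continuousAt.2 fun ξ => (hG' ξ).continuousAt
  have hm : ∀ {w : ℝ → ℝ}, (∀ s ∈ Icc (0 : ℝ) 1, |w s| ≤ 1) →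
      ∀ s ∈ Icc (0 : ℝ) 1, |s * w s| ≤ 1 := fun h s hs => by
    rw [abs_mul, abs_of_nonneg hs.1]
    exact mul_le_one₀ hs.2 (abs_nonneg _) (h s hs)
  have hcont : ∀ {w : ℝ → ℝ} {G : ℝ → ℂ}, Continuous w → Continuous G →
      Continuous (Function.uncurry fun y ξ => segAvg w G (θ y) ξ) := fun h1 h2 =>
    (continuous_segAvg h1 h2).comp (by fun_prop : Continuous fun z : ℝ × ℝ => (θ z.1, z.2))
  refine ⟨fun y ξ => segAvg (fun s => s * w s) G' (θ y) ξ,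
    fun y ξ => segAvg (fun s => s * (s * w s)) G'' (θ y) ξ, hcont hw hc,
    hcont (by fun_prop) hc', hcont (by fun_prop) hG'',
    fun y ξ => hasDerivAt_segAvg_right hw hG hc' h1 _ _,
    fun y ξ => hasDerivAt_segAvg_right (by fun_prop) hG' hG'' h2 _ _,
    fun y ξ => norm_segAvg_le hw1 h0 _ _, fun y ξ => norm_segAvg_le (hm hw1) h1 _ _,
    fun y ξ => norm_segAvg_le (hm (hm hw1)) h2 _ _⟩

theorem integrable_continuous_mul {R : ℝ} {p k : ℝ → ℂ} (hp : Continuous p) (hk : Integrable k)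
    (hs : ∀ ξ, R < |ξ| → k ξ = 0) : Integrable (fun ξ => p ξ * k ξ) := by
  refine (integrableOn_iff_integrable_of_support_subset (s := Icc (-R) R) fun ξ hξ => ?_).1
    (hk.integrableOn.continuousOn_mul hp.continuousOn isCompact_Icc)
  rw [mem_Icc, ← abs_le]
  by_contra hcon
  exact hξ (by simp [hs ξ (not_le.1 hcon)])

variable {R t : ℝ} {d : ℝ → ℝ} {h ℓ : ℝ → ℂ}

theorem FreqData.integrable (H : FreqData R t d h ℓ) : Integrable h :=
  memLp_integrable_of_supp H.memLp H.supp

theorem FreqData.integrable' (H : FreqData R t d h ℓ) : Integrable ℓ :=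
  memLp_integrable_of_supp H.memLp' H.supp'

theorem hasDerivAt_cexp_phase (x ξ : ℝ) :
    HasDerivAt (fun ξ : ℝ => Complex.exp (Complex.I * ((x * ξ : ℝ) : ℂ)))
      (Complex.I * x * Complex.exp (Complex.I * ((x * ξ : ℝ) : ℂ))) ξ := by
  have h1 : HasDerivAt (fun ξ : ℝ => ((x * ξ : ℝ) : ℂ)) (x : ℂ) ξ := by
    simpa using ((hasDerivAt_id ξ).const_mul x).ofReal_comp
  convert (h1.const_mul Complex.I).cexp using 1
  ring

/-- A symbol vanishing on the Lagrangian `d ξ = x / t` gains a factor `t⁻¹`. -/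
theorem FreqData.op_vanishing_eq (H : FreqData R t d h ℓ) (hd : Continuous d) (ht : t ≠ 0)
    {n n₁ : ℝ → ℝ → ℂ} (hn : Continuous (Function.uncurry n))
    (hn₁ : Continuous (Function.uncurry n₁))
    (hder : ∀ y ξ, HasDerivAt (n y) (n₁ y ξ) ξ) (x : ℝ) :
    op h (fun x ξ => ((d ξ - x / t : ℝ) : ℂ) * n (x / t) ξ) x =
      -(t : ℂ)⁻¹ * (op ℓ (fun x ξ => n (x / t) ξ) x +
        Complex.I * op h (fun x ξ => n₁ (x / t) ξ) x) := by
  have htc : (t : ℂ) ≠ 0 := by exact_mod_cast ht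
  set y := x / t with hy
  have hyx : (x : ℂ) = y * t := by rw [hy]; push_cast; field_simp
  have hcn : Continuous (n y) := hn.comp (by fun_prop : Continuous fun ξ : ℝ => (y, ξ))
  have hcn1 : Continuous (n₁ y) := hn₁.comp (by fun_prop : Continuous fun ξ : ℝ => (y, ξ))
  set e : ℝ → ℂ := fun ξ => Complex.exp (Complex.I * ((x * ξ : ℝ) : ℂ)) with he
  have hce : Continuous e := by rw [he]; fun_prop
  -- The weak identity is tested with n(y,ξ)e^{ixξ}. Differentiating the exponential produces ix =
  -- ity, which joins t a'(ξ) to form t(a'(ξ) - y).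
  have hib := H.ibp (fun ξ => n y ξ * e ξ) _
    (fun ξ => (hder y ξ).mul (hasDerivAt_cexp_phase x ξ)) (by fun_prop)
  have i1 : Integrable (fun ξ => n y ξ * ℓ ξ * e ξ) := by
    have := integrable_continuous_mul (p := fun ξ => n y ξ * e ξ) (by fun_prop) H.integrable' H.supp'
    exact this.congr (Filter.Eventually.of_forall fun ξ => by simp only; ring)
  have i2 : Integrable (fun ξ => n y ξ * h ξ * e ξ) := by
    have := integrable_continuous_mul (p := fun ξ => n y ξ * e ξ) (by fun_prop) H.integrable H.supp
    exact this.congr (Filter.Eventually.of_forall fun ξ => by simp only; ring)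
  have i3 : Integrable (fun ξ => ((d ξ : ℝ) : ℂ) * n y ξ * h ξ * e ξ) := by
    have := integrable_continuous_mul (p := fun ξ => ((d ξ : ℝ) : ℂ) * n y ξ * e ξ) (by fun_prop)
      H.integrable H.supp
    exact this.congr (Filter.Eventually.of_forall fun ξ => by simp only; ring)
  have i4 : Integrable (fun ξ => n₁ y ξ * h ξ * e ξ) := by
    have := integrable_continuous_mul (p := fun ξ => n₁ y ξ * e ξ) (by fun_prop) H.integrable H.supp
    exact this.congr (Filter.Eventually.of_forall fun ξ => by simp only; ring)
  have e1 : ∫ ξ, n y ξ * e ξ * (ℓ ξ + t * d ξ * h ξ) =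
      (∫ ξ, n y ξ * ℓ ξ * e ξ) + t * ∫ ξ, ((d ξ : ℝ) : ℂ) * n y ξ * h ξ * e ξ := by
    rw [← integral_const_mul, ← integral_add i1 (i3.const_mul _)]
    refine integral_congr_ae (Filter.Eventually.of_forall fun ξ => ?_)
    simp only
    ring
  have e2 : ∫ ξ, (n₁ y ξ * e ξ + n y ξ * (Complex.I * x * e ξ)) * h ξ =
      (∫ ξ, n₁ y ξ * h ξ * e ξ) + Complex.I * x * ∫ ξ, n y ξ * h ξ * e ξ := by
    rw [← integral_const_mul, ← integral_add i4 (i2.const_mul _)]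
    refine integral_congr_ae (Filter.Eventually.of_forall fun ξ => ?_)
    simp only
    ring
  have e3 : ∫ ξ, ((d ξ - y : ℝ) : ℂ) * n y ξ * h ξ * e ξ =
      (∫ ξ, ((d ξ : ℝ) : ℂ) * n y ξ * h ξ * e ξ) - y * ∫ ξ, n y ξ * h ξ * e ξ := by
    rw [← integral_const_mul, ← integral_sub i3 (i2.const_mul _)]
    refine integral_congr_ae (Filter.Eventually.of_forall fun ξ => ?_)
    simp only
    push_cast
    ring
  have hib' : (∫ ξ, n y ξ * ℓ ξ * e ξ) + t * ∫ ξ, ((d ξ : ℝ) : ℂ) * n y ξ * h ξ * e ξ =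
      -Complex.I * ((∫ ξ, n₁ y ξ * h ξ * e ξ) + Complex.I * x * ∫ ξ, n y ξ * h ξ * e ξ) := by
    rw [← e1, ← e2]; exact hib
  simp only [op, synth, ← hy]
  change _ * (∫ ξ, ((d ξ - y : ℝ) : ℂ) * n y ξ * h ξ * e ξ) = -(t : ℂ)⁻¹ *
    (_ * (∫ ξ, n y ξ * ℓ ξ * e ξ) + Complex.I * (_ * ∫ ξ, n₁ y ξ * h ξ * e ξ))
  rw [e3]
  rw [hyx] at hib'
  field_simp
  linear_combination hib' - (y * t * ∫ ξ, n y ξ * h ξ * e ξ) * Complex.I_mul_I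

theorem continuous_uncurry_div {σ : ℝ → ℝ → ℂ} (hσ : Continuous (Function.uncurry σ)) (t : ℝ) :
    Continuous (Function.uncurry fun x ξ => σ (x / t) ξ) :=
  hσ.comp (by fun_prop : Continuous fun z : ℝ × ℝ => (z.1 / t, z.2))

/-- Trading the vanishing factor for t⁻¹ uses one ξ-derivative of n, and bounding the resulting
operators uses another: this is why `IsSymbol` carries two derivatives. -/
theorem FreqData.l2Bound_op_vanishing (H : FreqData R t d h ℓ) (hd : Continuous d) (hR : 0 ≤ R)
    (ht : 0 < t) {N B : ℝ} (hN0 : 0 ≤ N) (hN : eLpNorm h 2 volume ≤ ENNReal.ofReal N)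
    (hN' : eLpNorm ℓ 2 volume ≤ ENNReal.ofReal N) {n : ℝ → ℝ → ℂ} (hn : IsSymbol B n) :
    L2Bound (op h (fun x ξ => ((d ξ - x / t : ℝ) : ℂ) * n (x / t) ξ))
      (t⁻¹ * (2 * ((1 + 2 * R) * B) * N)) := by
  have hB := hn.nonneg
  obtain ⟨n₁, n₂, c0, c1, c2, d1, d2, b0, b1, b2⟩ := hn
  have h1 : L2Bound (op ℓ (fun x ξ => n (x / t) ξ)) ((B + 2 * R * B) * N) :=
    l2Bound_op hR hN0 H.memLp' H.supp' hN' (continuous_uncurry_div c0 t)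
      (continuous_uncurry_div c1 t) (fun x ξ => d1 _ ξ) (fun x ξ => b0 _ _) (fun x ξ => b1 _ _)
  have h2 : L2Bound (op h (fun x ξ => n₁ (x / t) ξ)) ((B + 2 * R * B) * N) :=
    l2Bound_op hR hN0 H.memLp H.supp hN (continuous_uncurry_div c1 t)
      (continuous_uncurry_div c2 t) (fun x ξ => d2 _ ξ) (fun x ξ => b1 _ _) (fun x ξ => b2 _ _)
  have h3 := ((h1.add (h2.const_mul Complex.I) (by positivity) (by positivity)).const_mul
    (-(t : ℂ)⁻¹))
  have he : op h (fun x ξ => ((d ξ - x / t : ℝ) : ℂ) * n (x / t) ξ) = fun x => -(t : ℂ)⁻¹ *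
      (op ℓ (fun x ξ => n (x / t) ξ) x + Complex.I * op h (fun x ξ => n₁ (x / t) ξ) x) :=
    funext fun x => H.op_vanishing_eq hd ht.ne' c0 c1 d1 x
  rw [he]
  refine h3.mono (le_of_eq ?_)
  rw [norm_neg, norm_inv, Complex.norm_real, Real.norm_of_nonneg ht.le, Complex.norm_I]
  ring

end

/-! ### The frequency ξ_v and the phase φ -/

section Dispersion

variable {a : ℝ → ℝ}

theorem IsDispersive.hasDerivAt_iteratedDeriv (ha : IsDispersive a) (j : ℕ) (ξ : ℝ) :
    HasDerivAt (iteratedDeriv j a) (iteratedDeriv (j + 1) a ξ) ξ := by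
  rw [iteratedDeriv_succ]
  exact (ha.smooth.differentiable_iteratedDeriv j (by exact_mod_cast WithTop.coe_lt_top _)
    ξ).hasDerivAt

theorem iteratedDeriv_two_eq (a : ℝ → ℝ) : iteratedDeriv 2 a = deriv (deriv a) := by
  rw [iteratedDeriv_succ, iteratedDeriv_one]

theorem IsDispersive.hasDerivAt_deriv (ha : IsDispersive a) (ξ : ℝ) :
    HasDerivAt (deriv a) (deriv (deriv a) ξ) ξ := by
  have := ha.hasDerivAt_iteratedDeriv 1 ξ
  rwa [iteratedDeriv_one, iteratedDeriv_two_eq] at this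

theorem IsDispersive.hasDerivAt (ha : IsDispersive a) (ξ : ℝ) : HasDerivAt a (deriv a ξ) ξ :=
  (ha.smooth.differentiable (by simp) ξ).hasDerivAt

theorem IsDispersive.continuous_iteratedDeriv (ha : IsDispersive a) (j : ℕ) :
    Continuous (iteratedDeriv j a) :=
  continuous_iff_continuousAt.2 fun ξ => (ha.hasDerivAt_iteratedDeriv j ξ).continuousAt

theorem IsDispersive.continuous_deriv (ha : IsDispersive a) : Continuous (deriv a) :=
  continuous_iff_continuousAt.2 fun ξ => (ha.hasDerivAt_deriv ξ).continuousAt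

theorem IsDispersive.continuous_deriv2 (ha : IsDispersive a) : Continuous (deriv (deriv a)) := by
  rw [← iteratedDeriv_two_eq]; exact ha.continuous_iteratedDeriv 2

theorem IsDispersive.deriv_freq (ha : IsDispersive a) (v : ℝ) : deriv a (freq a v) = v :=
  Function.rightInverse_invFun ha.bijective.surjective v

theorem IsDispersive.freq_deriv (ha : IsDispersive a) (ξ : ℝ) : freq a (deriv a ξ) = ξ :=
  Function.leftInverse_invFun ha.bijective.injective ξ

/-- A nonzero strict derivative makes a' an open map, and the inverse of an open bijection is
continuous. -/
theorem IsDispersive.continuous_freq (ha : IsDispersive a) : Continuous (freq a) := by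
  have hopen : IsOpenMap (deriv a) := by
    rw [isOpenMap_iff_nhds_le]
    intro ξ
    have h1 : HasStrictDerivAt (deriv a) (deriv (deriv a) ξ) ξ := by
      refine hasStrictDerivAt_of_hasDerivAt_of_continuousAt
        (Filter.Eventually.of_forall ha.hasDerivAt_deriv) ha.continuous_deriv2.continuousAt
    exact (h1.map_nhds_eq (ha.nondegenerate ξ)).ge
  refine continuous_def.2 fun U hU => ?_
  convert hopen U hU using 1
  ext v
  constructor
  · intro h
    exact ⟨freq a v, h, ha.deriv_freq v⟩
  · rintro ⟨ξ, hξ, rfl⟩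
    rw [mem_preimage, ha.freq_deriv]
    exact hξ

theorem IsDispersive.hasDerivAt_freq (ha : IsDispersive a) (v : ℝ) :
    HasDerivAt (freq a) (deriv (deriv a) (freq a v))⁻¹ v :=
  HasDerivAt.of_local_left_inverse ha.continuous_freq.continuousAt (ha.hasDerivAt_deriv _)
    (ha.nondegenerate _) (Filter.Eventually.of_forall ha.deriv_freq)

/-- φ is a Legendre transform: the two terms containing the derivative of ξ_v cancel because a'(ξ_v)
= v. -/
theorem IsDispersive.hasDerivAt_phase (ha : IsDispersive a) (v : ℝ) :
    HasDerivAt (phase a) (freq a v) v := by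
  have h1 := ha.hasDerivAt_freq v
  have h2 := ((hasDerivAt_id v).mul h1).sub ((ha.hasDerivAt (freq a v)).comp v h1)
  refine h2.congr_deriv ?_
  rw [ha.deriv_freq]
  simp

theorem IsDispersive.continuous_phase (ha : IsDispersive a) : Continuous (phase a) :=
  continuous_iff_continuousAt.2 fun v => (ha.hasDerivAt_phase v).continuousAt

theorem IsDispersive.hasDerivAt_phase_div (ha : IsDispersive a) {t : ℝ} (ht : t ≠ 0) (x : ℝ) :
    HasDerivAt (fun x => t * phase a (x / t)) (freq a (x / t)) x := by
  have := ((ha.hasDerivAt_phase (x / t)).comp x ((hasDerivAt_id x).div_const t)).const_mul t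
  refine this.congr_deriv ?_
  field_simp

/-- The eikonal equation: with `IsDispersive.hasDerivAt_phase_div` it says that tφ(x/t) has
frequency ξ_{x/t} in x and -a(ξ_{x/t}) in t, as for a solution of the linear flow. -/
theorem IsDispersive.hasDerivAt_phase_time (ha : IsDispersive a) {t : ℝ} (ht : t ≠ 0) (x : ℝ) :
    HasDerivAt (fun t => t * phase a (x / t)) (-a (freq a (x / t))) t := by
  have h1 : HasDerivAt (fun t : ℝ => x / t) (-x / t ^ 2) t := by
    have := (hasDerivAt_inv ht).const_mul x
    refine this.congr_deriv ?_
    field_simp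
  have := (hasDerivAt_id t).mul ((ha.hasDerivAt_phase (x / t)).comp t h1)
  refine this.congr_deriv ?_
  simp only [Function.comp, phase, id]
  field_simp
  ring

theorem IsDispersive.sign (ha : IsDispersive a) :
    (∀ ξ, 0 < deriv (deriv a) ξ) ∨ ∀ ξ, deriv (deriv a) ξ < 0 := by
  by_contra hcon
  push Not at hcon
  obtain ⟨⟨x, hx⟩, ⟨y, hy⟩⟩ := hcon
  have := intermediate_value_univ x y ha.continuous_deriv2
  obtain ⟨z, hz⟩ := this ⟨hx, hy⟩
  exact ha.nondegenerate z hz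

end Dispersion

/-! ### Algebra and x-derivatives of operators with symbols -/

section Calculus

variable {R t : ℝ} {h : ℝ → ℂ}

theorem integrable_symbol {σ : ℝ → ℝ → ℂ} (hσ : Continuous (Function.uncurry σ))
    (hh : Integrable h) (hs : ∀ ξ, R < |ξ| → h ξ = 0) (x : ℝ) :
    Integrable (fun ξ => σ x ξ * h ξ * Complex.exp (Complex.I * ((x * ξ : ℝ) : ℂ))) := by
  have hc : Continuous (σ x) := hσ.comp (by fun_prop : Continuous fun ξ : ℝ => (x, ξ))
  have := integrable_continuous_mul
    (p := fun ξ => σ x ξ * Complex.exp (Complex.I * ((x * ξ : ℝ) : ℂ))) (by fun_prop) hh hs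
  exact this.congr (Filter.Eventually.of_forall fun ξ => by simp only; ring)

theorem op_add {σ τ : ℝ → ℝ → ℂ} (hσ : Continuous (Function.uncurry σ))
    (hτ : Continuous (Function.uncurry τ)) (hh : Integrable h) (hs : ∀ ξ, R < |ξ| → h ξ = 0)
    (x : ℝ) : op h (fun x ξ => σ x ξ + τ x ξ) x = op h σ x + op h τ x := by
  simp only [op, synth]
  rw [← mul_add, ← integral_add (integrable_symbol hσ hh hs x) (integrable_symbol hτ hh hs x)]
  congr 1
  refine integral_congr_ae (Filter.Eventually.of_forall fun ξ => ?_)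
  simp only
  ring

theorem op_mul_left (g : ℝ → ℂ) (σ : ℝ → ℝ → ℂ) (x : ℝ) :
    op h (fun x ξ => g x * σ x ξ) x = g x * op h σ x := by
  simp only [op, synth, mul_assoc]
  rw [integral_const_mul]
  ring

theorem op_congr {σ τ : ℝ → ℝ → ℂ} {x : ℝ} (hστ : ∀ ξ, σ x ξ = τ x ξ) : op h σ x = op h τ x := by
  simp only [op, hστ]

theorem op_one (x : ℝ) : op h (fun _ _ => 1) x = synth h x := by
  simp only [op, one_mul]

/-- The derivative falls on the exponential, giving iξ, or on the symbol. The bounded band confines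
the domination to a compact box in (x,ξ). -/
theorem hasDerivAt_op {σ σx : ℝ → ℝ → ℂ} (hσ : Continuous (Function.uncurry σ))
    (hσx : Continuous (Function.uncurry σx)) (hd : ∀ x ξ, HasDerivAt (fun x => σ x ξ) (σx x ξ) x)
    (hh : Integrable h) (hs : ∀ ξ, R < |ξ| → h ξ = 0) (x : ℝ) :
    HasDerivAt (op h σ) (op h (fun x ξ => Complex.I * ((ξ : ℂ) * σ x ξ) + σx x ξ) x) x := by
  have hτ : Continuous (Function.uncurry fun x ξ : ℝ => Complex.I * ((ξ : ℂ) * σ x ξ) + σx x ξ) := by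
    have h1 : Continuous fun z : ℝ × ℝ => σ z.1 z.2 := hσ
    have h2 : Continuous fun z : ℝ × ℝ => σx z.1 z.2 := hσx
    have : Continuous fun z : ℝ × ℝ => Complex.I * ((z.2 : ℂ) * σ z.1 z.2) + σx z.1 z.2 := by
      fun_prop
    exact this
  obtain ⟨B, hB⟩ := (isCompact_Icc (a := x - 1) (b := x + 1)).prod
    (isCompact_Icc (a := -R) (b := R)) |>.exists_bound_of_continuousOn hτ.continuousOn
  refine HasDerivAt.const_mul _ ?_
  refine (hasDerivAt_integral_of_dominated_loc_of_deriv_le (𝕜 := ℝ) (E := ℂ) (μ := volume)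
    (s := Icc (x - 1) (x + 1)) (bound := fun ξ => B * ‖h ξ‖)
    (F := fun x ξ => σ x ξ * h ξ * Complex.exp (Complex.I * ((x * ξ : ℝ) : ℂ)))
    (F' := fun x ξ => (Complex.I * ((ξ : ℂ) * σ x ξ) + σx x ξ) * h ξ *
      Complex.exp (Complex.I * ((x * ξ : ℝ) : ℂ)))
    (Icc_mem_nhds (by linarith) (by linarith)) ?_ ?_ ?_ ?_ ?_ ?_).2
  · exact Filter.Eventually.of_forall fun x => (integrable_symbol hσ hh hs x).1
  · exact integrable_symbol hσ hh hs x
  · exact (integrable_symbol hτ hh hs x).1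
  · refine Filter.Eventually.of_forall fun ξ y hy => ?_
    rw [norm_mul, norm_cexp_I_mul, mul_one, norm_mul]
    by_cases hξ : R < |ξ|
    · simp [hs ξ hξ]
    · gcongr
      exact hB (y, ξ) ⟨hy, by rw [mem_Icc, ← abs_le]; exact not_lt.1 hξ⟩
  · exact hh.norm.const_mul B
  · refine Filter.Eventually.of_forall fun ξ y _ => ?_
    have h1 : HasDerivAt (fun y : ℝ => Complex.exp (Complex.I * ((y * ξ : ℝ) : ℂ)))
        (Complex.I * ξ * Complex.exp (Complex.I * ((y * ξ : ℝ) : ℂ))) y := by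
      have := hasDerivAt_cexp_phase ξ y
      simpa only [mul_comm ξ] using this
    refine (((hd y ξ).mul_const (h ξ)).mul h1).congr_deriv ?_
    ring

end Calculus

/-! ### Taylor remainders of a at ξ_y as symbols -/

section

/-- The `j`-th derivative of `a`, as a complex valued function. -/
noncomputable def cderiv (a : ℝ → ℝ) (j : ℕ) (ξ : ℝ) : ℂ := (iteratedDeriv j a ξ : ℝ)

/-- The second order Taylor remainder of `a` at `ξ_y`, divided by `(ξ - ξ_y)²`. -/
noncomputable def symRem (a : ℝ → ℝ) (y ξ : ℝ) : ℂ :=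
  segAvg (fun s => 1 - s) (cderiv a 2) (freq a y) ξ

/-- The third order Taylor remainder of `a` at `ξ_y`, divided by `a''(ξ_y) (ξ - ξ_y)³`. -/
noncomputable def symRem₃ (a : ℝ → ℝ) (y ξ : ℝ) : ℂ :=
  ((deriv (deriv a) (freq a y))⁻¹ : ℝ) *
    segAvg (fun s => (1 - s) ^ 2 / 2) (cderiv a 3) (freq a y) ξ

variable {a : ℝ → ℝ}

theorem IsDispersive.hasDerivAt_cderiv (ha : IsDispersive a) (j : ℕ) (ξ : ℝ) :
    HasDerivAt (cderiv a j) (cderiv a (j + 1) ξ) ξ :=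
  (ha.hasDerivAt_iteratedDeriv j ξ).ofReal_comp

theorem IsDispersive.continuous_cderiv (ha : IsDispersive a) (j : ℕ) : Continuous (cderiv a j) :=
  Complex.continuous_ofReal.comp (ha.continuous_iteratedDeriv j)

/-- Five derivatives are enough: the third order remainder involves a''' and symbols require two
derivatives more. -/
theorem IsUniformlyDispersive.exists_bound (hu : IsUniformlyDispersive a) :
    ∃ B : ℝ, 0 < B ∧ ∀ j, 2 ≤ j → j ≤ 5 → ∀ ξ, ‖cderiv a j ξ‖ ≤ B := by
  choose c hc using hu.upper
  refine ⟨1 + |c 2 le_rfl| + |c 3 (by norm_num)| + |c 4 (by norm_num)| + |c 5 (by norm_num)|,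
    by positivity, fun j h2 h5 ξ => ?_⟩
  have h := hc j h2 ξ
  simp only [cderiv, Complex.norm_real, Real.norm_eq_abs]
  have := le_abs_self (c j h2)
  have p2 := abs_nonneg (c 2 le_rfl)
  have p3 := abs_nonneg (c 3 (by norm_num))
  have p4 := abs_nonneg (c 4 (by norm_num))
  have p5 := abs_nonneg (c 5 (by norm_num))
  interval_cases j <;> linarith

theorem IsDispersive.segAvg_one_deriv (ha : IsDispersive a) (y ξ : ℝ) :
    ((ξ - freq a y : ℝ) : ℂ) * segAvg (fun _ => 1) (cderiv a 2) (freq a y) ξ =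
      ((deriv a ξ - y : ℝ) : ℂ) := by
  have := segAvg_deriv_weight (w := fun _ => 1) (w' := fun _ => 0) (fun s => hasDerivAt_const s 1)
    continuous_const (ha.hasDerivAt_cderiv 1) (ha.continuous_cderiv 2) (freq a y) ξ
  push_cast
  rw [this]
  simp [segAvg, cderiv, iteratedDeriv_one, ha.deriv_freq]

/-- Since a'' has a constant sign, averaging cannot produce cancellation and the lower bound on
|a''| survives. -/
theorem IsDispersive.le_norm_segAvg (ha : IsDispersive a) {c : ℝ}
    (hc : ∀ ξ, c ≤ |deriv (deriv a) ξ|) (y ξ : ℝ) :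
    c ≤ ‖segAvg (fun _ => 1) (cderiv a 2) (freq a y) ξ‖ := by
  have hcont := ha.continuous_deriv2
  have h1 : segAvg (fun _ => 1) (cderiv a 2) (freq a y) ξ =
      ((∫ s in (0 : ℝ)..1, deriv (deriv a) (freq a y + s * (ξ - freq a y)) : ℝ) : ℂ) := by
    rw [← intervalIntegral.integral_ofReal]
    simp [segAvg, cderiv, iteratedDeriv_two_eq]
  rw [h1, Complex.norm_real, Real.norm_eq_abs]
  have hc1 : ∫ s in (0 : ℝ)..1, c = c := by simp
  have hi : IntervalIntegrable (fun s => deriv (deriv a) (freq a y + s * (ξ - freq a y)))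
      volume 0 1 := Continuous.intervalIntegrable (by fun_prop) _ _
  rcases ha.sign with hs | hs
  · refine le_trans ?_ (le_abs_self _)
    conv_lhs => rw [← hc1]
    refine intervalIntegral.integral_mono zero_le_one intervalIntegrable_const hi fun s => ?_
    have := hc (freq a y + s * (ξ - freq a y))
    rwa [abs_of_pos (hs _)] at this
  · refine le_trans ?_ (neg_le_abs _)
    rw [← intervalIntegral.integral_neg]
    conv_lhs => rw [← hc1]
    refine intervalIntegral.integral_mono zero_le_one intervalIntegrable_const hi.neg fun s => ?_
    have := hc (freq a y + s * (ξ - freq a y))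
    rwa [abs_of_neg (hs _)] at this

/-- The gain t⁻¹ is available for multiples of a'(ξ) - y, whereas the expansions below produce
multiples of ξ - ξ_y. Their quotient is the reciprocal of a segment average of a'', a symbol because
the average is bounded below. -/
theorem IsDispersive.exists_isSymbol_quotient (ha : IsDispersive a)
    (hu : IsUniformlyDispersive a) :
    ∃ (B : ℝ) (b : ℝ → ℝ → ℂ), IsSymbol B b ∧
      ∀ y ξ, ((ξ - freq a y : ℝ) : ℂ) = ((deriv a ξ - y : ℝ) : ℂ) * b y ξ := by
  obtain ⟨B, -, hB⟩ := hu.exists_bound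
  obtain ⟨c, hc0, hc⟩ := hu.lower
  have hs : IsSymbol B (fun y ξ => segAvg (fun _ => 1) (cderiv a 2) (freq a y) ξ) :=
    isSymbol_segAvg continuous_const (fun s _ => by simp) (ha.hasDerivAt_cderiv 2)
      (ha.hasDerivAt_cderiv 3) (ha.continuous_cderiv 4) (hB 2 (by norm_num) (by norm_num))
      (hB 3 (by norm_num) (by norm_num)) (hB 4 (by norm_num) (by norm_num)) ha.continuous_freq
  refine ⟨_, _, hs.inv hc0 (ha.le_norm_segAvg hc), fun y ξ => ?_⟩
  have hne : segAvg (fun _ => 1) (cderiv a 2) (freq a y) ξ ≠ 0 :=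
    norm_pos_iff.1 (hc0.trans_le (ha.le_norm_segAvg hc y ξ))
  rw [← ha.segAvg_one_deriv, mul_assoc, mul_inv_cancel₀ hne, mul_one]

theorem IsDispersive.exists_isSymbol_rem (ha : IsDispersive a) (hu : IsUniformlyDispersive a) :
    ∃ B, IsSymbol B (symRem a) ∧ IsSymbol B (symRem₃ a) := by
  obtain ⟨B, hB0, hB⟩ := hu.exists_bound
  obtain ⟨c, hc0, hc⟩ := hu.lower
  have h1 : IsSymbol B (symRem a) :=
    isSymbol_segAvg (by fun_prop)
      (fun s hs => by rw [abs_of_nonneg (by linarith [hs.2])]; linarith [hs.1])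
      (ha.hasDerivAt_cderiv 2)
      (ha.hasDerivAt_cderiv 3) (ha.continuous_cderiv 4) (hB 2 (by norm_num) (by norm_num))
      (hB 3 (by norm_num) (by norm_num)) (hB 4 (by norm_num) (by norm_num)) ha.continuous_freq
  have h2 : IsSymbol B
      (fun y ξ => segAvg (fun s => (1 - s) ^ 2 / 2) (cderiv a 3) (freq a y) ξ) :=
    isSymbol_segAvg (by fun_prop)
      (fun s hs => by
        rw [abs_of_nonneg (by positivity)]
        have := hs.1
        have := hs.2
        nlinarith)
      (ha.hasDerivAt_cderiv 3)
      (ha.hasDerivAt_cderiv 4) (ha.continuous_cderiv 5) (hB 3 (by norm_num) (by norm_num))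
      (hB 4 (by norm_num) (by norm_num)) (hB 5 (by norm_num) (by norm_num)) ha.continuous_freq
  have h3 := h2.mul_left (b := c⁻¹)
    (g := fun y => (((deriv (deriv a) (freq a y))⁻¹ : ℝ) : ℂ))
    (Complex.continuous_ofReal.comp ((ha.continuous_deriv2.comp ha.continuous_freq).inv₀
      fun y => ha.nondegenerate _))
    (fun y => by
      rw [Complex.norm_real, norm_inv, Real.norm_eq_abs]
      exact inv_anti₀ hc0 (hc _))
  have up : ∀ {B B' : ℝ} {σ : ℝ → ℝ → ℂ}, IsSymbol B σ → B ≤ B' → IsSymbol B' σ := by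
    rintro B B' σ ⟨σ₁, σ₂, c0, c1, c2, d1, d2, b0, b1, b2⟩ hBB
    exact ⟨σ₁, σ₂, c0, c1, c2, d1, d2, fun y ξ => (b0 y ξ).trans hBB,
      fun y ξ => (b1 y ξ).trans hBB, fun y ξ => (b2 y ξ).trans hBB⟩
  exact ⟨max B (c⁻¹ * B), up h1 (le_max_left _ _), up h3 (le_max_right _ _)⟩

/-- Integration by parts along the segment replaces the weighted mean of a'' by the plain mean of
a', a form whose dependence on y is easy to differentiate. -/
theorem IsDispersive.mul_symRem (ha : IsDispersive a) (y ξ : ℝ) :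
    ((ξ - freq a y : ℝ) : ℂ) * symRem a y ξ =
      segAvg (fun _ => 1) (cderiv a 1) (freq a y) ξ - y := by
  have := segAvg_deriv_weight (w := fun s => 1 - s) (w' := fun _ => -1)
    (fun s => by simpa using (hasDerivAt_id s).const_sub 1) continuous_const
    (ha.hasDerivAt_cderiv 1) (ha.continuous_cderiv 2) (freq a y) ξ
  simp only [symRem]
  push_cast
  rw [this]
  simp only [segAvg, cderiv, iteratedDeriv_one, ha.deriv_freq]
  simp
  ring

theorem IsDispersive.taylor_second (ha : IsDispersive a) (y ξ : ℝ) :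
    ((a ξ : ℝ) : ℂ) = a (freq a y) + y * ((ξ - freq a y : ℝ) : ℂ) +
      ((ξ - freq a y : ℝ) : ℂ) * (((ξ - freq a y : ℝ) : ℂ) * symRem a y ξ) := by
  rw [ha.mul_symRem]
  have := segAvg_deriv_weight (w := fun _ => 1) (w' := fun _ => 0)
    (fun s => hasDerivAt_const s 1) continuous_const
    (ha.hasDerivAt_cderiv 0) (ha.continuous_cderiv 1) (freq a y) ξ
  have h0 : segAvg (fun _ => 0) (cderiv a 0) (freq a y) ξ = 0 := by simp [segAvg]
  rw [h0] at this
  simp only [cderiv, iteratedDeriv_zero] at this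
  push_cast
  push_cast at this
  linear_combination -this

/-- At ξ = ξ_y the remainder equals a''(ξ_y)/2, the weight 1 - s having mass 1/2. This isolates the
constant -1/2; the correction vanishes on ξ = ξ_y and is harmless. -/
theorem IsDispersive.symRem_eq (ha : IsDispersive a) (y ξ : ℝ) :
    ((deriv (deriv a) (freq a y))⁻¹ : ℝ) * symRem a y ξ - 1 =
      -(1 / 2) + ((ξ - freq a y : ℝ) : ℂ) * symRem₃ a y ξ := by
  have := segAvg_deriv_weight (w := fun s => (1 - s) ^ 2 / 2) (w' := fun s => -(1 - s))
    (fun s => by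
      have := ((((hasDerivAt_id s).const_sub 1).pow 2).div_const 2)
      refine this.congr_deriv ?_
      simp; ring) (by fun_prop)
    (ha.hasDerivAt_cderiv 2) (ha.continuous_cderiv 3) (freq a y) ξ
  have hn : segAvg (fun s => -(1 - s)) (cderiv a 2) (freq a y) ξ = -symRem a y ξ := by
    simp only [symRem, segAvg]
    rw [← intervalIntegral.integral_neg]
    congr 1
    ext s
    push_cast
    ring
  rw [hn] at this
  have hne : ((deriv (deriv a) (freq a y) : ℝ) : ℂ) ≠ 0 := by exact_mod_cast ha.nondegenerate _
  simp only [symRem₃]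
  have h2 : cderiv a 2 (freq a y) = ((deriv (deriv a) (freq a y) : ℝ) : ℂ) := by
    simp [cderiv, iteratedDeriv_two_eq]
  rw [h2] at this
  push_cast at this ⊢
  field_simp
  linear_combination (-2) * this

/-- Moving the left end of the segment mean of a' gives `symRem` times dξ_y/dy = 1/a''(ξ_y), and the
subtracted y gives -1. The resulting -1/2 is the constant needed for the cancellation in the linear
part. -/
theorem IsDispersive.hasDerivAt_mul_symRem (ha : IsDispersive a) (hu : IsUniformlyDispersive a)
    (y ξ : ℝ) : HasDerivAt (fun y => ((ξ - freq a y : ℝ) : ℂ) * symRem a y ξ)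
      (-(1 / 2) + ((ξ - freq a y : ℝ) : ℂ) * symRem₃ a y ξ) y := by
  obtain ⟨B, hB0, hB⟩ := hu.exists_bound
  simp only [ha.mul_symRem]
  rw [← ha.symRem_eq]
  have h1 := hasDerivAt_segAvg_left (w := fun _ => 1) continuous_const (ha.hasDerivAt_cderiv 1)
    (ha.continuous_cderiv 2) (hB 2 (by norm_num) (by norm_num)) (freq a y) ξ
  have h2 := (HasDerivAt.scomp y h1 (ha.hasDerivAt_freq y)).sub (hasDerivAt_id y).ofReal_comp
  refine HasDerivAt.congr_deriv h2 ?_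
  simp only [symRem, mul_one]
  rw [Complex.real_smul]
  simp

theorem continuous_mul_freq (ha : IsDispersive a) {σ : ℝ → ℝ → ℂ}
    (hσ : Continuous (Function.uncurry σ)) :
    Continuous (Function.uncurry fun y ξ => ((ξ - freq a y : ℝ) : ℂ) * σ y ξ) := by
  have h1 : Continuous fun z : ℝ × ℝ => σ z.1 z.2 := hσ
  have := ha.continuous_freq
  have : Continuous fun z : ℝ × ℝ => ((z.2 - freq a z.1 : ℝ) : ℂ) * σ z.1 z.2 := by fun_prop
  exact this

/-- Symbols vanishing on the Lagrangian `ξ = ξ_{x/t}` gain a factor `t⁻¹`, uniformly. -/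
theorem IsDispersive.exists_vanishing_const (ha : IsDispersive a) (hu : IsUniformlyDispersive a)
    {R : ℝ} (hR : 0 ≤ R) :
    ∃ C : ℝ, 0 ≤ C ∧ ∀ (t N : ℝ) (h ℓ : ℝ → ℂ), 0 < t → FreqData R t (deriv a) h ℓ → 0 ≤ N →
      eLpNorm h 2 volume ≤ ENNReal.ofReal N → eLpNorm ℓ 2 volume ≤ ENNReal.ofReal N →
      ∀ (B : ℝ) (m : ℝ → ℝ → ℂ), IsSymbol B m →
        L2Bound (op h fun x ξ => ((ξ - freq a (x / t) : ℝ) : ℂ) * m (x / t) ξ)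
          (t⁻¹ * (C * B * N)) := by
  obtain ⟨B₀, b, hb, hbe⟩ := ha.exists_isSymbol_quotient hu
  have hB₀ := hb.nonneg
  refine ⟨2 * ((1 + 2 * R) * (4 * B₀)), by positivity, ?_⟩
  intro t N h ℓ ht H hN0 hN hN' B m hm
  have key := H.l2Bound_op_vanishing ha.continuous_deriv hR ht hN0 hN hN' (hb.mul hm)
  have he : op h (fun x ξ => ((ξ - freq a (x / t) : ℝ) : ℂ) * m (x / t) ξ) =
      op h (fun x ξ => ((deriv a ξ - x / t : ℝ) : ℂ) * (b (x / t) ξ * m (x / t) ξ)) := by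
    funext x
    refine op_congr fun ξ => ?_
    rw [hbe, mul_assoc]
  rw [he]
  exact key.mono (le_of_eq (by ring))

end

/-! ### Wave packets and integration by parts in the linear part -/

section

/-- The width factor `|a''(ξ_v)|^{1/2}`. -/
noncomputable def width (a : ℝ → ℝ) (v : ℝ) : ℝ := Real.sqrt |deriv (deriv a) (freq a v)|

/-- The rescaled variable `y = (x - v t) / (t^{1/2} |a''(ξ_v)|^{1/2})`. -/
noncomputable def scaled (a : ℝ → ℝ) (v t x : ℝ) : ℝ := (x - v * t) / (Real.sqrt t * width a v)

/-- The phase factor `e^{i t φ(x/t)}`. -/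
noncomputable def carrier (a : ℝ → ℝ) (t x : ℝ) : ℂ :=
  Complex.exp (Complex.I * ((t * phase a (x / t) : ℝ) : ℂ))

/-- The time derivative of the wave packet. -/
noncomputable def packetDt (a : ℝ → ℝ) (χ : ℝ → ℂ) (v t x : ℝ) : ℂ :=
  ((width a v)⁻¹ : ℝ) * (((-v / (Real.sqrt t * width a v) - scaled a v t x / (2 * t) : ℝ) : ℂ) *
    deriv χ (scaled a v t x) - Complex.I * a (freq a (x / t)) * χ (scaled a v t x)) * carrier a t x

variable {a : ℝ → ℝ} {χ : ℝ → ℂ}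

theorem packet_eq (a : ℝ → ℝ) (χ : ℝ → ℂ) (v t x : ℝ) :
    packet a χ v t x = ((width a v)⁻¹ : ℝ) * χ (scaled a v t x) * carrier a t x := rfl

theorem IsDispersive.width_pos (ha : IsDispersive a) (v : ℝ) : 0 < width a v :=
  Real.sqrt_pos.2 (abs_pos.2 (ha.nondegenerate _))

theorem hasDerivAt_scaled (v t x : ℝ) :
    HasDerivAt (scaled a v t) (Real.sqrt t * width a v)⁻¹ x := by
  have := ((hasDerivAt_id x).sub_const (v * t)).div_const (Real.sqrt t * width a v)
  exact this.congr_deriv (one_div _)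

theorem norm_carrier (a : ℝ → ℝ) (t x : ℝ) : ‖carrier a t x‖ = 1 := norm_cexp_I_mul _

theorem IsDispersive.hasDerivAt_conj_carrier (ha : IsDispersive a) {t : ℝ} (ht : t ≠ 0) (x : ℝ) :
    HasDerivAt (fun x => (starRingEnd ℂ) (carrier a t x))
      (-(Complex.I * freq a (x / t)) * (starRingEnd ℂ) (carrier a t x)) x := by
  have h1 : HasDerivAt (carrier a t) (carrier a t x * (Complex.I * (freq a (x / t) : ℝ))) x :=
    ((ha.hasDerivAt_phase_div ht x).ofReal_comp.const_mul Complex.I).cexp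
  refine h1.star.congr_deriv ?_
  simp only [RCLike.star_def, map_mul, Complex.conj_I, Complex.conj_ofReal]
  ring

theorem IsDispersive.hasDerivAt_packet (ha : IsDispersive a) (hχ : ContDiff ℝ ∞ χ) {t : ℝ}
    (ht : 0 < t) (v x : ℝ) : HasDerivAt (fun t => packet a χ v t x) (packetDt a χ v t x) t := by
  have hκ := (ha.width_pos v).ne'
  have hst := (Real.sqrt_pos.2 ht).ne'
  have hsq : Real.sqrt t ^ 2 = t := Real.sq_sqrt ht.le
  have h1 : HasDerivAt (fun t => scaled a v t x)
      (-v / (Real.sqrt t * width a v) - scaled a v t x / (2 * t)) t := by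
    have n1 : HasDerivAt (fun t : ℝ => x - v * t) (-v) t := by
      simpa using ((hasDerivAt_id t).const_mul v).const_sub x
    have n2 := (Real.hasDerivAt_sqrt ht.ne').mul_const (width a v)
    refine (n1.div n2 (mul_ne_zero hst hκ)).congr_deriv ?_
    simp only [scaled]
    conv_rhs => rw [← hsq]
    rw [Real.sqrt_sq (Real.sqrt_nonneg t)]
    field_simp
    ring_nf
    rw [hsq]
    ring
  have h2 : HasDerivAt (fun t => carrier a t x)
      (carrier a t x * (Complex.I * (-a (freq a (x / t)) : ℝ))) t :=
    ((ha.hasDerivAt_phase_time ht.ne' x).ofReal_comp.const_mul Complex.I).cexp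
  have h3 : HasDerivAt (fun t => χ (scaled a v t x))
      (((-v / (Real.sqrt t * width a v) - scaled a v t x / (2 * t) : ℝ) : ℂ) *
        deriv χ (scaled a v t x)) t :=
    (HasDerivAt.scomp t (hχ.differentiable (by simp) _).hasDerivAt h1).congr_deriv
      (Complex.real_smul ..)
  refine ((h3.const_mul (((width a v)⁻¹ : ℝ) : ℂ)).mul h2).congr_deriv ?_
  simp only [packetDt]
  push_cast
  ring

theorem exists_bump_bounds (hχ : ContDiff ℝ ∞ χ) (hχc : HasCompactSupport χ) :
    ∃ ρ M : ℝ, 0 < ρ ∧ 0 < M ∧ (∀ y, ρ < |y| → χ y = 0 ∧ deriv χ y = 0) ∧ (∀ y, ‖χ y‖ ≤ M) ∧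
      ∀ y, ‖deriv χ y‖ ≤ M := by
  obtain ⟨ρ, hρ⟩ := hχc.isBounded.subset_closedBall (0 : ℝ)
  obtain ⟨M₀, hM₀⟩ := hχ.continuous.bounded_above_of_compact_support hχc
  obtain ⟨M₁, hM₁⟩ := (hχ.continuous_deriv (by simp)).bounded_above_of_compact_support hχc.deriv
  refine ⟨max ρ 1, max (max M₀ M₁) 1, by positivity, by positivity, fun y hy => ?_,
    fun y => (hM₀ y).trans ((le_max_left _ _).trans (le_max_left _ _)),
    fun y => (hM₁ y).trans ((le_max_right _ _).trans (le_max_left _ _))⟩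
  have : y ∉ tsupport χ := fun h => by
    have := hρ h
    rw [mem_closedBall_zero_iff, Real.norm_eq_abs] at this
    exact absurd (this.trans (le_max_left ρ 1)) (not_le.2 hy)
  exact ⟨image_eq_zero_of_notMem_tsupport this,
    image_eq_zero_of_notMem_tsupport fun h => this (tsupport_deriv_subset h)⟩

theorem scaled_support (ha : IsDispersive a) {t v x ρ κ₁ : ℝ} (ht : 0 < t) (hκ : width a v ≤ κ₁)
    (hρ : 0 ≤ ρ) (hx : x ∉ Icc (v * t - ρ * κ₁ * Real.sqrt t) (v * t + ρ * κ₁ * Real.sqrt t)) :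
    ρ < |scaled a v t x| := by
  by_contra hcon
  refine hx ?_
  have hp : 0 < Real.sqrt t * width a v := mul_pos (Real.sqrt_pos.2 ht) (ha.width_pos v)
  rw [not_lt, scaled, abs_div, abs_of_pos hp, div_le_iff₀ hp] at hcon
  have h2 : ρ * (Real.sqrt t * width a v) ≤ ρ * κ₁ * Real.sqrt t := by
    have := mul_le_mul_of_nonneg_left hκ (mul_nonneg hρ (Real.sqrt_nonneg t))
    nlinarith
  have := abs_le.1 (hcon.trans h2)
  exact ⟨by linarith [this.1], by linarith [this.2]⟩

theorem integrable_of_continuous_of_support {F : ℝ → ℂ} {c d : ℝ} (hF : Continuous F)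
    (h : ∀ x, x ∉ Icc c d → F x = 0) : Integrable F :=
  hF.integrable_of_hasCompactSupport (HasCompactSupport.intro isCompact_Icc h)

/-- The remainder after integrating by parts in the linear part of the equation for `γ`. -/
noncomputable def linRem (a : ℝ → ℝ) (χ : ℝ → ℂ) (D S T : ℝ → ℂ) (v t x : ℝ) : ℂ :=
  (starRingEnd ℂ) (carrier a t x) *
    (-((2 * Real.sqrt t)⁻¹ : ℝ) * Complex.I * scaled a v t x * D x *
        (starRingEnd ℂ) (χ (scaled a v t x)) +
      ((width a v)⁻¹ * (Real.sqrt t * width a v)⁻¹ : ℝ) * S x *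
        (starRingEnd ℂ) (deriv χ (scaled a v t x)) +
      (t⁻¹ * (width a v)⁻¹ : ℝ) * T x * (starRingEnd ℂ) (χ (scaled a v t x)))

/-- The functions stand for u and for operators with symbols, writing θ = ξ - ξ_{x/t}: D has symbol
θ, S has θ·`symRem`, Z has θ²·`symRem`, T has θ·`symRem₃`. The term a(ξ_{x/t})U cancels the time
derivative of the phase. Everything else that is not small is an exact derivative. -/
theorem IsDispersive.integral_linear_eq (ha : IsDispersive a) (hχ : ContDiff ℝ ∞ χ)
    (hχc : HasCompactSupport χ) {t : ℝ} (ht : 0 < t) (v : ℝ) {U S D Z T AU : ℝ → ℂ}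
    (hU : ∀ x, HasDerivAt U (Complex.I * (D x + freq a (x / t) * U x)) x)
    (hS : ∀ x, HasDerivAt S
      (Complex.I * (Z x + freq a (x / t) * S x) + (t : ℂ)⁻¹ * (T x - 1 / 2 * U x)) x)
    (hAU : ∀ x, AU x = a (freq a (x / t)) * U x + (x / t : ℝ) * D x + Z x)
    (hD : Continuous D) (hZ : Continuous Z) (hT : Continuous T) :
    ∫ x, (-(Complex.I * AU x) * (starRingEnd ℂ) (packet a χ v t x) +
      U x * (starRingEnd ℂ) (packetDt a χ v t x)) = ∫ x, linRem a χ D S T v t x := by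
  obtain ⟨ρ, M, hρ, hM, hsupp, -, -⟩ := exists_bump_bounds hχ hχc
  have hUc : Continuous U := continuous_iff_continuousAt.2 fun x => (hU x).continuousAt
  have hSc : Continuous S := continuous_iff_continuousAt.2 fun x => (hS x).continuousAt
  have hAUc : Continuous AU := by
    have h1 := ha.smooth.continuous
    have h2 := ha.continuous_freq
    rw [show AU = fun x => (a (freq a (x / t)) : ℂ) * U x + (x / t : ℝ) * D x + Z x from funext hAU]
    fun_prop
  have hκ := ha.width_pos v
  have hst := Real.sqrt_pos.2 ht
  have hEc : Continuous fun x => (starRingEnd ℂ) (carrier a t x) :=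
    continuous_iff_continuousAt.2 fun x => (ha.hasDerivAt_conj_carrier ht.ne' x).continuousAt
  have hEc' : Continuous fun x => carrier a t x := by
    exact (Complex.continuous_conj.comp hEc).congr fun x => Complex.conj_conj _
  have hyc : Continuous (scaled a v t) :=
    continuous_iff_continuousAt.2 fun x => (hasDerivAt_scaled v t x).continuousAt
  have hχ0 := hχ.continuous
  have hχ1 : Continuous (deriv χ) := hχ.continuous_deriv (by simp)
  have hfc := ha.continuous_freq
  have hac := ha.smooth.continuous
  have hcz : ∀ x, HasDerivAt (fun x => (starRingEnd ℂ) (χ (scaled a v t x)))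
      (((Real.sqrt t * width a v)⁻¹ : ℝ) * (starRingEnd ℂ) (deriv χ (scaled a v t x))) x := by
    intro x
    have h1 := HasDerivAt.scomp x (hχ.differentiable (by simp) (scaled a v t x)).hasDerivAt
      (hasDerivAt_scaled (a := a) v t x)
    refine h1.star.congr_deriv ?_
    rw [Complex.real_smul]
    simp
  have hsx : ∀ x, HasDerivAt (fun x => (scaled a v t x : ℂ))
      (((Real.sqrt t * width a v)⁻¹ : ℝ) : ℂ) x := fun x => (hasDerivAt_scaled v t x).ofReal_comp
  have hxt : ∀ x : ℝ, HasDerivAt (fun x : ℝ => ((x / t : ℝ) : ℂ)) ((t⁻¹ : ℝ) : ℂ) x := fun x =>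
    (((hasDerivAt_id x).div_const t).congr_deriv (one_div t)).ofReal_comp
  -- The conjugated carrier removes ξ_{x/t} from the derivatives, so that differentiating -(x/t)U
  -- and -S reproduces the terms (x/t)D and Z of A(D)u. Up to the amplitude, the coefficients of Uχ
  -- are -1/t from x/t, 1/(2t) from the -1/2 in the derivative of S, and 1/(2t) from the third term
  -- of Φ: they add up to zero.
  set Φ : ℝ → ℂ := fun x => (starRingEnd ℂ) (carrier a t x) *
    ((-((x / t : ℝ) : ℂ) * U x * ((width a v)⁻¹ : ℝ) - S x * ((width a v)⁻¹ : ℝ) +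
      ((2 * Real.sqrt t)⁻¹ : ℝ) * U x * scaled a v t x) *
        (starRingEnd ℂ) (χ (scaled a v t x))) with hΦ
  set I₀ : ℝ → ℂ := fun x => -(Complex.I * AU x) * (starRingEnd ℂ) (packet a χ v t x) +
      U x * (starRingEnd ℂ) (packetDt a χ v t x) with hI₀
  have hder : ∀ x, HasDerivAt Φ (I₀ x - linRem a χ D S T v t x) x := by
    intro x
    have h1 := (ha.hasDerivAt_conj_carrier ht.ne' x).mul
      (((((hxt x).neg.mul (hU x)).mul_const (((width a v)⁻¹ : ℝ) : ℂ)).sub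
        ((hS x).mul_const (((width a v)⁻¹ : ℝ) : ℂ))).add
        (((hU x).const_mul (((2 * Real.sqrt t)⁻¹ : ℝ) : ℂ)).mul (hsx x)) |>.mul (hcz x))
    refine h1.congr_deriv ?_
    have hx : x = v * t + scaled a v t x * (Real.sqrt t * width a v) := by
      rw [scaled]; field_simp; ring
    -- This matches the terms with χ': transport at speed x/t is transport at speed v plus the
    -- contribution of the growing width √t.
    have hxt' : x / t = v + scaled a v t x * width a v / Real.sqrt t := by
      have h2 : t / Real.sqrt t = Real.sqrt t := Real.div_sqrt
      rw [div_eq_iff ht.ne']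
      linear_combination hx - scaled a v t x * width a v * h2
    simp only [hI₀, linRem, packet_eq, packetDt, hAU, map_mul, map_sub, Complex.conj_ofReal,
      Complex.conj_I, Pi.mul_apply, Pi.neg_apply, Pi.sub_apply, Pi.add_apply]
    rw [hxt']
    have htc : ((t : ℝ) : ℂ) = (Real.sqrt t : ℂ) ^ 2 := by
      exact_mod_cast (Real.sq_sqrt ht.le).symm
    have hstc : (Real.sqrt t : ℂ) ≠ 0 := by exact_mod_cast hst.ne'
    have hκc : (width a v : ℂ) ≠ 0 := by exact_mod_cast hκ.ne'
    generalize (starRingEnd ℂ) (carrier a t x) = E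
    generalize (starRingEnd ℂ) (χ (scaled a v t x)) = X
    generalize (starRingEnd ℂ) (deriv χ (scaled a v t x)) = X'
    generalize ((scaled a v t x : ℝ)) = y
    generalize (freq a (v + y * width a v / Real.sqrt t)) = θ
    generalize a θ = aθ
    generalize U x = u
    generalize S x = s
    generalize D x = d
    generalize Z x = z
    generalize T x = τ
    push_cast
    rw [htc]
    field_simp
    ring
  have hs0 : ∀ x, x ∉ Icc (v * t - ρ * width a v * Real.sqrt t)
      (v * t + ρ * width a v * Real.sqrt t) →
      χ (scaled a v t x) = 0 ∧ deriv χ (scaled a v t x) = 0 := fun x hx =>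
    hsupp _ (scaled_support ha ht le_rfl hρ.le hx)
  have hint : ∀ {F : ℝ → ℂ}, Continuous F → (∀ x, x ∉ Icc (v * t - ρ * width a v * Real.sqrt t)
      (v * t + ρ * width a v * Real.sqrt t) → F x = 0) → Integrable F :=
    fun h1 h2 => integrable_of_continuous_of_support h1 h2
  have i0 : Integrable I₀ := by
    refine hint ?_ fun x hx => ?_
    · rw [hI₀]
      simp only [packet_eq, packetDt, map_mul, map_sub]
      fun_prop
    · simp [hI₀, packet_eq, packetDt, hs0 x hx]
  have i1 : Integrable (linRem a χ D S T v t) := by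
    refine hint ?_ fun x hx => ?_
    · unfold linRem
      fun_prop
    · simp [linRem, hs0 x hx]
  have i2 : Integrable Φ := by
    refine hint ?_ fun x hx => ?_
    · rw [hΦ]
      fun_prop
    · simp [hΦ, hs0 x hx]
  have := integral_eq_zero_of_hasDerivAt_of_integrable hder (i0.sub i1) i2
  rw [integral_sub i0 i1] at this
  exact sub_eq_zero.1 this

end

/-! ### Estimate of the linear part -/

section

theorem L2Bound.norm_add {F G : ℝ → ℂ} {c d : ℝ} (hF : L2Bound F c) (hG : L2Bound G d)
    (hc : 0 ≤ c) (hd : 0 ≤ d) : L2Bound (fun x => ((‖F x‖ + ‖G x‖ : ℝ) : ℂ)) (c + d) := by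
  have h1 : ∀ {F : ℝ → ℂ} {c : ℝ}, L2Bound F c → L2Bound (fun x => ((‖F x‖ : ℝ) : ℂ)) c :=
    fun hF => ⟨Complex.continuous_ofReal.comp_aestronglyMeasurable hF.1.norm, by
      refine (le_of_eq ?_).trans hF.2
      exact eLpNorm_congr_norm_ae (Filter.Eventually.of_forall fun x => by simp)⟩
  have := (h1 hF).add (h1 hG) hc hd
  simpa only [Complex.ofReal_add] using this

theorem norm_norm_add (z w : ℂ) : ‖((‖z‖ + ‖w‖ : ℝ) : ℂ)‖ = ‖z‖ + ‖w‖ := by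
  rw [Complex.norm_real, Real.norm_of_nonneg (by positivity)]

/-- Separates the roles of v: G may depend on v, while its majorant F does not, so one L² bound on F
serves every velocity. -/
theorem norm_integral_le_window {F G : ℝ → ℂ} {t δ v : ℝ} (hF : MemLp F 2 volume)
    (h : ∀ x, ‖G x‖ ≤ ‖F x‖) (h0 : ∀ x, x ∉ Icc (v * t - δ) (v * t + δ) → G x = 0) :
    ‖∫ x, G x‖ ≤ window F t δ v := by
  rw [← setIntegral_eq_integral_of_forall_compl_eq_zero (s := Icc (v * t - δ) (v * t + δ)) h0]
  exact norm_integral_le_of_norm_le (integrableOn_window hF _ _).norm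
    (Filter.Eventually.of_forall h)

variable {a : ℝ → ℝ} {χ : ℝ → ℂ}

/-- Uniform bounds for the cutoff and for the widths of the packets. -/
structure PacketBounds (a : ℝ → ℝ) (χ : ℝ → ℂ) (ρ M κ₀ κ₁ : ℝ) : Prop where
  ρ_pos : 0 < ρ
  M_pos : 0 < M
  κ₀_pos : 0 < κ₀
  supp : ∀ y, ρ < |y| → χ y = 0 ∧ deriv χ y = 0
  le : ∀ y, ‖χ y‖ ≤ M
  le' : ∀ y, ‖deriv χ y‖ ≤ M
  width_ge : ∀ v, κ₀ ≤ width a v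
  width_le : ∀ v, width a v ≤ κ₁

theorem exists_packetBounds (hu : IsUniformlyDispersive a) (hχ : ContDiff ℝ ∞ χ)
    (hχc : HasCompactSupport χ) : ∃ ρ M κ₀ κ₁, PacketBounds a χ ρ M κ₀ κ₁ := by
  obtain ⟨ρ, M, hρ, hM, h1, h2, h3⟩ := exists_bump_bounds hχ hχc
  obtain ⟨c, hc0, hc⟩ := hu.lower
  obtain ⟨B, hB⟩ := hu.upper 2 le_rfl
  refine ⟨ρ, M, Real.sqrt c, Real.sqrt B, hρ, hM, Real.sqrt_pos.2 hc0, h1, h2, h3,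
    fun v => Real.sqrt_le_sqrt (hc _), fun v => Real.sqrt_le_sqrt ?_⟩
  rw [← iteratedDeriv_two_eq]
  exact hB _

variable {ρ M κ₀ κ₁ : ℝ}

theorem PacketBounds.κ₁_pos (hb : PacketBounds a χ ρ M κ₀ κ₁) : 0 < κ₁ :=
  hb.κ₀_pos.trans_le ((hb.width_ge 0).trans (hb.width_le 0))

theorem PacketBounds.vanish (hb : PacketBounds a χ ρ M κ₀ κ₁) (ha : IsDispersive a) {t v x : ℝ}
    (ht : 0 < t)
    (hx : x ∉ Icc (v * t - ρ * κ₁ * Real.sqrt t) (v * t + ρ * κ₁ * Real.sqrt t)) :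
    χ (scaled a v t x) = 0 ∧ deriv χ (scaled a v t x) = 0 :=
  hb.supp _ (scaled_support ha ht (hb.width_le v) hb.ρ_pos.le hx)

/-- The factor y is bounded by ρ on the support of χ, and t⁻¹ ≤ t^{-1/2} puts the three terms on the
same footing. -/
theorem PacketBounds.norm_linRem_le (hb : PacketBounds a χ ρ M κ₀ κ₁) {t : ℝ}
    (ht : 1 ≤ t) (v : ℝ) (D S T : ℝ → ℂ) (x : ℝ) :
    ‖linRem a χ D S T v t x‖ ≤ (Real.sqrt t)⁻¹ * (M * (ρ + κ₀⁻¹ ^ 2 + κ₀⁻¹)) *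
      (‖D x‖ + ‖S x‖ + ‖T x‖) := by
  have hM := hb.M_pos.le
  have hρ := hb.ρ_pos.le
  have hκ0 := hb.κ₀_pos
  have ht0 : 0 < t := by linarith
  have hst := Real.sqrt_pos.2 ht0
  have hwi : (width a v)⁻¹ ≤ κ₀⁻¹ := inv_anti₀ hκ0 (hb.width_ge v)
  have hw0 : 0 < width a v := hκ0.trans_le (hb.width_ge v)
  have hyχ : |scaled a v t x| * ‖χ (scaled a v t x)‖ ≤ ρ * M := by
    by_cases h : ρ < |scaled a v t x|
    · rw [(hb.supp _ h).1]; simp; positivity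
    · exact mul_le_mul (not_lt.1 h) (hb.le _) (norm_nonneg _) hρ
  have htt : t⁻¹ ≤ (Real.sqrt t)⁻¹ := inv_anti₀ hst (Real.sqrt_le_iff.2 ⟨ht0.le, by nlinarith⟩)
  simp only [linRem, norm_mul, RCLike.norm_conj, norm_carrier, one_mul]
  refine (norm_add₃_le).trans ?_
  simp only [norm_mul, norm_neg, RCLike.norm_conj, Complex.norm_real, Complex.norm_I, mul_one,
    Real.norm_eq_abs, abs_inv, abs_mul, abs_of_pos hst, abs_of_pos hw0, abs_of_pos ht0, abs_two]
  have e1 : (2 * Real.sqrt t)⁻¹ * |scaled a v t x| * ‖D x‖ * ‖χ (scaled a v t x)‖ ≤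
      (Real.sqrt t)⁻¹ * (M * ρ) * ‖D x‖ := by
    have : (2 * Real.sqrt t)⁻¹ ≤ (Real.sqrt t)⁻¹ := inv_anti₀ hst (by linarith)
    calc _ = (2 * Real.sqrt t)⁻¹ * (|scaled a v t x| * ‖χ (scaled a v t x)‖) * ‖D x‖ := by ring
      _ ≤ (Real.sqrt t)⁻¹ * (ρ * M) * ‖D x‖ := by gcongr
      _ = _ := by ring
  have e2 : (width a v)⁻¹ * (Real.sqrt t * width a v)⁻¹ * ‖S x‖ * ‖deriv χ (scaled a v t x)‖ ≤
      (Real.sqrt t)⁻¹ * (M * κ₀⁻¹ ^ 2) * ‖S x‖ := by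
    calc _ = (Real.sqrt t)⁻¹ * (‖deriv χ (scaled a v t x)‖ * (width a v)⁻¹ ^ 2) * ‖S x‖ := by
          rw [mul_inv]; ring
      _ ≤ _ := by gcongr; exact hb.le' _
  have e3 : t⁻¹ * (width a v)⁻¹ * ‖T x‖ * ‖χ (scaled a v t x)‖ ≤
      (Real.sqrt t)⁻¹ * (M * κ₀⁻¹) * ‖T x‖ := by
    calc _ = t⁻¹ * (‖χ (scaled a v t x)‖ * (width a v)⁻¹) * ‖T x‖ := by ring
      _ ≤ _ := by gcongr; exact hb.le _
  have p : 0 ≤ (Real.sqrt t)⁻¹ := by positivity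
  have p1 : (Real.sqrt t)⁻¹ * (M * ρ) * ‖D x‖ ≤
      (Real.sqrt t)⁻¹ * (M * (ρ + κ₀⁻¹ ^ 2 + κ₀⁻¹)) * ‖D x‖ := by
    gcongr
    have : 0 ≤ κ₀⁻¹ ^ 2 + κ₀⁻¹ := by positivity
    linarith
  have p2 : (Real.sqrt t)⁻¹ * (M * κ₀⁻¹ ^ 2) * ‖S x‖ ≤
      (Real.sqrt t)⁻¹ * (M * (ρ + κ₀⁻¹ ^ 2 + κ₀⁻¹)) * ‖S x‖ := by
    gcongr
    have : 0 ≤ κ₀⁻¹ := by positivity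
    linarith
  have p3 : (Real.sqrt t)⁻¹ * (M * κ₀⁻¹) * ‖T x‖ ≤
      (Real.sqrt t)⁻¹ * (M * (ρ + κ₀⁻¹ ^ 2 + κ₀⁻¹)) * ‖T x‖ := by
    gcongr
    have : 0 ≤ κ₀⁻¹ ^ 2 := by positivity
    linarith
  linarith

theorem continuous_op {R : ℝ} {h : ℝ → ℂ} {σ : ℝ → ℝ → ℂ} (hσ : Continuous (Function.uncurry σ))
    (hh : Integrable h) (hs : ∀ ξ, R < |ξ| → h ξ = 0) : Continuous (op h σ) := by
  refine continuous_iff_continuousAt.2 fun x => ?_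
  obtain ⟨B, hB⟩ := (isCompact_Icc (a := x - 1) (b := x + 1)).prod
    (isCompact_Icc (a := -R) (b := R)) |>.exists_bound_of_continuousOn hσ.continuousOn
  refine ContinuousAt.mul continuousAt_const ?_
  refine continuousAt_of_dominated (bound := fun ξ => B * ‖h ξ‖)
    (Filter.Eventually.of_forall fun x => (integrable_symbol hσ hh hs x).1) ?_
    (hh.norm.const_mul B) ?_
  · filter_upwards [Icc_mem_nhds (show x - 1 < x by linarith) (show x < x + 1 by linarith)] with y hy
    refine Filter.Eventually.of_forall fun ξ => ?_
    rw [norm_mul, norm_cexp_I_mul, mul_one, norm_mul]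
    by_cases hξ : R < |ξ|
    · simp [hs ξ hξ]
    · gcongr
      exact hB (y, ξ) ⟨hy, by rw [mem_Icc, ← abs_le]; exact not_lt.1 hξ⟩
  · refine Filter.Eventually.of_forall fun ξ => Continuous.continuousAt ?_
    have : Continuous fun x => σ x ξ := hσ.comp (by fun_prop : Continuous fun x : ℝ => (x, ξ))
    fun_prop

theorem isSymbol_one : IsSymbol 1 (fun _ _ => 1) :=
  ⟨fun _ _ => 0, fun _ _ => 0, continuous_const, continuous_const, continuous_const,
    fun _ _ => hasDerivAt_const _ _, fun _ _ => hasDerivAt_const _ _, fun _ _ => by simp,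
    fun _ _ => by simp, fun _ _ => by simp⟩

/-- `op` of the vanishing symbol `(ξ - ξ_{x/t}) m(x/t, ξ)`. -/
noncomputable def opVan (a : ℝ → ℝ) (t : ℝ) (h : ℝ → ℂ) (m : ℝ → ℝ → ℂ) : ℝ → ℂ :=
  op h fun x ξ => ((ξ - freq a (x / t) : ℝ) : ℂ) * m (x / t) ξ

theorem IsDispersive.continuous_opVan_symbol (ha : IsDispersive a) {m : ℝ → ℝ → ℂ}
    (hm : Continuous (Function.uncurry m)) (t : ℝ) :
    Continuous (Function.uncurry fun x ξ => ((ξ - freq a (x / t) : ℝ) : ℂ) * m (x / t) ξ) :=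
  continuous_uncurry_div (continuous_mul_freq ha hm) t

theorem IsDispersive.hasDerivAt_synth (ha : IsDispersive a) {R t : ℝ} {h : ℝ → ℂ}
    (hh : Integrable h) (hs : ∀ ξ, R < |ξ| → h ξ = 0) (x : ℝ) :
    HasDerivAt (synth h) (Complex.I * (opVan a t h (fun _ _ => 1) x +
      freq a (x / t) * synth h x)) x := by
  have h1 := hasDerivAt_op (h := h) (σ := fun _ _ => 1) (σx := fun _ _ => 0) continuous_const
    continuous_const (fun x ξ => hasDerivAt_const x 1) hh hs x
  have h2 : op h (fun _ _ => 1) = synth h := funext op_one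
  rw [h2] at h1
  refine h1.congr_deriv ?_
  have c1 := ha.continuous_opVan_symbol (m := fun _ _ => 1) continuous_const t
  have c2 : Continuous (Function.uncurry fun x _ : ℝ => ((freq a (x / t) : ℝ) : ℂ) * 1) := by
    have := ha.continuous_freq
    have : Continuous fun z : ℝ × ℝ => ((freq a (z.1 / t) : ℝ) : ℂ) * 1 := by fun_prop
    exact this
  rw [opVan, ← op_one x, ← op_mul_left (fun x => ((freq a (x / t) : ℝ) : ℂ)),
    ← op_add c1 c2 hh hs x, ← op_mul_left (fun _ => Complex.I)]
  refine op_congr fun ξ => ?_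
  push_cast
  ring

/-- `op` of the symbol `(ξ - ξ_{x/t})² r(x/t, ξ)`, where `r` is the second order remainder. -/
noncomputable def opRem (a : ℝ → ℝ) (t : ℝ) (h : ℝ → ℂ) : ℝ → ℂ :=
  op h fun x ξ => ((ξ - freq a (x / t) : ℝ) : ℂ) *
    (((ξ - freq a (x / t) : ℝ) : ℂ) * symRem a (x / t) ξ)

/-- The factor iξ from the exponential is split at ξ_{x/t}. The symbol depends on x through y = x/t,
so its own x-derivative carries t⁻¹ and the constant -1/2. -/
theorem IsDispersive.hasDerivAt_opVan_symRem (ha : IsDispersive a)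
    (hu : IsUniformlyDispersive a) {R t : ℝ} {h : ℝ → ℂ} (hh : Integrable h)
    (hs : ∀ ξ, R < |ξ| → h ξ = 0) (x : ℝ) :
    HasDerivAt (opVan a t h (symRem a)) (Complex.I * (opRem a t h x +
      freq a (x / t) * opVan a t h (symRem a) x) +
      (t : ℂ)⁻¹ * (opVan a t h (symRem₃ a) x - 1 / 2 * synth h x)) x := by
  obtain ⟨B, ⟨-, -, hrc, -⟩, ⟨-, -, hrc₃, -⟩⟩ := ha.exists_isSymbol_rem hu
  have hcf := ha.continuous_freq
  have cS := ha.continuous_opVan_symbol hrc t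
  have cT := ha.continuous_opVan_symbol hrc₃ t
  have cZ := ha.continuous_opVan_symbol (continuous_mul_freq ha hrc) t
  have c3 : Continuous (Function.uncurry fun x ξ : ℝ => (t : ℂ)⁻¹ *
      (-(1 / 2) + ((ξ - freq a (x / t) : ℝ) : ℂ) * symRem₃ a (x / t) ξ)) := by
    have h1 : Continuous fun z : ℝ × ℝ =>
      ((z.2 - freq a (z.1 / t) : ℝ) : ℂ) * symRem₃ a (z.1 / t) z.2 := cT
    have : Continuous fun z : ℝ × ℝ => (t : ℂ)⁻¹ *
      (-(1 / 2) + ((z.2 - freq a (z.1 / t) : ℝ) : ℂ) * symRem₃ a (z.1 / t) z.2) := by fun_prop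
    exact this
  have h1 := hasDerivAt_op cS c3 (fun x ξ => by
    have h2 := HasDerivAt.scomp x (ha.hasDerivAt_mul_symRem hu (x / t) ξ)
      ((hasDerivAt_id x).div_const t)
    refine h2.congr_deriv ?_
    rw [Complex.real_smul, one_div]
    push_cast
    ring) hh hs x
  refine h1.congr_deriv ?_
  have cc : Continuous (Function.uncurry fun x _ : ℝ => (-(1 / 2) : ℂ) * 1) := by
    have : Continuous fun _ : ℝ × ℝ => (-(1 / 2) : ℂ) * 1 := continuous_const
    exact this
  have cfS : Continuous (Function.uncurry fun x ξ : ℝ => ((freq a (x / t) : ℝ) : ℂ) *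
      (((ξ - freq a (x / t) : ℝ) : ℂ) * symRem a (x / t) ξ)) := by
    have h1 : Continuous fun z : ℝ × ℝ =>
      ((z.2 - freq a (z.1 / t) : ℝ) : ℂ) * symRem a (z.1 / t) z.2 := cS
    have : Continuous fun z : ℝ × ℝ => ((freq a (z.1 / t) : ℝ) : ℂ) *
      (((z.2 - freq a (z.1 / t) : ℝ) : ℂ) * symRem a (z.1 / t) z.2) := by fun_prop
    exact this
  have e1 : opRem a t h x + freq a (x / t) * opVan a t h (symRem a) x = op h (fun x ξ => ((ξ : ℝ) : ℂ) *
      (((ξ - freq a (x / t) : ℝ) : ℂ) * symRem a (x / t) ξ)) x := by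
    rw [opRem, opVan, ← op_mul_left (fun x => ((freq a (x / t) : ℝ) : ℂ)),
      ← op_add cZ cfS hh hs x]
    refine op_congr fun ξ => ?_
    push_cast
    ring
  have e2 : opVan a t h (symRem₃ a) x - 1 / 2 * synth h x = op h (fun x ξ => -(1 / 2) +
      ((ξ - freq a (x / t) : ℝ) : ℂ) * symRem₃ a (x / t) ξ) x := by
    rw [sub_eq_neg_add, ← neg_mul, ← op_one x, ← op_mul_left (fun _ => (-(1 / 2) : ℂ)), opVan,
      ← op_add cc cT hh hs x]
    refine op_congr fun ξ => ?_
    ring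
  have cX : Continuous (Function.uncurry fun x ξ : ℝ => Complex.I * (((ξ : ℝ) : ℂ) *
      (((ξ - freq a (x / t) : ℝ) : ℂ) * symRem a (x / t) ξ))) := by
    have h1 : Continuous fun z : ℝ × ℝ =>
      ((z.2 - freq a (z.1 / t) : ℝ) : ℂ) * symRem a (z.1 / t) z.2 := cS
    have : Continuous fun z : ℝ × ℝ => Complex.I * (((z.2 : ℝ) : ℂ) *
      (((z.2 - freq a (z.1 / t) : ℝ) : ℂ) * symRem a (z.1 / t) z.2)) := by fun_prop
    exact this
  rw [e1, e2, ← op_mul_left (fun _ => Complex.I), ← op_mul_left (fun _ => (t : ℂ)⁻¹),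
    ← op_add cX c3 hh hs x]

theorem IsDispersive.synth_mul_eq (ha : IsDispersive a) (hu : IsUniformlyDispersive a) {R : ℝ}
    (t : ℝ) {h : ℝ → ℂ} (hh : Integrable h) (hs : ∀ ξ, R < |ξ| → h ξ = 0) (x : ℝ) :
    synth (fun ξ => a ξ * h ξ) x = a (freq a (x / t)) * synth h x +
      (x / t : ℝ) * opVan a t h (fun _ _ => 1) x + opRem a t h x := by
  obtain ⟨B, ⟨-, -, hrc, -⟩, -⟩ := ha.exists_isSymbol_rem hu
  have hcf := ha.continuous_freq
  have hca := ha.smooth.continuous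
  have cZ := ha.continuous_opVan_symbol (continuous_mul_freq ha hrc) t
  have c1 : Continuous (Function.uncurry fun x _ : ℝ => ((a (freq a (x / t)) : ℝ) : ℂ) * 1) := by
    have : Continuous fun z : ℝ × ℝ => ((a (freq a (z.1 / t)) : ℝ) : ℂ) * 1 := by fun_prop
    exact this
  have c2 : Continuous (Function.uncurry fun x ξ : ℝ => ((x / t : ℝ) : ℂ) *
      (((ξ - freq a (x / t) : ℝ) : ℂ) * 1)) := by
    have : Continuous fun z : ℝ × ℝ => ((z.1 / t : ℝ) : ℂ) *
      (((z.2 - freq a (z.1 / t) : ℝ) : ℂ) * 1) := by fun_prop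
    exact this
  have c12 : Continuous (Function.uncurry fun x ξ : ℝ => ((a (freq a (x / t)) : ℝ) : ℂ) * 1 +
      ((x / t : ℝ) : ℂ) * (((ξ - freq a (x / t) : ℝ) : ℂ) * 1)) := c1.add c2
  rw [← op_one (h := h) x, ← op_mul_left (fun x => ((a (freq a (x / t)) : ℝ) : ℂ)), opVan,
    ← op_mul_left (fun x => ((x / t : ℝ) : ℂ)), ← op_add c1 c2 hh hs x, opRem,
    ← op_add c12 cZ hh hs x]
  have : synth (fun ξ => a ξ * h ξ) x = op h (fun _ ξ => (a ξ : ℂ)) x := rfl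
  rw [this]
  refine op_congr fun ξ => ?_
  rw [ha.taylor_second (x / t) ξ]
  ring

/-- The linear part of the equation for the profile `γ`. -/
theorem IsDispersive.exists_linear_bound (ha : IsDispersive a) (hu : IsUniformlyDispersive a)
    (hχ : ContDiff ℝ ∞ χ) (hχc : HasCompactSupport χ) (hb : PacketBounds a χ ρ M κ₀ κ₁) {R : ℝ}
    (hR : 0 ≤ R) :
    ∃ C : ℝ, 0 ≤ C ∧ ∀ (t N : ℝ) (h ℓ : ℝ → ℂ), 1 ≤ t → FreqData R t (deriv a) h ℓ → 0 ≤ N →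
      eLpNorm h 2 volume ≤ ENNReal.ofReal N → eLpNorm ℓ 2 volume ≤ ENNReal.ofReal N →
      ∃ F : ℝ → ℂ, L2Bound F ((Real.sqrt t)⁻¹ * t⁻¹ * (C * N)) ∧ ∀ v,
        ‖∫ x, (-(Complex.I * synth (fun ξ => a ξ * h ξ) x) *
          (starRingEnd ℂ) (packet a χ v t x) +
          synth h x * (starRingEnd ℂ) (packetDt a χ v t x))‖ ≤
        window F t (ρ * κ₁ * Real.sqrt t) v := by
  obtain ⟨C, hC, hvan⟩ := ha.exists_vanishing_const hu hR
  obtain ⟨B, hr, hr₃⟩ := ha.exists_isSymbol_rem hu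
  have hB := hr.nonneg
  have hM := hb.M_pos.le
  have hρ := hb.ρ_pos.le
  have hκ0 := hb.κ₀_pos
  set K := M * (ρ + κ₀⁻¹ ^ 2 + κ₀⁻¹) with hK
  have hK0 : 0 ≤ K := by positivity
  refine ⟨K * (C * 1 + C * B + C * B), by positivity, ?_⟩
  intro t N h ℓ ht H hN0 hN hN'
  have ht0 : 0 < t := by linarith
  have hh := H.integrable
  have hs := H.supp
  obtain ⟨-, -, hrc, -⟩ := id hr
  obtain ⟨-, -, hrc₃, -⟩ := id hr₃
  set D := opVan a t h (fun _ _ => 1) with hD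
  set S := opVan a t h (symRem a) with hS
  set T := opVan a t h (symRem₃ a) with hT
  have cD := ha.continuous_opVan_symbol (m := fun _ _ => 1) continuous_const t
  have cT := ha.continuous_opVan_symbol hrc₃ t
  have cZ := ha.continuous_opVan_symbol (continuous_mul_freq ha hrc) t
  have bD : L2Bound D (t⁻¹ * (C * 1 * N)) :=
    hvan t N h ℓ ht0 H hN0 hN hN' 1 (fun _ _ => 1) isSymbol_one
  have bS : L2Bound S (t⁻¹ * (C * B * N)) := hvan t N h ℓ ht0 H hN0 hN hN' B (symRem a) hr
  have bT : L2Bound T (t⁻¹ * (C * B * N)) := hvan t N h ℓ ht0 H hN0 hN hN' B (symRem₃ a) hr₃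
  have dU := ha.hasDerivAt_synth (t := t) hh hs
  -- The majorant is built from norms, free of v: t^{-1/2} from the coefficients of the remainder,
  -- t⁻¹ from the vanishing symbols.
  set F : ℝ → ℂ := fun x => (((Real.sqrt t)⁻¹ * K : ℝ) : ℂ) *
    ((‖((‖D x‖ + ‖S x‖ : ℝ) : ℂ)‖ + ‖T x‖ : ℝ) : ℂ) with hF
  have bF : L2Bound F (‖(((Real.sqrt t)⁻¹ * K : ℝ) : ℂ)‖ *
      (t⁻¹ * (C * 1 * N) + t⁻¹ * (C * B * N) + t⁻¹ * (C * B * N))) :=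
    ((bD.norm_add bS (by positivity) (by positivity)).norm_add bT (by positivity)
      (by positivity)).const_mul _
  refine ⟨F, bF.mono (le_of_eq ?_), fun v => ?_⟩
  · rw [Complex.norm_real, Real.norm_of_nonneg (by positivity)]
    ring
  · have hlin := ha.integral_linear_eq hχ hχc ht0 v dU (ha.hasDerivAt_opVan_symRem hu hh hs)
      (ha.synth_mul_eq hu t hh hs) (continuous_op cD hh hs)
      (continuous_op cZ hh hs) (continuous_op cT hh hs)
    refine (congrArg norm hlin).trans_le ?_
    refine norm_integral_le_window bF.memLp (fun x => ?_) fun x hx => ?_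
    · have h1 : ‖F x‖ = (Real.sqrt t)⁻¹ * K * (‖D x‖ + ‖S x‖ + ‖T x‖) := by
        rw [hF]
        simp only [norm_mul, Complex.norm_real]
        rw [Real.norm_of_nonneg (by positivity), Real.norm_of_nonneg (by positivity),
          Real.norm_of_nonneg (by positivity), Real.norm_of_nonneg (by positivity)]
      rw [h1]
      exact hb.norm_linRem_le ht v D S T x
    · have := hb.vanish ha ht0 hx
      simp [linRem, this]

end

/-! ### The cubic form as a superposition of products of translates -/

/-- A cubic symbol is a superposition of characters, with rapidly decaying density `k`. -/
theorem IsCubicSymbol.exists_characters {q : ℝ → ℝ → ℝ → ℂ} (hq : IsCubicSymbol q) :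
    ∃ (k : EuclideanSpace ℝ (Fin 3) → ℂ) (s : Fin 3 → EuclideanSpace ℝ (Fin 3) → ℝ),
      Continuous k ∧ (∀ j, Continuous (s j)) ∧ (∀ j z, |s j z| ≤ 7 * ‖z‖) ∧
      (∀ n : ℕ, Integrable fun z => ‖z‖ ^ n * ‖k z‖) ∧
      ∀ ξ₁ ξ₂ ξ₃, q ξ₁ ξ₂ ξ₃ = ∫ z, k z *
        Complex.exp (Complex.I * ((-(s 0 z * ξ₁ - s 1 z * ξ₂ + s 2 z * ξ₃) : ℝ) : ℂ)) := by
  let e : EuclideanSpace ℝ (Fin 3) → ℝ × ℝ × ℝ := fun ζ => (ζ 0, ζ 1, ζ 2)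
  have he : ContDiff ℝ ∞ e := by fun_prop
  have hsm : ContDiff ℝ ∞ (fun ζ => q (e ζ).1 (e ζ).2.1 (e ζ).2.2) := hq.smooth.comp he
  have hcs : HasCompactSupport (fun ζ => q (e ζ).1 (e ζ).2.1 (e ζ).2.2) := by
    let f : ℝ × ℝ × ℝ → EuclideanSpace ℝ (Fin 3) := fun p => !₂[p.1, p.2.1, p.2.2]
    have hf : Continuous f := by
      refine (PiLp.continuous_toLp 2 _).comp ?_
      refine continuous_pi fun i => ?_
      fin_cases i <;> simp <;> fun_prop
    have hc := hq.compactSupport.isCompact.image hf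
    refine HasCompactSupport.intro hc fun ζ hζ => ?_
    by_contra hne
    refine hζ ⟨e ζ, subset_tsupport _ hne, ?_⟩
    ext i
    fin_cases i <;> simp [f, e]
  let φ : SchwartzMap (EuclideanSpace ℝ (Fin 3)) ℂ := hcs.toSchwartzMap hsm
  let K : SchwartzMap (EuclideanSpace ℝ (Fin 3)) ℂ := 𝓕⁻ φ
  -- The middle sign is reversed because the second factor enters conjugated; 7 is a bound for 2π.
  refine ⟨K, ![fun z => 2 * Real.pi * z 0, fun z => -(2 * Real.pi * z 1),
    fun z => 2 * Real.pi * z 2], K.continuous, ?_, ?_, ?_, ?_⟩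
  · intro j
    fin_cases j <;> simp <;> fun_prop
  · intro j z
    have hz : ∀ i, |z i| ≤ ‖z‖ := fun i => by
      simpa using PiLp.norm_apply_le z i
    have hpi : 2 * Real.pi ≤ 7 := by linarith [Real.pi_lt_d2]
    have hm : ∀ i, |2 * Real.pi * z i| ≤ 7 * ‖z‖ := fun i => by
      rw [abs_mul, abs_of_pos two_pi_pos]
      have := hz i
      gcongr
    fin_cases j
    · exact hm 0
    · change |-(2 * Real.pi * z 1)| ≤ _
      rw [abs_neg]
      exact hm 1
    · exact hm 2
  · intro n
    exact K.integrable_pow_mul volume n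
  · intro ξ₁ ξ₂ ξ₃
    have h1 : φ = 𝓕 K := (FourierTransform.fourier_fourierInv_eq φ).symm
    have h2 : φ !₂[ξ₁, ξ₂, ξ₃] = q ξ₁ ξ₂ ξ₃ := rfl
    rw [← h2, h1, SchwartzMap.fourier_coe, Real.fourier_eq']
    refine integral_congr_ae (Filter.Eventually.of_forall fun z => ?_)
    simp only [smul_eq_mul]
    rw [mul_comm]
    congr 2
    rw [mul_comm]
    congr 2
    simp [PiLp.inner_apply, Fin.sum_univ_three]
    ring

/-- The cubic form, as a superposition of products of translates. -/
noncomputable def cubicSum (k : EuclideanSpace ℝ (Fin 3) → ℂ)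
    (s : Fin 3 → EuclideanSpace ℝ (Fin 3) → ℝ) (U : ℝ → ℂ) (x : ℝ) : ℂ :=
  ∫ z, k z * (U (x - s 0 z) * (starRingEnd ℂ) (U (x - s 1 z)) * U (x - s 2 z))

theorem synth_sub (h : ℝ → ℂ) (x s : ℝ) : synth h (x - s) =
    ((Real.sqrt (2 * Real.pi))⁻¹ : ℝ) * ∫ ξ : ℝ, h ξ *
      Complex.exp (Complex.I * ((x * ξ : ℝ) : ℂ)) *
      Complex.exp (Complex.I * ((-(s * ξ) : ℝ) : ℂ)) := by
  simp only [synth]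
  congr 1
  refine integral_congr_ae (Filter.Eventually.of_forall fun ξ => ?_)
  simp only
  rw [mul_assoc, ← Complex.exp_add]
  congr 2
  push_cast
  ring

theorem cexp_conj (x : ℝ) : (starRingEnd ℂ) (Complex.exp (Complex.I * (x : ℂ))) =
    Complex.exp (Complex.I * ((-x : ℝ) : ℂ)) := by
  rw [← Complex.exp_conj]
  simp

/-- For each character the integrand is a product of functions of the three frequencies, and by
Fubini the integral is a product of three inverse transforms. Multiplying by e^{-isξ} before
synthesis is translation by s. -/
theorem integral_cubic_eq_cubicSum {q : ℝ → ℝ → ℝ → ℂ} {k : EuclideanSpace ℝ (Fin 3) → ℂ}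
    {s : Fin 3 → EuclideanSpace ℝ (Fin 3) → ℝ} (hk : Integrable k) (hs : ∀ j, Continuous (s j))
    (hrep : ∀ ξ₁ ξ₂ ξ₃, q ξ₁ ξ₂ ξ₃ = ∫ z, k z *
      Complex.exp (Complex.I * ((-(s 0 z * ξ₁ - s 1 z * ξ₂ + s 2 z * ξ₃) : ℝ) : ℂ)))
    {h : ℝ → ℂ} (hh : Integrable h) (x : ℝ) :
    (((Real.sqrt (2 * Real.pi))⁻¹ : ℝ) : ℂ) ^ 3 * ∫ p : (ℝ × ℝ) × ℝ,
      q p.1.1 p.1.2 p.2 * (h p.1.1 * (starRingEnd ℂ) (h p.1.2) * h p.2) *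
        Complex.exp (Complex.I * ((x * (p.1.1 - p.1.2 + p.2) : ℝ) : ℂ)) =
      cubicSum k s (synth h) x := by
  have hhc : Integrable (fun ξ => (starRingEnd ℂ) (h ξ)) :=
    Complex.conjLIE.toContinuousLinearEquiv.toContinuousLinearMap.integrable_comp hh
  set e : ℝ → ℂ := fun y => Complex.exp (Complex.I * (y : ℂ)) with he
  have hec : Continuous e := by rw [he]; fun_prop
  have hea : ∀ y y', e (y + y') = e y * e y' := fun y y' => by
    simp only [he]; rw [← Complex.exp_add]; congr 1; push_cast; ring
  have hen : ∀ y, ‖e y‖ = 1 := norm_cexp_I_mul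
  set F : (ℝ × ℝ) × ℝ → EuclideanSpace ℝ (Fin 3) → ℂ := fun p z =>
    k z * ((h p.1.1 * e (x * p.1.1) * e (-(s 0 z * p.1.1))) *
      ((starRingEnd ℂ) (h p.1.2) * e (-(x * p.1.2)) * e (s 1 z * p.1.2)) *
      (h p.2 * e (x * p.2) * e (-(s 2 z * p.2)))) with hF
  have hFi : Integrable (Function.uncurry F)
      ((volume : Measure ((ℝ × ℝ) × ℝ)).prod volume) := by
    have h0 : Integrable (fun P : ((ℝ × ℝ) × ℝ) × EuclideanSpace ℝ (Fin 3) =>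
        (h P.1.1.1 * (starRingEnd ℂ) (h P.1.1.2)) * h P.1.2 * k P.2)
        ((volume : Measure ((ℝ × ℝ) × ℝ)).prod volume) :=
      ((hh.mul_prod hhc).mul_prod hh).mul_prod hk
    have hs0 := hs 0
    have hs1 := hs 1
    have hs2 := hs 2
    have hb := h0.mul_bdd (c := 1) (g := fun P => e (x * P.1.1.1) * e (-(s 0 P.2 * P.1.1.1)) *
      (e (-(x * P.1.1.2)) * e (s 1 P.2 * P.1.1.2)) * (e (x * P.1.2) * e (-(s 2 P.2 * P.1.2))))
      (Continuous.aestronglyMeasurable (by fun_prop))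
      (Filter.Eventually.of_forall fun P => by simp [hen])
    refine hb.congr (Filter.Eventually.of_forall fun P => ?_)
    simp only [hF, Function.uncurry]
    ring
  have h1 : ∀ p : (ℝ × ℝ) × ℝ, q p.1.1 p.1.2 p.2 * (h p.1.1 * (starRingEnd ℂ) (h p.1.2) * h p.2) *
      Complex.exp (Complex.I * ((x * (p.1.1 - p.1.2 + p.2) : ℝ) : ℂ)) = ∫ z, F p z := by
    intro p
    rw [hrep, ← integral_mul_const, ← integral_mul_const]
    refine integral_congr_ae (Filter.Eventually.of_forall fun z => ?_)
    simp only [hF]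
    change k z * e (-(s 0 z * p.1.1 - s 1 z * p.1.2 + s 2 z * p.2)) * _ *
      e (x * (p.1.1 - p.1.2 + p.2)) = _
    rw [show -(s 0 z * p.1.1 - s 1 z * p.1.2 + s 2 z * p.2) =
      -(s 0 z * p.1.1) + (s 1 z * p.1.2 + -(s 2 z * p.2)) by ring,
      show x * (p.1.1 - p.1.2 + p.2) = x * p.1.1 + (-(x * p.1.2) + x * p.2) by ring,
      hea, hea, hea, hea]
    ring
  simp only [h1]
  rw [integral_integral_swap hFi, cubicSum, ← integral_const_mul]
  refine integral_congr_ae (Filter.Eventually.of_forall fun z => ?_)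
  simp only [hF]
  rw [integral_const_mul]
  change _ * (k z * ∫ p : (ℝ × ℝ) × ℝ, _ ∂((volume : Measure (ℝ × ℝ)).prod volume)) = _
  rw [integral_prod_mul (μ := (volume : Measure (ℝ × ℝ))) (ν := (volume : Measure ℝ))
    (fun p : ℝ × ℝ => (h p.1 * e (x * p.1) * e (-(s 0 z * p.1))) *
      ((starRingEnd ℂ) (h p.2) * e (-(x * p.2)) * e (s 1 z * p.2)))
    (fun ξ => h ξ * e (x * ξ) * e (-(s 2 z * ξ)))]
  have h2 : ∫ p : ℝ × ℝ, (h p.1 * e (x * p.1) * e (-(s 0 z * p.1))) *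
      ((starRingEnd ℂ) (h p.2) * e (-(x * p.2)) * e (s 1 z * p.2)) =
      (∫ ξ, h ξ * e (x * ξ) * e (-(s 0 z * ξ))) *
        ∫ ξ, (starRingEnd ℂ) (h ξ) * e (-(x * ξ)) * e (s 1 z * ξ) :=
    integral_prod_mul (μ := (volume : Measure ℝ)) (ν := (volume : Measure ℝ))
      (fun ξ => h ξ * e (x * ξ) * e (-(s 0 z * ξ)))
      (fun ξ => (starRingEnd ℂ) (h ξ) * e (-(x * ξ)) * e (s 1 z * ξ))
  have h3 : (starRingEnd ℂ) (synth h (x - s 1 z)) = ((Real.sqrt (2 * Real.pi))⁻¹ : ℝ) *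
      ∫ ξ, (starRingEnd ℂ) (h ξ) * e (-(x * ξ)) * e (s 1 z * ξ) := by
    rw [synth_sub, map_mul, Complex.conj_ofReal, ← integral_conj]
    congr 1
    refine integral_congr_ae (Filter.Eventually.of_forall fun ξ => ?_)
    simp only [map_mul, cexp_conj, he, neg_neg]
  rw [h2, h3, synth_sub, synth_sub]
  simp only [he]
  ring

/-- The cubic form of a band limited function. -/
theorem coeFn_eq_cubicSum {q : ℝ → ℝ → ℝ → ℂ} {k : EuclideanSpace ℝ (Fin 3) → ℂ}
    {s : Fin 3 → EuclideanSpace ℝ (Fin 3) → ℝ} (hk : Integrable k) (hs : ∀ j, Continuous (s j))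
    (hrep : ∀ ξ₁ ξ₂ ξ₃, q ξ₁ ξ₂ ξ₃ = ∫ z, k z *
      Complex.exp (Complex.I * ((-(s 0 z * ξ₁ - s 1 z * ξ₂ + s 2 z * ξ₃) : ℝ) : ℂ)))
    (hq : IsCubicSymbol q) {u g : L2} {h : ℝ → ℂ} (hu : hat u =ᵐ[volume] h) (hh : Integrable h)
    (hg : IsCubicForm q u g) : g =ᵐ[volume] cubicSum k s (synth h) := by
  have hhc : Integrable (fun ξ => (starRingEnd ℂ) (h ξ)) :=
    Complex.conjLIE.toContinuousLinearEquiv.toContinuousLinearMap.integrable_comp hh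
  obtain ⟨Bq, hBq⟩ := hq.smooth.continuous.bounded_above_of_compact_support hq.compactSupport
  have hqc : Continuous fun p : (ℝ × ℝ) × ℝ => q p.1.1 p.1.2 p.2 :=
    hq.smooth.continuous.comp (by fun_prop : Continuous fun p : (ℝ × ℝ) × ℝ => (p.1.1, p.1.2, p.2))
  set H : (ℝ × ℝ) × ℝ → ℂ := fun p =>
    q p.1.1 p.1.2 p.2 * (h p.1.1 * (starRingEnd ℂ) (h p.1.2) * h p.2) with hH
  have hHi : Integrable H := by
    have h0 : Integrable (fun p : (ℝ × ℝ) × ℝ => (h p.1.1 * (starRingEnd ℂ) (h p.1.2)) * h p.2) :=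
      (hh.mul_prod hhc).mul_prod hh
    exact h0.bdd_mul hqc.aestronglyMeasurable (Filter.Eventually.of_forall fun p => hBq (p.1.1, p.1.2, p.2))
  -- The measure preserving shear that passes from the three input frequencies to two of them and
  -- the output frequency ξ = ξ₁ - ξ₂ + ξ₃.
  let Φ : (ℝ × ℝ) × ℝ → (ℝ × ℝ) × ℝ := fun p => (p.1, p.2 - p.1.1 + p.1.2)
  have hΦ : MeasurePreserving Φ := by
    refine MeasurePreserving.skew_product (f := id) (g := fun (a : ℝ × ℝ) c => c - a.1 + a.2)
      (MeasurePreserving.id _) (by fun_prop) (Filter.Eventually.of_forall fun a => ?_)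
    have h1 : (fun c : ℝ => c - a.1 + a.2) = fun c => c + (-a.1 + a.2) := by ext c; ring
    rw [h1]
    exact map_add_right_eq_self volume _
  have hΦe : MeasurableEmbedding Φ := by
    refine MeasurableEquiv.measurableEmbedding
      (⟨⟨Φ, fun p => (p.1, p.2 + p.1.1 - p.1.2), fun p => ?_, fun p => ?_⟩, ?_, ?_⟩ :
        (ℝ × ℝ) × ℝ ≃ᵐ (ℝ × ℝ) × ℝ)
    · refine Prod.ext rfl ?_
      simp only [Φ]
      ring
    · refine Prod.ext rfl ?_
      simp only [Φ]
      ring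
    · simp only [Φ, Equiv.coe_fn_mk]; fun_prop
    · simp only [Φ, Equiv.coe_fn_symm_mk]; fun_prop
  have hHΦ : Integrable (H ∘ Φ) := hΦ.integrable_comp_of_integrable hHi
  set G : ℝ → ℂ := fun ξ => ((2 * Real.pi)⁻¹ : ℝ) * ∫ p : ℝ × ℝ, H (Φ (p, ξ)) with hG
  have hGi : Integrable G := (hHΦ.integral_prod_right).const_mul _
  have hgG : hat g =ᵐ[volume] G := by
    filter_upwards [hg, hHΦ.prod_left_ae] with ξ h1 h2
    rw [h1, hG]
    simp only
    congr 1
    have h3 : ∫ p : ℝ × ℝ, H (Φ (p, ξ)) = ∫ ξ₁, ∫ ξ₂, H (Φ ((ξ₁, ξ₂), ξ)) := integral_prod _ h2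
    rw [h3]
    have hbad : {ξ | hat u ξ ≠ h ξ} =ᵐ[volume] (∅ : Set ℝ) := by
      rw [ae_eq_empty]; exact hu
    refine integral_congr_ae ?_
    filter_upwards [hu] with ξ₁ h4
    refine integral_congr_ae ?_
    -- For fixed ξ and ξ₁ the third frequency is a translate of ξ₂, so û may be replaced by h there
    -- too.
    have hmp : MeasurePreserving (fun ξ₂ : ℝ => ξ - ξ₁ + ξ₂) volume volume :=
      measurePreserving_add_left volume _
    filter_upwards [hu, hmp.quasiMeasurePreserving.ae_eq_comp hu] with ξ₂ h5 h6
    simp only [Function.comp] at h6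
    simp only [hH, Φ]
    rw [h4, h5, h6]
  refine (coeFn_eq_synth hgG hGi).trans (Filter.Eventually.of_forall fun x => ?_)
  rw [← integral_cubic_eq_cubicSum hk hs hrep hh x]
  set E : (ℝ × ℝ) × ℝ → ℂ := fun p =>
    Complex.exp (Complex.I * ((x * (p.1.1 - p.1.2 + p.2) : ℝ) : ℂ)) with hE
  have hHE : Integrable (fun p => H p * E p) :=
    hHi.mul_bdd (c := 1) (Continuous.aestronglyMeasurable (by rw [hE]; fun_prop))
      (Filter.Eventually.of_forall fun p => (norm_cexp_I_mul _).le)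
  have hHEΦ : Integrable ((fun p => H p * E p) ∘ Φ) := hΦ.integrable_comp_of_integrable hHE
  have e1 : ∫ p, H p * E p = ∫ ξ : ℝ, ∫ p : ℝ × ℝ, H (Φ (p, ξ)) * E (Φ (p, ξ)) := by
    rw [← hΦ.integral_comp hΦe]
    exact integral_prod_symm _ hHEΦ
  rw [e1]
  simp only [synth, hG]
  have e2 : ∀ ξ : ℝ, ∫ p : ℝ × ℝ, H (Φ (p, ξ)) * E (Φ (p, ξ)) =
      (∫ p : ℝ × ℝ, H (Φ (p, ξ))) * Complex.exp (Complex.I * ((x * ξ : ℝ) : ℂ)) := by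
    intro ξ
    rw [← integral_mul_const]
    refine integral_congr_ae (Filter.Eventually.of_forall fun p => ?_)
    simp only [hE, Φ]
    congr 4
    ring
  simp only [e2, mul_assoc]
  rw [integral_const_mul, ← mul_assoc]
  congr 1
  -- The constant (2π)⁻¹ of the cubic form and (2π)^{-1/2} of the synthesis supply the three
  -- normalizing factors of the translates.
  have h6 : ((Real.sqrt (2 * Real.pi))⁻¹ : ℝ) * (Real.sqrt (2 * Real.pi))⁻¹ = (2 * Real.pi)⁻¹ := by
    rw [← mul_inv, Real.mul_self_sqrt two_pi_pos.le]
  rw [← h6]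
  push_cast
  ring

/-! ### Localization of the cubic form at the frequency ξ_{x/t} -/

section

/-- The character `e^{-i s ξ}`. -/
noncomputable def chr (s ξ : ℝ) : ℂ := Complex.exp (Complex.I * ((-(s * ξ) : ℝ) : ℂ))

theorem norm_chr (s ξ : ℝ) : ‖chr s ξ‖ = 1 := norm_cexp_I_mul _

theorem continuous_chr : Continuous fun p : ℝ × ℝ => chr p.1 p.2 := by
  unfold chr; fun_prop

theorem hasDerivAt_chr (s ξ : ℝ) : HasDerivAt (chr s) (-(Complex.I * s) * chr s ξ) ξ := by
  have h1 : HasDerivAt (fun ξ : ℝ => ((-(s * ξ) : ℝ) : ℂ)) ((-s : ℝ) : ℂ) ξ := by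
    have := ((hasDerivAt_id ξ).const_mul s).neg.ofReal_comp
    simpa using this
  refine (h1.const_mul Complex.I).cexp.congr_deriv ?_
  simp only [chr]
  push_cast
  ring

/-- The symbol `(e^{-isξ} - e^{-isξ_y}) / (ξ - ξ_y)`. -/
noncomputable def symChr (a : ℝ → ℝ) (s y ξ : ℝ) : ℂ :=
  segAvg (fun _ => 1) (fun ξ => -(Complex.I * s) * chr s ξ) (freq a y) ξ

variable {a : ℝ → ℝ} {χ : ℝ → ℂ} {ρ M κ₀ κ₁ : ℝ}

/-- The divided difference already costs one factor |s| and each ξ-derivative another, hence at most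
|s|³. -/
theorem IsDispersive.isSymbol_symChr (ha : IsDispersive a) (s : ℝ) :
    IsSymbol ((1 + |s|) ^ 3) (symChr a s) := by
  have hs := abs_nonneg s
  have hc : Continuous (chr s) :=
    continuous_iff_continuousAt.2 fun ξ => (hasDerivAt_chr s ξ).continuousAt
  have hn : ‖-(Complex.I * (s : ℂ))‖ = |s| := by simp
  have hcd : ∀ (c : ℂ) ξ, HasDerivAt (fun ξ => c * chr s ξ) (c * (-(Complex.I * s)) * chr s ξ) ξ :=
    fun c ξ => ((hasDerivAt_chr s ξ).const_mul c).congr_deriv (by ring)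
  refine isSymbol_segAvg continuous_const (fun _ _ => by simp) (hcd _) (hcd _) (by fun_prop)
    (fun ξ => ?_) (fun ξ => ?_) (fun ξ => ?_) ha.continuous_freq
  all_goals
    simp only [norm_mul, norm_chr, hn, mul_one]
    nlinarith [mul_nonneg hs hs, mul_nonneg (mul_nonneg hs hs) hs]

/-- Translation by s is the multiplier e^{-isξ}; subtracting its value at ξ_{x/t} leaves ξ - ξ_{x/t}
times a divided difference, a vanishing symbol. -/
theorem IsDispersive.translation_error_eq (ha : IsDispersive a) {R t : ℝ} {h : ℝ → ℂ}
    (hh : Integrable h) (hs : ∀ ξ, R < |ξ| → h ξ = 0) (s x : ℝ) :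
    synth h (x - s) - chr s (freq a (x / t)) * synth h x = opVan a t h (symChr a s) x := by
  have hc : Continuous (chr s) :=
    continuous_iff_continuousAt.2 fun ξ => (hasDerivAt_chr s ξ).continuousAt
  have h1 : ∀ y ξ, ((ξ - freq a y : ℝ) : ℂ) * symChr a s y ξ = chr s ξ - chr s (freq a y) := by
    intro y ξ
    have := segAvg_deriv_weight (w := fun _ => 1) (w' := fun _ => 0)
      (fun s => hasDerivAt_const s 1) continuous_const (hasDerivAt_chr s) (by fun_prop)
      (freq a y) ξ
    have h0 : segAvg (fun _ => 0) (chr s) (freq a y) ξ = 0 := by simp [segAvg]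
    rw [h0] at this
    simp only [symChr]
    push_cast at this ⊢
    rw [this]
    ring
  obtain ⟨-, -, hcs, -⟩ := ha.isSymbol_symChr s
  have c1 := ha.continuous_opVan_symbol hcs t
  have c2 : Continuous (Function.uncurry fun x _ : ℝ => chr s (freq a (x / t)) * 1) := by
    have := ha.continuous_freq
    have : Continuous fun z : ℝ × ℝ => chr s (freq a (z.1 / t)) * 1 := by fun_prop
    exact this
  have h2 : synth h (x - s) = op h (fun _ ξ => chr s ξ) x := by
    rw [synth_sub]
    simp only [op, synth]
    congr 1
    refine integral_congr_ae (Filter.Eventually.of_forall fun ξ => ?_)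
    simp only [chr]
    ring
  rw [sub_eq_iff_eq_add, opVan, ← op_one (h := h) x,
    ← op_mul_left (fun x => chr s (freq a (x / t))), ← op_add c1 c2 hh hs x, h2]
  refine op_congr fun ξ => ?_
  rw [h1]
  ring

/-- After removal of the carrier, u varies slowly: the derivative of the product has the modulus of
the operator with symbol ξ - ξ_{x/t}. -/
theorem IsDispersive.conj_carrier_mul_sub_le (ha : IsDispersive a) {R t : ℝ} (ht : 0 < t)
    {h : ℝ → ℂ} (hh : Integrable h) (hs : ∀ ξ, R < |ξ| → h ξ = 0) {c d : ℝ} {x y : ℝ}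
    (hx : x ∈ Icc c d) (hy : y ∈ Icc c d) :
    ‖(starRingEnd ℂ) (carrier a t y) * synth h y - (starRingEnd ℂ) (carrier a t x) * synth h x‖ ≤
      ∫ z in Icc c d, ‖opVan a t h (fun _ _ => 1) z‖ := by
  have cD := ha.continuous_opVan_symbol (m := fun _ _ => 1) continuous_const t
  have hD : Continuous (opVan a t h (fun _ _ => 1)) := continuous_op cD hh hs
  wlog hxy : x ≤ y generalizing x y
  · rw [norm_sub_rev]
    exact this hy hx (le_of_not_ge hxy)
  have hder : ∀ x, HasDerivAt (fun x => (starRingEnd ℂ) (carrier a t x) * synth h x)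
      (Complex.I * ((starRingEnd ℂ) (carrier a t x) * opVan a t h (fun _ _ => 1) x)) x := by
    intro x
    refine ((ha.hasDerivAt_conj_carrier ht.ne' x).mul
      (ha.hasDerivAt_synth (t := t) hh hs x)).congr_deriv ?_
    ring
  have hEc : Continuous fun x => (starRingEnd ℂ) (carrier a t x) :=
    continuous_iff_continuousAt.2 fun x => (ha.hasDerivAt_conj_carrier ht.ne' x).continuousAt
  rw [← intervalIntegral.integral_eq_sub_of_hasDerivAt (fun x _ => hder x)
    (Continuous.intervalIntegrable (by fun_prop) _ _)]
  refine (intervalIntegral.norm_integral_le_integral_norm hxy).trans ?_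
  simp only [norm_mul, Complex.norm_I, one_mul, RCLike.norm_conj, norm_carrier]
  rw [intervalIntegral.integral_of_le hxy]
  refine setIntegral_mono_set hD.norm.integrableOn_Icc
    (Filter.Eventually.of_forall fun _ => norm_nonneg _) ?_
  exact (Ioc_subset_Icc_self.trans (Icc_subset_Icc hx.1 hy.2)).eventuallyLE

/-- The dispersive decay of a frequency localized function with finite `X` norm. -/
theorem IsDispersive.exists_sup_bound (ha : IsDispersive a) (hu : IsUniformlyDispersive a)
    {R : ℝ} (hR : 0 ≤ R) :
    ∃ C : ℝ, 0 ≤ C ∧ ∀ (t N : ℝ) (h ℓ : ℝ → ℂ), 0 < t → FreqData R t (deriv a) h ℓ → 0 ≤ N →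
      eLpNorm h 2 volume ≤ ENNReal.ofReal N → eLpNorm ℓ 2 volume ≤ ENNReal.ofReal N →
      ∀ x, ‖synth h x‖ ≤ (Real.sqrt t)⁻¹ * (C * N) := by
  obtain ⟨C, hC, hvan⟩ := ha.exists_vanishing_const hu hR
  refine ⟨1 + C, by positivity, ?_⟩
  intro t N h ℓ ht H hN0 hN hN' x
  have hh := H.integrable
  have hs := H.supp
  have bD : L2Bound (opVan a t h (fun _ _ => 1)) (t⁻¹ * (C * 1 * N)) :=
    hvan t N h ℓ ht H hN0 hN hN' 1 (fun _ _ => 1) isSymbol_one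
  have bU : L2Bound (synth h) N := l2Bound_synth H.memLp hh hN
  have hst := Real.sqrt_pos.2 ht
  -- Length t balances the two contributions: over such an interval the demodulated function
  -- oscillates by at most √t · t⁻¹CN, and the mean of |u| is at most t^{-1/2}N.
  have hxt : x ≤ x + t := by linarith
  have i1 := integral_Icc_norm_le bD (by positivity) hxt
  have i2 := integral_Icc_norm_le bU hN0 hxt
  rw [add_sub_cancel_left] at i1 i2
  set J := ∫ z in Icc x (x + t), ‖opVan a t h (fun _ _ => 1) z‖ with hJ
  have hpt : ∀ y ∈ Icc x (x + t), ‖synth h x‖ - J ≤ ‖synth h y‖ := by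
    intro y hy
    have h1 := ha.conj_carrier_mul_sub_le ht hh hs hy (left_mem_Icc.2 hxt)
    have h2 := (norm_sub_norm_le _ _).trans h1
    simp only [norm_mul, RCLike.norm_conj, norm_carrier, one_mul] at h2
    linarith
  have h3 : (‖synth h x‖ - J) * t ≤ ∫ y in Icc x (x + t), ‖synth h y‖ := by
    have := setIntegral_mono_on (μ := volume) (f := fun _ => ‖synth h x‖ - J)
      (g := fun y => ‖synth h y‖) (s := Icc x (x + t)) (by simp)
      (integrableOn_window bU.memLp _ _).norm measurableSet_Icc hpt
    rw [setIntegral_const, smul_eq_mul, Real.volume_real_Icc_of_le hxt, add_sub_cancel_left] at this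
    linarith
  have h4 : ‖synth h x‖ * t ≤ Real.sqrt t * N + Real.sqrt t * (C * N) := by
    have h5 : J * t ≤ Real.sqrt t * (C * N) := by
      calc J * t ≤ (Real.sqrt t * (t⁻¹ * (C * 1 * N))) * t := by gcongr
        _ = _ := by field_simp
    nlinarith
  have h6 : ‖synth h x‖ = ‖synth h x‖ * t * ((Real.sqrt t)⁻¹ * (Real.sqrt t)⁻¹) := by
    rw [← mul_inv, Real.mul_self_sqrt ht.le, mul_assoc, mul_inv_cancel₀ ht.ne', mul_one]
  rw [h6]
  calc _ ≤ (Real.sqrt t * N + Real.sqrt t * (C * N)) * ((Real.sqrt t)⁻¹ * (Real.sqrt t)⁻¹) := by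
        gcongr
    _ = _ := by field_simp

/-- Telescoping one factor at a time; a and c' enter only through differences and need no bound. -/
theorem norm_cubic_sub_le {a b c a' b' c' : ℂ} {B : ℝ} (ha' : ‖a'‖ ≤ B)
    (hb : ‖b‖ ≤ B) (hb' : ‖b'‖ ≤ B) (hc : ‖c‖ ≤ B) :
    ‖a * (starRingEnd ℂ) b * c - a' * (starRingEnd ℂ) b' * c'‖ ≤
      B ^ 2 * (‖a - a'‖ + ‖b - b'‖ + ‖c - c'‖) := by
  have hB : 0 ≤ B := (norm_nonneg _).trans hb
  have e : a * (starRingEnd ℂ) b * c - a' * (starRingEnd ℂ) b' * c' =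
      (a - a') * (starRingEnd ℂ) b * c + a' * (starRingEnd ℂ) (b - b') * c +
        a' * (starRingEnd ℂ) b' * (c - c') := by
    rw [map_sub]; ring
  rw [e]
  refine norm_add₃_le.trans ?_
  simp only [norm_mul, RCLike.norm_conj]
  have h1 : ‖a - a'‖ * ‖b‖ * ‖c‖ ≤ ‖a - a'‖ * B * B := by gcongr
  have h2 : ‖a'‖ * ‖b - b'‖ * ‖c‖ ≤ B * ‖b - b'‖ * B := by gcongr
  have h3 : ‖a'‖ * ‖b'‖ * ‖c - c'‖ ≤ B * B * ‖c - c'‖ := by gcongr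
  nlinarith

theorem mul_conj_mul_self (z : ℂ) : z * (starRingEnd ℂ) z * z = ((‖z‖ ^ 2 : ℝ) : ℂ) * z := by
  rw [Complex.mul_conj, Complex.normSq_eq_norm_sq]

/-- The symbol bound (1 + |s|)³ is squared by the Cauchy–Schwarz form of Minkowski's inequality, so
six moments of k are used. -/
theorem integrable_norm_mul_one_add_pow {k : EuclideanSpace ℝ (Fin 3) → ℂ} (hkc : Continuous k)
    (hk : ∀ n : ℕ, Integrable fun z => ‖z‖ ^ n * ‖k z‖) :
    Integrable fun z => ‖k z‖ * ((1 + 7 * ‖z‖) ^ 3) ^ 2 := by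
  have hk0 : Integrable fun z => ‖k z‖ := by simpa using hk 0
  refine (((hk0.add (hk 6)).const_mul (8 ^ 6))).mono'
    (Continuous.aestronglyMeasurable (by fun_prop)) (Filter.Eventually.of_forall fun z => ?_)
  rw [Real.norm_of_nonneg (by positivity), ← pow_mul]
  have h1 : (1 + 7 * ‖z‖) ^ 6 ≤ 8 ^ 6 * (1 + ‖z‖ ^ 6) := by
    rcases le_total ‖z‖ 1 with hz | hz
    · calc (1 + 7 * ‖z‖) ^ 6 ≤ 8 ^ 6 := by gcongr; linarith
        _ ≤ _ := by
          have : 0 ≤ ‖z‖ ^ 6 := by positivity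
          linarith
    · calc (1 + 7 * ‖z‖) ^ 6 ≤ (8 * ‖z‖) ^ 6 := by gcongr; linarith
        _ ≤ _ := by rw [mul_pow]; linarith
  calc _ ≤ ‖k z‖ * (8 ^ 6 * (1 + ‖z‖ ^ 6)) := by gcongr
    _ = _ := by simp only [Pi.add_apply]; ring

theorem l2Bound_integral_norm_mul {k : EuclideanSpace ℝ (Fin 3) → ℂ}
    (hkc : Continuous k) (hk0 : Integrable fun z => ‖k z‖) {b : EuclideanSpace ℝ (Fin 3) → ℝ}
    (hb : ∀ z, 0 ≤ b z) (hkb : Integrable fun z => ‖k z‖ * b z ^ 2)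
    {W : EuclideanSpace ℝ (Fin 3) → ℝ → ℂ} (hW : Continuous (Function.uncurry W))
    {N : ℝ} (hN : 0 ≤ N) (hWb : ∀ z, eLpNorm (W z) 2 volume ≤ ENNReal.ofReal (N * b z)) :
    L2Bound (fun x => ((∫ z, ‖k z‖ * ‖W z x‖ : ℝ) : ℂ))
      (N * Real.sqrt ((∫ z, ‖k z‖) * ∫ z, ‖k z‖ * b z ^ 2)) := by
  have hA : ∫⁻ z, ‖‖k z‖‖ₑ ≤ ENNReal.ofReal (∫ z, ‖k z‖) := by
    simp only [enorm_norm]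
    rw [ofReal_integral_norm_eq_lintegral_enorm
      ((integrable_norm_iff hkc.aestronglyMeasurable).1 hk0)]
  have hB : ∫⁻ z, ‖‖k z‖‖ₑ * ENNReal.ofReal (N * b z) ^ 2 ≤
      ENNReal.ofReal (N ^ 2 * ∫ z, ‖k z‖ * b z ^ 2) := by
    rw [← integral_const_mul, ofReal_integral_eq_lintegral_ofReal
      (hkb.const_mul _) (Filter.Eventually.of_forall fun z => by positivity)]
    refine lintegral_mono fun z => le_of_eq ?_
    rw [Real.enorm_of_nonneg (norm_nonneg _),
      ← ENNReal.ofReal_pow (mul_nonneg hN (hb z)), ← ENNReal.ofReal_mul (norm_nonneg _)]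
    congr 1
    ring
  have hA0 : 0 ≤ ∫ z, ‖k z‖ := integral_nonneg fun _ => norm_nonneg _
  have h1 := eLpNorm_integral_mul_le hk0.1 hW.aestronglyMeasurable hA0 hWb hA hB
  have h2 : Real.sqrt ((∫ z, ‖k z‖) * (N ^ 2 * ∫ z, ‖k z‖ * b z ^ 2)) =
      N * Real.sqrt ((∫ z, ‖k z‖) * ∫ z, ‖k z‖ * b z ^ 2) := by
    rw [mul_left_comm, Real.sqrt_mul (by positivity), Real.sqrt_sq hN]
  rw [h2] at h1
  constructor
  · refine Complex.continuous_ofReal.comp_aestronglyMeasurable ?_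
    have h1 : AEStronglyMeasurable (fun p : ℝ × EuclideanSpace ℝ (Fin 3) =>
        ‖k p.2‖ * ‖W p.2 p.1‖) (volume.prod volume) := by
      have h2 : Continuous fun p : EuclideanSpace ℝ (Fin 3) × ℝ => W p.1 p.2 := hW
      have h3 : Continuous fun p : ℝ × EuclideanSpace ℝ (Fin 3) => W p.2 p.1 :=
        h2.comp continuous_swap
      exact Continuous.aestronglyMeasurable (by fun_prop)
    exact h1.integral_prod_right'
  · refine (le_of_eq ?_).trans h1
    exact eLpNorm_congr_norm_ae (Filter.Eventually.of_forall fun x => by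
      rw [Complex.norm_real])

/-- At a single frequency θ the value q(θ,θ,θ) is the same superposition with each translate of U
replaced by the modulation e^{-isθ}U. The two superpositions are compared factor by factor, with two
factors estimated by the supremum m. -/
theorem norm_cubicSum_sub_le {q : ℝ → ℝ → ℝ → ℂ} {k : EuclideanSpace ℝ (Fin 3) → ℂ}
    {s : Fin 3 → EuclideanSpace ℝ (Fin 3) → ℝ} (hs : ∀ j, Continuous (s j))
    (hki : Integrable k)
    (hrep : ∀ ξ₁ ξ₂ ξ₃, q ξ₁ ξ₂ ξ₃ = ∫ z, k z *
      Complex.exp (Complex.I * ((-(s 0 z * ξ₁ - s 1 z * ξ₂ + s 2 z * ξ₃) : ℝ) : ℂ)))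
    {U : ℝ → ℂ} (hUc : Continuous U) {m : ℝ} (hUb : ∀ x, ‖U x‖ ≤ m) (θ x : ℝ) :
    ‖cubicSum k s U x - q θ θ θ * (((‖U x‖ ^ 2 : ℝ) : ℂ) * U x)‖ ≤
      m ^ 2 * ((∫ z, ‖k z‖ * ‖U (x - s 0 z) - chr (s 0 z) θ * U x‖) +
        (∫ z, ‖k z‖ * ‖U (x - s 1 z) - chr (s 1 z) θ * U x‖) +
        ∫ z, ‖k z‖ * ‖U (x - s 2 z) - chr (s 2 z) θ * U x‖) := by
  have hm0 : 0 ≤ m := (norm_nonneg _).trans (hUb x)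
  have cchr : ∀ j, Continuous fun z => chr (s j z) θ := fun j =>
    continuous_chr.comp (by have := hs j; fun_prop :
      Continuous fun z : EuclideanSpace ℝ (Fin 3) => (s j z, θ))
  have hs0 := hs 0
  have hs1 := hs 1
  have hs2 := hs 2
  have hWi : ∀ j, Integrable fun z => ‖k z‖ * ‖U (x - s j z) - chr (s j z) θ * U x‖ := by
    intro j
    have := cchr j
    have := hs j
    refine hki.norm.mul_bdd (c := m + m) (Continuous.aestronglyMeasurable (by fun_prop))
      (Filter.Eventually.of_forall fun z => ?_)
    rw [norm_norm]
    refine (norm_sub_le _ _).trans ?_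
    rw [norm_mul, norm_chr, one_mul]
    exact add_le_add (hUb _) (hUb _)
  have hqe : q θ θ θ * (((‖U x‖ ^ 2 : ℝ) : ℂ) * U x) = ∫ z, k z *
      ((chr (s 0 z) θ * U x) * (starRingEnd ℂ) (chr (s 1 z) θ * U x) * (chr (s 2 z) θ * U x)) := by
    rw [hrep, ← integral_mul_const]
    refine integral_congr_ae (Filter.Eventually.of_forall fun z => ?_)
    simp only
    rw [← mul_conj_mul_self, map_mul]
    have h1 : Complex.exp (Complex.I * ((-(s 0 z * θ - s 1 z * θ + s 2 z * θ) : ℝ) : ℂ)) =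
        chr (s 0 z) θ * (starRingEnd ℂ) (chr (s 1 z) θ) * chr (s 2 z) θ := by
      simp only [chr, cexp_conj, ← Complex.exp_add]
      congr 1
      push_cast
      ring
    rw [h1]
    ring
  have hcub : ∀ {b₁ b₂ b₃ : EuclideanSpace ℝ (Fin 3) → ℂ}, Continuous b₁ → Continuous b₂ →
      Continuous b₃ → (∀ z, ‖b₁ z‖ ≤ m) → (∀ z, ‖b₂ z‖ ≤ m) → (∀ z, ‖b₃ z‖ ≤ m) →
      Integrable fun z => k z * (b₁ z * (starRingEnd ℂ) (b₂ z) * b₃ z) := by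
    intro b₁ b₂ b₃ c₁ c₂ c₃ h₁ h₂ h₃
    have := Complex.continuous_conj
    refine hki.mul_bdd (c := m * m * m) (Continuous.aestronglyMeasurable (by fun_prop))
      (Filter.Eventually.of_forall fun z => ?_)
    simp only [norm_mul, RCLike.norm_conj]
    have := h₁ z
    have := h₂ z
    have := h₃ z
    gcongr
  have hchm : ∀ j z, ‖chr (s j z) θ * U x‖ ≤ m := fun j z => by
    rw [norm_mul, norm_chr, one_mul]; exact hUb x
  have i1 : Integrable fun z => k z * (U (x - s 0 z) *
      (starRingEnd ℂ) (U (x - s 1 z)) * U (x - s 2 z)) :=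
    hcub (by fun_prop) (by fun_prop) (by fun_prop) (fun z => hUb _) (fun z => hUb _)
      (fun z => hUb _)
  have i2 : Integrable fun z => k z * ((chr (s 0 z) θ * U x) *
      (starRingEnd ℂ) (chr (s 1 z) θ * U x) * (chr (s 2 z) θ * U x)) :=
    hcub ((cchr 0).mul continuous_const) ((cchr 1).mul continuous_const)
      ((cchr 2).mul continuous_const) (hchm 0) (hchm 1) (hchm 2)
  have h01 : Integrable fun z => ‖k z‖ * ‖U (x - s 0 z) - chr (s 0 z) θ * U x‖ +
      ‖k z‖ * ‖U (x - s 1 z) - chr (s 1 z) θ * U x‖ := (hWi 0).add (hWi 1)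
  rw [hqe, cubicSum, ← integral_sub i1 i2, ← integral_add (hWi 0) (hWi 1),
    ← integral_add h01 (hWi 2), ← integral_const_mul]
  refine norm_integral_le_of_norm_le ((h01.add (hWi 2)).const_mul (m ^ 2))
    (Filter.Eventually.of_forall fun z => ?_)
  rw [← mul_sub, norm_mul]
  have := norm_cubic_sub_le (a := U (x - s 0 z)) (b := U (x - s 1 z))
    (c := U (x - s 2 z)) (c' := chr (s 2 z) θ * U x) (hchm 0 z) (hUb (x - s 1 z)) (hchm 1 z)
    (hUb (x - s 2 z))
  refine (mul_le_mul_of_nonneg_left this (norm_nonneg (k z))).trans (le_of_eq ?_)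
  ring

theorem aestronglyMeasurable_cubicSum {k : EuclideanSpace ℝ (Fin 3) → ℂ}
    {s : Fin 3 → EuclideanSpace ℝ (Fin 3) → ℝ} (hkc : Continuous k) (hs : ∀ j, Continuous (s j))
    {U : ℝ → ℂ} (hUc : Continuous U) : AEStronglyMeasurable (cubicSum k s U) volume := by
  have hs0 := hs 0
  have hs1 := hs 1
  have hs2 := hs 2
  have h1 : AEStronglyMeasurable (fun p : ℝ × EuclideanSpace ℝ (Fin 3) => k p.2 *
      (U (p.1 - s 0 p.2) * (starRingEnd ℂ) (U (p.1 - s 1 p.2)) * U (p.1 - s 2 p.2)))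
      (volume.prod volume) := by
    have := Complex.continuous_conj
    exact Continuous.aestronglyMeasurable (by fun_prop)
  exact h1.integral_prod_right'

/-- Localization of the cubic form: `Q(u, ū, u)` is close to `q(ξ, ξ, ξ) |u|² u` with
`ξ = ξ_{x/t}`. -/
theorem IsDispersive.exists_cubic_error (ha : IsDispersive a) (hu : IsUniformlyDispersive a)
    {q : ℝ → ℝ → ℝ → ℂ} (hq : IsCubicSymbol q) {k : EuclideanSpace ℝ (Fin 3) → ℂ}
    {s : Fin 3 → EuclideanSpace ℝ (Fin 3) → ℝ} (hkc : Continuous k) (hs : ∀ j, Continuous (s j))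
    (hs7 : ∀ j z, |s j z| ≤ 7 * ‖z‖) (hk : ∀ n : ℕ, Integrable fun z => ‖z‖ ^ n * ‖k z‖)
    (hrep : ∀ ξ₁ ξ₂ ξ₃, q ξ₁ ξ₂ ξ₃ = ∫ z, k z *
      Complex.exp (Complex.I * ((-(s 0 z * ξ₁ - s 1 z * ξ₂ + s 2 z * ξ₃) : ℝ) : ℂ)))
    {R : ℝ} (hR : 0 ≤ R) :
    ∃ C : ℝ, 0 ≤ C ∧ ∀ (t N : ℝ) (h ℓ : ℝ → ℂ), 0 < t → FreqData R t (deriv a) h ℓ → 0 ≤ N →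
      eLpNorm h 2 volume ≤ ENNReal.ofReal N → eLpNorm ℓ 2 volume ≤ ENNReal.ofReal N →
      L2Bound (fun x => cubicSum k s (synth h) x - q (freq a (x / t)) (freq a (x / t))
        (freq a (x / t)) * (((‖synth h x‖ ^ 2 : ℝ) : ℂ) * synth h x))
        (t⁻¹ * t⁻¹ * (C * N ^ 3)) := by
  obtain ⟨C, hC, hvan⟩ := ha.exists_vanishing_const hu hR
  obtain ⟨C', hC', hsup⟩ := ha.exists_sup_bound hu hR
  have hk0 : Integrable fun z => ‖k z‖ := by simpa using hk 0
  have hki : Integrable k := (integrable_norm_iff hkc.aestronglyMeasurable).1 hk0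
  have hk6 := integrable_norm_mul_one_add_pow hkc hk
  set S := Real.sqrt ((∫ z, ‖k z‖) * ∫ z, ‖k z‖ * ((1 + 7 * ‖z‖) ^ 3) ^ 2) with hS
  have hS0 : 0 ≤ S := Real.sqrt_nonneg _
  refine ⟨C' ^ 2 * (3 * (C * S)), by positivity, ?_⟩
  intro t N h ℓ ht H hN0 hN hN'
  have hh := H.integrable
  have hsp := H.supp
  have hfc := ha.continuous_freq
  have hUc : Continuous (synth h) :=
    continuous_iff_continuousAt.2 fun x => (ha.hasDerivAt_synth (t := t) hh hsp x).continuousAt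
  have hUb := hsup t N h ℓ ht H hN0 hN hN'
  have hI : ∀ j, L2Bound (fun x => ((∫ z, ‖k z‖ *
      ‖synth h (x - s j z) - chr (s j z) (freq a (x / t)) * synth h x‖ : ℝ) : ℂ))
      (t⁻¹ * (C * N) * S) := by
    intro j
    have hWc : Continuous fun p : EuclideanSpace ℝ (Fin 3) × ℝ =>
        synth h (p.2 - s j p.1) - chr (s j p.1) (freq a (p.2 / t)) * synth h p.2 := by
      have h1 := hs j
      have h2 : Continuous fun p : EuclideanSpace ℝ (Fin 3) × ℝ =>
          chr (s j p.1) (freq a (p.2 / t)) := continuous_chr.comp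
        (by fun_prop : Continuous fun p : EuclideanSpace ℝ (Fin 3) × ℝ =>
          (s j p.1, freq a (p.2 / t)))
      fun_prop
    refine l2Bound_integral_norm_mul hkc hk0 (fun z => by positivity) hk6
      (W := fun z x => synth h (x - s j z) - chr (s j z) (freq a (x / t)) * synth h x) hWc
      (by positivity) fun z => ?_
    have h1 : (fun x => synth h (x - s j z) - chr (s j z) (freq a (x / t)) * synth h x) =
        opVan a t h (symChr a (s j z)) :=
      funext fun x => ha.translation_error_eq hh hsp (s j z) x
    rw [h1]
    refine (hvan t N h ℓ ht H hN0 hN hN' _ (symChr a (s j z)) (ha.isSymbol_symChr _)).2.trans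
      (ENNReal.ofReal_le_ofReal ?_)
    have := hs7 j z
    calc _ ≤ t⁻¹ * (C * (1 + 7 * ‖z‖) ^ 3 * N) := by gcongr
      _ = _ := by ring
  have hc0 : 0 ≤ t⁻¹ * (C * N) * S := by positivity
  have hsum := ((hI 0).add (hI 1) hc0 hc0).add (hI 2) (by positivity) hc0
  have hmeas : AEStronglyMeasurable (fun x => cubicSum k s (synth h) x - q (freq a (x / t))
      (freq a (x / t)) (freq a (x / t)) * (((‖synth h x‖ ^ 2 : ℝ) : ℂ) * synth h x)) volume := by
    have hqc : Continuous fun x => q (freq a (x / t)) (freq a (x / t)) (freq a (x / t)) :=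
      hq.smooth.continuous.comp (by fun_prop : Continuous fun x : ℝ =>
        (freq a (x / t), freq a (x / t), freq a (x / t)))
    exact (aestronglyMeasurable_cubicSum hkc hs hUc).sub
      (hqc.mul (by fun_prop)).aestronglyMeasurable
  -- Two factors are bounded pointwise and give t⁻¹; the translation error in the remaining one
  -- gives t⁻¹ in L².
  have hfin := hsum.of_le (b := ((Real.sqrt t)⁻¹ * (C' * N)) ^ 2) hmeas (by positivity)
    (fun x => ?_)
  · refine hfin.mono (le_of_eq ?_)
    have : (Real.sqrt t)⁻¹ ^ 2 = t⁻¹ := by rw [inv_pow, Real.sq_sqrt ht.le]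
    rw [mul_pow, this]
    ring
  · refine (norm_cubicSum_sub_le hs hki hrep hUc hUb (freq a (x / t)) x).trans (le_of_eq ?_)
    rw [← Complex.ofReal_add, ← Complex.ofReal_add, Complex.norm_real, Real.norm_of_nonneg]
    exact add_nonneg (add_nonneg (integral_nonneg fun z => by positivity)
      (integral_nonneg fun z => by positivity)) (integral_nonneg fun z => by positivity)

end

/-! ### Estimate of the cubic part -/

section

theorem IsCubicSymbol.exists_diag_bounds {q : ℝ → ℝ → ℝ → ℂ} (hq : IsCubicSymbol q) :
    ∃ B Λ : ℝ, 0 ≤ B ∧ 0 ≤ Λ ∧ (∀ ξ, ‖q ξ ξ ξ‖ ≤ B) ∧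
      ∀ ξ η, ‖q ξ ξ ξ - q η η η‖ ≤ Λ * |ξ - η| := by
  obtain ⟨B, hB⟩ := hq.smooth.continuous.bounded_above_of_compact_support hq.compactSupport
  obtain ⟨Λ, hΛ⟩ := hq.smooth.lipschitzWith_of_hasCompactSupport hq.compactSupport (by simp)
  refine ⟨B, Λ, (norm_nonneg _).trans (hB (0, 0, 0)), Λ.2, fun ξ => hB (ξ, ξ, ξ), fun ξ η => ?_⟩
  have := hΛ.dist_le_mul (ξ, ξ, ξ) (η, η, η)
  rw [dist_eq_norm] at this
  refine this.trans (le_of_eq ?_)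
  simp [Prod.dist_eq, Real.dist_eq]

theorem IsDispersive.exists_freq_lipschitz {a : ℝ → ℝ} (ha : IsDispersive a)
    (hu : IsUniformlyDispersive a) :
    ∃ Λ : ℝ, 0 ≤ Λ ∧ ∀ v w, |freq a v - freq a w| ≤ Λ * |v - w| := by
  obtain ⟨c, hc0, hc⟩ := hu.lower
  refine ⟨c⁻¹, by positivity, fun v w => ?_⟩
  have := convex_univ.norm_image_sub_le_of_norm_hasDerivWithin_le (C := c⁻¹)
    (fun x _ => (ha.hasDerivAt_freq x).hasDerivWithinAt)
    (fun x _ => by rw [norm_inv]; exact inv_anti₀ hc0 (hc _)) (mem_univ w) (mem_univ v)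
  simpa using this

/-- The rescaled cutoff in the wave packet, without the oscillating factor, conjugated. -/
noncomputable def cutoff (a : ℝ → ℝ) (χ : ℝ → ℂ) (v t x : ℝ) : ℂ :=
  ((width a v)⁻¹ : ℝ) * (starRingEnd ℂ) (χ (scaled a v t x))

variable {a : ℝ → ℝ} {χ : ℝ → ℂ} {ρ M κ₀ κ₁ : ℝ}

theorem conj_packet (a : ℝ → ℝ) (χ : ℝ → ℂ) (v t x : ℝ) : (starRingEnd ℂ) (packet a χ v t x) =
    cutoff a χ v t x * (starRingEnd ℂ) (carrier a t x) := by
  rw [packet_eq, cutoff, map_mul, map_mul, Complex.conj_ofReal]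

theorem continuous_cutoff (a : ℝ → ℝ) (hχ : Continuous χ) (v t : ℝ) :
    Continuous (cutoff a χ v t) := by
  have := Complex.continuous_conj
  unfold cutoff scaled
  fun_prop

/-- The change of variables contributes √t times the width and the amplitude divides by the width.
Mass √t is what produces the factor t⁻¹ in front of the cubic term of the limiting equation. -/
theorem IsDispersive.integral_cutoff (ha : IsDispersive a) (hχ1 : ∫ y : ℝ, χ y = 1) {t : ℝ}
    (ht : 0 < t) (v : ℝ) : ∫ x, cutoff a χ v t x = Real.sqrt t := by
  have hw := ha.width_pos v
  have hst := Real.sqrt_pos.2 ht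
  simp only [cutoff, scaled]
  rw [integral_const_mul,
    integral_sub_right_eq_self (fun x => (starRingEnd ℂ) (χ (x / (Real.sqrt t * width a v)))),
    Measure.integral_comp_div (fun x => (starRingEnd ℂ) (χ x)), integral_conj, hχ1,
    abs_of_pos (by positivity), map_one, Complex.real_smul, mul_one, ← Complex.ofReal_mul]
  congr 1
  field_simp

theorem PacketBounds.norm_cutoff_le (hb : PacketBounds a χ ρ M κ₀ κ₁) (v t x : ℝ) :
    ‖cutoff a χ v t x‖ ≤ κ₀⁻¹ * M := by
  have hκ0 := hb.κ₀_pos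
  have hw0 : 0 < width a v := hκ0.trans_le (hb.width_ge v)
  have hwi : (width a v)⁻¹ ≤ κ₀⁻¹ := inv_anti₀ hκ0 (hb.width_ge v)
  rw [cutoff, norm_mul, Complex.norm_real, Real.norm_of_nonneg (by positivity), RCLike.norm_conj]
  gcongr
  exact hb.le _

theorem norm_integral_le_of_Icc {G : ℝ → ℂ} {c δ B : ℝ} (hδ : 0 ≤ δ)
    (h : ∀ x ∈ Icc (c - δ) (c + δ), ‖G x‖ ≤ B) (h0 : ∀ x, x ∉ Icc (c - δ) (c + δ) → G x = 0) :
    ‖∫ x, G x‖ ≤ B * (2 * δ) := by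
  rw [← setIntegral_eq_integral_of_forall_compl_eq_zero h0]
  refine (norm_setIntegral_le_of_norm_le_const (by simp) h).trans (le_of_eq ?_)
  rw [Real.volume_real_Icc_of_le (by linarith)]
  ring

theorem norm_sq_mul_sub_le {z w : ℂ} {B : ℝ} (hz : ‖z‖ ≤ B) (hw : ‖w‖ ≤ B) :
    ‖((‖z‖ ^ 2 : ℝ) : ℂ) * z - ((‖w‖ ^ 2 : ℝ) : ℂ) * w‖ ≤ 3 * B ^ 2 * ‖z - w‖ := by
  rw [← mul_conj_mul_self, ← mul_conj_mul_self]
  refine (norm_cubic_sub_le hw hz hw hz).trans (le_of_eq ?_)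
  ring

/-- Replacing the cubic average of `w` against the cutoff by the cube of the average. -/
theorem IsDispersive.norm_integral_cube_sub_le (ha : IsDispersive a)
    (hb : PacketBounds a χ ρ M κ₀ κ₁) (hχ : Continuous χ) (hχ1 : ∫ y : ℝ, χ y = 1) {t : ℝ}
    (ht : 0 < t) (v : ℝ) {w : ℝ → ℂ} (hw : Continuous w) {m J L : ℝ} (hm : ∀ x, ‖w x‖ ≤ m)
    (hJ : ∀ x ∈ Icc (v * t - ρ * κ₁ * Real.sqrt t) (v * t + ρ * κ₁ * Real.sqrt t),
      ‖w x - w (v * t)‖ ≤ J) (hL : L = κ₀⁻¹ * M * (2 * (ρ * κ₁))) :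
    ‖(∫ x, ((‖w x‖ ^ 2 : ℝ) : ℂ) * w x * cutoff a χ v t x) -
      (t : ℂ)⁻¹ * (((‖∫ x, w x * cutoff a χ v t x‖ ^ 2 : ℝ) : ℂ) * ∫ x, w x * cutoff a χ v t x)‖ ≤
      3 * L * (1 + L ^ 2) * (m ^ 2 * Real.sqrt t * J) := by
  have hst := Real.sqrt_pos.2 ht
  have hκ1 := hb.κ₁_pos
  have hρ := hb.ρ_pos
  have hM := hb.M_pos
  have hκ0 := hb.κ₀_pos
  have hL0 : 0 ≤ L := by rw [hL]; positivity
  have hm0 : 0 ≤ m := (norm_nonneg _).trans (hm 0)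
  set c := cutoff a χ v t with hc
  set δ := ρ * κ₁ * Real.sqrt t with hδ
  have hδ0 : 0 ≤ δ := by positivity
  have hmem : v * t ∈ Icc (v * t - δ) (v * t + δ) := ⟨by linarith, by linarith⟩
  have hJ0 : 0 ≤ J := (norm_nonneg _).trans (hJ _ hmem)
  have cc : Continuous c := continuous_cutoff a hχ v t
  have c0 : ∀ x, x ∉ Icc (v * t - δ) (v * t + δ) → c x = 0 := fun x hx => by
    rw [hc, cutoff, (hb.vanish ha ht hx).1, map_zero, mul_zero]
  have hint : ∀ {g : ℝ → ℂ}, Continuous g → Integrable fun x => g x * c x := fun hg =>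
    integrable_of_continuous_of_support (hg.mul cc) fun x hx => by rw [c0 x hx, mul_zero]
  have hbd : ∀ {g : ℝ → ℂ} {B : ℝ}, 0 ≤ B →
      (∀ x ∈ Icc (v * t - δ) (v * t + δ), ‖g x‖ ≤ B) → ‖∫ x, g x * c x‖ ≤ Real.sqrt t * L * B := by
    intro g B hB hg
    have := norm_integral_le_of_Icc (G := fun x => g x * c x) (B := B * (κ₀⁻¹ * M)) hδ0
      (fun x hx => by
        rw [norm_mul]
        have := hb.norm_cutoff_le v t x
        have := hg x hx
        gcongr)
      fun x hx => by rw [c0 x hx, mul_zero]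
    refine this.trans (le_of_eq ?_)
    rw [hL, hδ]
    ring
  set w₀ := w (v * t) with hw₀
  have hI : ∫ x, c x = Real.sqrt t := ha.integral_cutoff hχ1 ht v
  set γ := ∫ x, w x * c x with hγ
  -- Both quantities are compared with what they would be for the constant value of w at the centre
  -- of the window. Because the cutoff has mass √t, the two then agree exactly.
  set γ₀ := w₀ * (Real.sqrt t : ℂ) with hγ₀
  have hw₀' : ‖w₀‖ ≤ m := hm _
  have hγb : ‖γ‖ ≤ Real.sqrt t * L * m := hbd hm0 fun x _ => hm x
  have hγ₀e : γ₀ = ∫ x, w₀ * c x := by rw [integral_const_mul, hI]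
  have hγ₀b : ‖γ₀‖ ≤ Real.sqrt t * L * m := by
    rw [hγ₀e]; exact hbd (g := fun _ => w₀) hm0 fun x _ => hw₀'
  have hγd : ‖γ₀ - γ‖ ≤ Real.sqrt t * L * J := by
    rw [norm_sub_rev, hγ₀e, hγ, ← integral_sub (hint hw) (hint continuous_const)]
    simp only [← sub_mul]
    exact hbd hJ0 hJ
  have e1 : ∫ x, ((‖w₀‖ ^ 2 : ℝ) : ℂ) * w₀ * c x =
      (t : ℂ)⁻¹ * (((‖γ₀‖ ^ 2 : ℝ) : ℂ) * γ₀) := by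
    rw [integral_const_mul, hI, hγ₀, norm_mul, Complex.norm_real, Real.norm_of_nonneg hst.le,
      mul_pow, Real.sq_sqrt ht.le]
    have : (t : ℂ) ≠ 0 := by exact_mod_cast ht.ne'
    push_cast
    field_simp
  have e2 : (∫ x, ((‖w x‖ ^ 2 : ℝ) : ℂ) * w x * c x) -
      (t : ℂ)⁻¹ * (((‖γ‖ ^ 2 : ℝ) : ℂ) * γ) =
      (∫ x, (((‖w x‖ ^ 2 : ℝ) : ℂ) * w x - ((‖w₀‖ ^ 2 : ℝ) : ℂ) * w₀) * c x) +
        (t : ℂ)⁻¹ * (((‖γ₀‖ ^ 2 : ℝ) : ℂ) * γ₀ - ((‖γ‖ ^ 2 : ℝ) : ℂ) * γ) := by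
    simp only [sub_mul]
    rw [integral_sub (hint (g := fun x => ((‖w x‖ ^ 2 : ℝ) : ℂ) * w x) (by fun_prop))
      (hint (g := fun _ => ((‖w₀‖ ^ 2 : ℝ) : ℂ) * w₀) continuous_const), e1]
    ring
  rw [e2]
  refine (norm_add_le _ _).trans ?_
  have b1 := hbd (g := fun x => ((‖w x‖ ^ 2 : ℝ) : ℂ) * w x - ((‖w₀‖ ^ 2 : ℝ) : ℂ) * w₀)
    (B := 3 * m ^ 2 * J) (by positivity) fun x hx =>
      (norm_sq_mul_sub_le (hm x) hw₀').trans (by gcongr; exact hJ x hx)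
  have b2 : ‖(t : ℂ)⁻¹ * (((‖γ₀‖ ^ 2 : ℝ) : ℂ) * γ₀ - ((‖γ‖ ^ 2 : ℝ) : ℂ) * γ)‖ ≤
      t⁻¹ * (3 * (Real.sqrt t * L * m) ^ 2 * (Real.sqrt t * L * J)) := by
    rw [norm_mul, norm_inv, Complex.norm_real, Real.norm_of_nonneg ht.le]
    gcongr
    exact (norm_sq_mul_sub_le hγ₀b hγb).trans (by gcongr)
  have e3 : t⁻¹ * (3 * (Real.sqrt t * L * m) ^ 2 * (Real.sqrt t * L * J)) =
      3 * L * L ^ 2 * (m ^ 2 * Real.sqrt t * J) := by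
    rw [mul_pow, mul_pow, Real.sq_sqrt ht.le]
    field_simp
  rw [e3] at b2
  calc _ ≤ _ := add_le_add b1 b2
    _ = _ := by ring

theorem window_norm_add {F G : ℝ → ℂ} (hF : MemLp F 2 volume) (hG : MemLp G 2 volume)
    (t δ v : ℝ) :
    window (fun x => ((‖F x‖ + ‖G x‖ : ℝ) : ℂ)) t δ v = window F t δ v + window G t δ v := by
  simp only [window, norm_norm_add]
  exact integral_add (integrableOn_window hF _ _).norm (integrableOn_window hG _ _).norm

theorem window_const_mul (F : ℝ → ℂ) {c : ℝ} (hc : 0 ≤ c) (t δ v : ℝ) :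
    window (fun x => (c : ℂ) * F x) t δ v = c * window F t δ v := by
  simp only [window, norm_mul, Complex.norm_real, Real.norm_of_nonneg hc]
  exact integral_const_mul _ _

/-- The nonlinear part of the equation for the profile `γ`. -/
theorem IsDispersive.exists_cubic_bound (ha : IsDispersive a) (hu : IsUniformlyDispersive a)
    (hχ : ContDiff ℝ ∞ χ) (hχ1 : ∫ y : ℝ, χ y = 1) (hb : PacketBounds a χ ρ M κ₀ κ₁)
    {q : ℝ → ℝ → ℝ → ℂ} (hq : IsCubicSymbol q) {k : EuclideanSpace ℝ (Fin 3) → ℂ}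
    {s : Fin 3 → EuclideanSpace ℝ (Fin 3) → ℝ} (hkc : Continuous k) (hs : ∀ j, Continuous (s j))
    (hs7 : ∀ j z, |s j z| ≤ 7 * ‖z‖) (hk : ∀ n : ℕ, Integrable fun z => ‖z‖ ^ n * ‖k z‖)
    (hrep : ∀ ξ₁ ξ₂ ξ₃, q ξ₁ ξ₂ ξ₃ = ∫ z, k z *
      Complex.exp (Complex.I * ((-(s 0 z * ξ₁ - s 1 z * ξ₂ + s 2 z * ξ₃) : ℝ) : ℂ)))
    {R : ℝ} (hR : 0 ≤ R) :
    ∃ C : ℝ, 0 ≤ C ∧ ∀ (t N : ℝ) (h ℓ : ℝ → ℂ), 1 ≤ t → FreqData R t (deriv a) h ℓ → 0 ≤ N →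
      eLpNorm h 2 volume ≤ ENNReal.ofReal N → eLpNorm ℓ 2 volume ≤ ENNReal.ofReal N →
      ∃ F : ℝ → ℂ, L2Bound F ((Real.sqrt t)⁻¹ * t⁻¹ * (C * N ^ 3)) ∧ ∀ v,
        ‖(∫ x, cubicSum k s (synth h) x * (starRingEnd ℂ) (packet a χ v t x)) -
          (t : ℂ)⁻¹ * (q (freq a v) (freq a v) (freq a v) *
            (((‖∫ x, synth h x * (starRingEnd ℂ) (packet a χ v t x)‖ ^ 2 : ℝ) : ℂ) *
              ∫ x, synth h x * (starRingEnd ℂ) (packet a χ v t x)))‖ ≤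
        window F t (ρ * κ₁ * Real.sqrt t) v := by
  obtain ⟨C, hC, hvan⟩ := ha.exists_vanishing_const hu hR
  obtain ⟨C', hC', hsup⟩ := ha.exists_sup_bound hu hR
  obtain ⟨C'', hC'', hcub⟩ := ha.exists_cubic_error hu hq hkc hs hs7 hk hrep hR
  obtain ⟨B, Λ, hB, hΛ, hqB, hqΛ⟩ := hq.exists_diag_bounds
  obtain ⟨Θ, hΘ, hfΘ⟩ := ha.exists_freq_lipschitz hu
  have hM := hb.M_pos.le
  have hρ := hb.ρ_pos.le
  have hκ0 := hb.κ₀_pos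
  have hκ1 := hb.κ₁_pos.le
  obtain ⟨L, hL⟩ : ∃ L, L = κ₀⁻¹ * M * (2 * (ρ * κ₁)) := ⟨_, rfl⟩
  have hL0 : 0 ≤ L := by rw [hL]; positivity
  refine ⟨κ₀⁻¹ * M * C'' + Λ * Θ * (ρ * κ₁) * (κ₀⁻¹ * M) * C' ^ 2 +
    B * (3 * L * (1 + L ^ 2)) * C' ^ 2 * C, by positivity, ?_⟩
  intro t N h ℓ ht H hN0 hN hN'
  have ht0 : 0 < t := by linarith
  have hst := Real.sqrt_pos.2 ht0
  have hst2 : (Real.sqrt t)⁻¹ * (Real.sqrt t)⁻¹ = t⁻¹ := by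
    rw [← mul_inv, Real.mul_self_sqrt ht0.le]
  have htt : t⁻¹ ≤ (Real.sqrt t)⁻¹ := inv_anti₀ hst (Real.sqrt_le_iff.2 ⟨ht0.le, by nlinarith⟩)
  have hh := H.integrable
  have hsp := H.supp
  have bD : L2Bound (opVan a t h (fun _ _ => 1)) (t⁻¹ * (C * 1 * N)) :=
    hvan t N h ℓ ht0 H hN0 hN hN' 1 (fun _ _ => 1) isSymbol_one
  have bU : L2Bound (synth h) N := l2Bound_synth H.memLp hh hN
  have hUb := hsup t N h ℓ ht0 H hN0 hN hN'
  have bE := hcub t N h ℓ ht0 H hN0 hN hN'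
  have hfc := ha.continuous_freq
  have hUc : Continuous (synth h) :=
    continuous_iff_continuousAt.2 fun x => (ha.hasDerivAt_synth (t := t) hh hsp x).continuousAt
  set D := opVan a t h (fun _ _ => 1) with hD
  set U := synth h with hU
  set E : ℝ → ℂ := fun x => cubicSum k s U x - q (freq a (x / t)) (freq a (x / t))
        (freq a (x / t)) * (((‖U x‖ ^ 2 : ℝ) : ℂ) * U x) with hE
  set m := (Real.sqrt t)⁻¹ * (C' * N) with hm
  have hm0 : 0 ≤ m := by positivity
  have hm2 : m ^ 2 = t⁻¹ * (C' * N) ^ 2 := by rw [hm, mul_pow, sq (Real.sqrt t)⁻¹, hst2]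
  -- The weights b₁, b₂, b₃ belong to three errors: localizing Q at ξ_{x/t}, freezing q at ξ_v, and
  -- replacing the average of a cube by the cube of an average. The corresponding L² functions are
  -- E, U and D.
  set b₁ := κ₀⁻¹ * M with hb₁
  have hb₁0 : 0 ≤ b₁ := by positivity
  set b₂ := Λ * Θ * (ρ * κ₁) * (Real.sqrt t)⁻¹ * m ^ 2 * b₁ with hb₂
  have hb₂0 : 0 ≤ b₂ := by positivity
  set b₃ := B * (3 * L * (1 + L ^ 2)) * (m ^ 2 * Real.sqrt t) with hb₃
  have hb₃0 : 0 ≤ b₃ := by positivity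
  have n1 := bE.const_mul (b₁ : ℂ)
  have n2 := bU.const_mul (b₂ : ℂ)
  have n3 := bD.const_mul (b₃ : ℂ)
  simp only [Complex.norm_real] at n1 n2 n3
  rw [Real.norm_of_nonneg hb₁0] at n1
  rw [Real.norm_of_nonneg hb₂0] at n2
  rw [Real.norm_of_nonneg hb₃0] at n3
  have n12 := n1.norm_add n2 (by positivity) (by positivity)
  have n123 := n12.norm_add n3 (by positivity) (by positivity)
  refine ⟨_, n123.mono ?_, fun v => ?_⟩
  · have e1 : b₁ * (t⁻¹ * t⁻¹ * (C'' * N ^ 3)) ≤ (Real.sqrt t)⁻¹ * t⁻¹ * (b₁ * C'' * N ^ 3) := by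
      calc b₁ * (t⁻¹ * t⁻¹ * (C'' * N ^ 3)) = t⁻¹ * t⁻¹ * (b₁ * C'' * N ^ 3) := by ring
        _ ≤ _ := by gcongr
    have e2 : b₂ * N = (Real.sqrt t)⁻¹ * t⁻¹ * (Λ * Θ * (ρ * κ₁) * b₁ * C' ^ 2 * N ^ 3) := by
      rw [hb₂, hm2]; ring
    have e3 : b₃ * (t⁻¹ * (C * 1 * N)) = (Real.sqrt t)⁻¹ * t⁻¹ *
        (B * (3 * L * (1 + L ^ 2)) * C' ^ 2 * C * N ^ 3) := by
      have : t⁻¹ * Real.sqrt t = (Real.sqrt t)⁻¹ := by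
        rw [← hst2]; field_simp
      rw [hb₃, hm2, ← this]
      ring
    rw [e2, e3]
    calc _ ≤ _ := add_le_add_left (add_le_add_left e1 _) _
      _ = _ := by ring
  · set δ := ρ * κ₁ * Real.sqrt t with hδ
    have hδ0 : 0 ≤ δ := by positivity
    set c := cutoff a χ v t with hc
    have cc : Continuous c := continuous_cutoff a hχ.continuous v t
    have c0 : ∀ x, x ∉ Icc (v * t - δ) (v * t + δ) → c x = 0 := fun x hx => by
      rw [hc, cutoff, (hb.vanish ha ht0 hx).1, map_zero, mul_zero]
    have hmem : v * t ∈ Icc (v * t - δ) (v * t + δ) := ⟨by linarith, by linarith⟩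
    have ce : Continuous fun x => (starRingEnd ℂ) (carrier a t x) :=
      continuous_iff_continuousAt.2 fun x => (ha.hasDerivAt_conj_carrier ht0.ne' x).continuousAt
    set e : ℝ → ℂ := fun x => (starRingEnd ℂ) (carrier a t x) with he
    have ne : ∀ x, ‖e x‖ = 1 := fun x => by rw [he]; simp only [RCLike.norm_conj, norm_carrier]
    set w : ℝ → ℂ := fun x => e x * U x with hw
    have cw : Continuous w := ce.mul hUc
    have nw : ∀ x, ‖w x‖ = ‖U x‖ := fun x => by rw [hw]; simp only [norm_mul, ne, one_mul]
    have hγ : ∫ x, U x * (starRingEnd ℂ) (packet a χ v t x) = ∫ x, w x * c x :=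
      integral_congr_ae (Filter.Eventually.of_forall fun x => by
        simp only [conj_packet, hw, he, hc]; ring)
    have hqc : Continuous fun x => q (freq a (x / t)) (freq a (x / t)) (freq a (x / t)) :=
      hq.smooth.continuous.comp (by fun_prop : Continuous fun x : ℝ =>
        (freq a (x / t), freq a (x / t), freq a (x / t)))
    set p : ℝ → ℂ := fun x => q (freq a (x / t)) (freq a (x / t)) (freq a (x / t)) with hp
    set q₀ := q (freq a v) (freq a v) (freq a v) with hq₀
    have cub : Continuous fun x => ((‖U x‖ ^ 2 : ℝ) : ℂ) * U x := by fun_prop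
    set V : ℝ → ℂ := fun x => ((‖U x‖ ^ 2 : ℝ) : ℂ) * U x with hV
    have iE : Integrable fun x => E x * (starRingEnd ℂ) (packet a χ v t x) := by
      have h1 : IntegrableOn (fun x => E x * (c x * e x)) (Icc (v * t - δ) (v * t + δ)) :=
        (integrableOn_window bE.memLp _ _).mul_continuousOn (cc.mul ce).continuousOn isCompact_Icc
      rw [integrableOn_iff_integrable_of_support_subset] at h1
      · simpa only [conj_packet] using h1
      · intro x hx
        by_contra hcon
        exact hx (by simp only [c0 x hcon, zero_mul, mul_zero])
    have i2 : Integrable fun x => (p x - q₀) * V x * (c x * e x) :=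
      integrable_of_continuous_of_support (c := v * t - δ) (d := v * t + δ) (by fun_prop)
        fun x hx => by simp only [c0 x hx, zero_mul, mul_zero]
    have i3 : Integrable fun x => ((‖w x‖ ^ 2 : ℝ) : ℂ) * w x * c x :=
      integrable_of_continuous_of_support (c := v * t - δ) (d := v * t + δ) (by fun_prop)
        fun x hx => by simp only [c0 x hx, mul_zero]
    have hsplit : ∫ x, cubicSum k s U x * (starRingEnd ℂ) (packet a χ v t x) =
        (∫ x, E x * (starRingEnd ℂ) (packet a χ v t x)) +
          (∫ x, (p x - q₀) * V x * (c x * e x)) +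
          q₀ * ∫ x, ((‖w x‖ ^ 2 : ℝ) : ℂ) * w x * c x := by
      have i12 : Integrable fun x => E x * (starRingEnd ℂ) (packet a χ v t x) +
        (p x - q₀) * V x * (c x * e x) := iE.add i2
      rw [← integral_const_mul, ← integral_add iE i2, ← integral_add i12 (i3.const_mul q₀)]
      refine integral_congr_ae (Filter.Eventually.of_forall fun x => ?_)
      have h1 : cubicSum k s U x = E x + p x * V x := by simp only [hE, hp, hV]; ring
      have h2 : (starRingEnd ℂ) (packet a χ v t x) = c x * e x := conj_packet a χ v t x
      have h3 : ((‖w x‖ ^ 2 : ℝ) : ℂ) * w x = e x * V x := by rw [nw]; simp only [hw, hV]; ring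
      simp only [h1, h2, h3]
      ring
    -- The oscillation of w over the window is itself a window integral, of D, so this error has the
    -- same form as the others.
    have hcube := ha.norm_integral_cube_sub_le hb hχ.continuous hχ1 ht0 v cw (m := m)
      (J := window D t δ v) (fun x => by rw [nw]; exact hUb x)
      (fun x hx => ha.conj_carrier_mul_sub_le ht0 hh hsp hmem hx) hL
    have hfin : (∫ x, cubicSum k s U x * (starRingEnd ℂ) (packet a χ v t x)) - (t : ℂ)⁻¹ * (q₀ *
        (((‖∫ x, U x * (starRingEnd ℂ) (packet a χ v t x)‖ ^ 2 : ℝ) : ℂ) *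
          ∫ x, U x * (starRingEnd ℂ) (packet a χ v t x))) =
        (∫ x, E x * (starRingEnd ℂ) (packet a χ v t x)) +
          (∫ x, (p x - q₀) * V x * (c x * e x)) +
          q₀ * ((∫ x, ((‖w x‖ ^ 2 : ℝ) : ℂ) * w x * c x) - (t : ℂ)⁻¹ *
            (((‖∫ x, w x * c x‖ ^ 2 : ℝ) : ℂ) * ∫ x, w x * c x)) := by
      rw [hsplit, hγ]
      ring
    rw [hfin]
    refine norm_add₃_le.trans ?_
    rw [window_norm_add n12.memLp n3.memLp, window_norm_add n1.memLp n2.memLp,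
      window_const_mul _ hb₃0]
    refine add_le_add (add_le_add ?_ ?_) ?_
    · refine norm_integral_le_window n1.memLp (fun x => ?_) fun x hx => ?_
      · rw [conj_packet, norm_mul, norm_mul, norm_mul, Complex.norm_real, Real.norm_of_nonneg hb₁0,
          mul_comm b₁]
        have := hb.norm_cutoff_le v t x
        have h2 := ne x
        rw [he] at h2
        rw [h2, mul_one]
        gcongr
      · have := c0 x hx
        rw [hc] at this
        rw [conj_packet, this, zero_mul, mul_zero]
    · refine norm_integral_le_window n2.memLp (fun x => ?_) fun x hx => ?_
      · by_cases hx : x ∈ Icc (v * t - δ) (v * t + δ)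
        · have d1 : ‖p x - q₀‖ ≤ Λ * Θ * (ρ * κ₁) * (Real.sqrt t)⁻¹ := by
            have d2 : |x / t - v| ≤ ρ * κ₁ * (Real.sqrt t)⁻¹ := by
              have d3 : x / t - v = (x - v * t) / t := by field_simp
              rw [d3, abs_div, abs_of_pos ht0, div_le_iff₀ ht0]
              have d4 : (Real.sqrt t)⁻¹ * t = Real.sqrt t := by
                rw [inv_mul_eq_div, Real.div_sqrt]
              rw [mul_assoc, d4, abs_le]
              exact ⟨by linarith [hx.1], by linarith [hx.2]⟩
            calc ‖p x - q₀‖ ≤ Λ * |freq a (x / t) - freq a v| := hqΛ _ _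
              _ ≤ Λ * (Θ * |x / t - v|) := by gcongr; exact hfΘ _ _
              _ ≤ Λ * (Θ * (ρ * κ₁ * (Real.sqrt t)⁻¹)) := by gcongr
              _ = _ := by ring
          simp only [norm_mul, Complex.norm_real, hV, ne, mul_one, norm_pow, norm_norm,
            Real.norm_of_nonneg hb₂0]
          have d5 := hb.norm_cutoff_le v t x
          have d6 := hUb x
          calc _ ≤ Λ * Θ * (ρ * κ₁) * (Real.sqrt t)⁻¹ * (m ^ 2 * ‖U x‖) * b₁ := by gcongr
            _ = _ := by rw [hb₂]; ring
        · rw [c0 x hx, zero_mul, mul_zero, norm_zero]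
          exact norm_nonneg _
      · rw [c0 x hx, zero_mul, mul_zero]
    · rw [norm_mul]
      calc _ ≤ B * (3 * L * (1 + L ^ 2) * (m ^ 2 * Real.sqrt t * window D t δ v)) := by
            gcongr
            exact hqB _
        _ = _ := by rw [hb₃]; ring

end

/-! ### Differentiating the profile in time -/

section

variable {a : ℝ → ℝ} {χ : ℝ → ℂ}

theorem IsDispersive.continuous_width (ha : IsDispersive a) : Continuous (width a) := by
  have := ha.continuous_freq
  have := ha.continuous_deriv2
  unfold width
  fun_prop

/-- Joint continuity of the wave packets and of their time derivatives. -/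
theorem IsDispersive.continuousOn_packet (ha : IsDispersive a) (hχ : ContDiff ℝ ∞ χ) :
    ContinuousOn (fun z : ℝ × ℝ × ℝ => packet a χ z.1 z.2.1 z.2.2) {z | 0 < z.2.1} ∧
      ContinuousOn (fun z : ℝ × ℝ × ℝ => packetDt a χ z.1 z.2.1 z.2.2) {z | 0 < z.2.1} := by
  have c1 := ha.continuous_width
  have c2 := ha.continuous_freq
  have c3 := ha.smooth.continuous
  have c4 := ha.continuous_phase
  have c5 := hχ.continuous
  have c6 := hχ.continuous_deriv (by simp)
  have hw : ∀ v, width a v ≠ 0 := fun v => (ha.width_pos v).ne'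
  have h0 : ∀ z ∈ {z : ℝ × ℝ × ℝ | 0 < z.2.1}, Real.sqrt z.2.1 * width a z.1 ≠ 0 := fun z hz =>
    mul_ne_zero (Real.sqrt_pos.2 hz).ne' (hw _)
  have h2 : ∀ z ∈ {z : ℝ × ℝ × ℝ | 0 < z.2.1}, z.2.1 ≠ 0 := fun z hz => ne_of_gt hz
  have h2' : ∀ z ∈ {z : ℝ × ℝ × ℝ | 0 < z.2.1}, 2 * z.2.1 ≠ 0 := fun z hz =>
    mul_ne_zero two_ne_zero (ne_of_gt hz)
  have s1 : ContinuousOn (fun z : ℝ × ℝ × ℝ => scaled a z.1 z.2.1 z.2.2) {z | 0 < z.2.1} :=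
    ContinuousOn.div (by fun_prop) (by fun_prop) h0
  have s2 : ContinuousOn (fun z : ℝ × ℝ × ℝ => z.2.2 / z.2.1) {z | 0 < z.2.1} :=
    ContinuousOn.div (by fun_prop) (by fun_prop) h2
  have s3 : ContinuousOn (fun z : ℝ × ℝ × ℝ => -z.1 / (Real.sqrt z.2.1 * width a z.1) -
      scaled a z.1 z.2.1 z.2.2 / (2 * z.2.1)) {z | 0 < z.2.1} :=
    (ContinuousOn.div (by fun_prop) (by fun_prop) h0).sub (s1.div (by fun_prop) h2')
  have s4 : ContinuousOn (fun z : ℝ × ℝ × ℝ => carrier a z.2.1 z.2.2) {z | 0 < z.2.1} := by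
    have := c4.comp_continuousOn s2
    unfold carrier
    refine Complex.continuous_exp.comp_continuousOn (continuousOn_const.mul
      (Complex.continuous_ofReal.comp_continuousOn (ContinuousOn.mul (by fun_prop) this)))
  have s5 : ContinuousOn (fun z : ℝ × ℝ × ℝ => (((width a z.1)⁻¹ : ℝ) : ℂ)) {z | 0 < z.2.1} :=
    (Complex.continuous_ofReal.comp ((c1.comp continuous_fst).inv₀ fun z => hw _)).continuousOn
  have s6 := c5.comp_continuousOn s1
  have s7 := c6.comp_continuousOn s1
  have s8 := Complex.continuous_ofReal.comp_continuousOn ((c3.comp c2).comp_continuousOn s2)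
  have s9 := Complex.continuous_ofReal.comp_continuousOn s3
  refine ⟨(s5.mul s6).mul s4, ?_⟩
  exact (s5.mul ((s9.mul s7).sub ((continuousOn_const.mul s8).mul s6))).mul s4

/-- Provides one compactly supported majorant for the packet and its time derivative over a whole
time interval, as needed to differentiate under the integral. -/
theorem IsDispersive.exists_packet_support (ha : IsDispersive a) (hχ : ContDiff ℝ ∞ χ)
    (hχc : HasCompactSupport χ) {t₁ t₂ : ℝ} (h1 : 0 < t₁) (v : ℝ) :
    ∃ X B : ℝ, 0 ≤ B ∧ ∀ s ∈ Icc t₁ t₂,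
      (∀ x, ‖packet a χ v s x‖ ≤ (Icc (-X) X).indicator (fun _ => B) x) ∧
      ∀ x, ‖packetDt a χ v s x‖ ≤ (Icc (-X) X).indicator (fun _ => B) x := by
  obtain ⟨ρ, M, hρ, -, hsupp, -, -⟩ := exists_bump_bounds hχ hχc
  obtain ⟨c1, c2⟩ := ha.continuousOn_packet hχ
  have hw := ha.width_pos v
  set X := |v| * t₂ + ρ * width a v * Real.sqrt t₂ with hX
  have hmap : ContinuousOn (fun z : ℝ × ℝ => (v, z.1, z.2)) (Icc t₁ t₂ ×ˢ Icc (-X) X) := by fun_prop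
  have hmem : MapsTo (fun z : ℝ × ℝ => (v, z.1, z.2)) (Icc t₁ t₂ ×ˢ Icc (-X) X)
      {z : ℝ × ℝ × ℝ | 0 < z.2.1} := fun z hz => h1.trans_le hz.1.1
  have hK : IsCompact (Icc t₁ t₂ ×ˢ Icc (-X) X) := isCompact_Icc.prod isCompact_Icc
  obtain ⟨B₁, hB₁⟩ := hK.exists_bound_of_continuousOn (c1.comp hmap hmem)
  obtain ⟨B₂, hB₂⟩ := hK.exists_bound_of_continuousOn (c2.comp hmap hmem)
  refine ⟨X, max 0 (max B₁ B₂), le_max_left _ _, fun s hs => ?_⟩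
  have hout : ∀ x, x ∉ Icc (-X) X → ρ < |scaled a v s x| := by
    intro x hx
    refine scaled_support ha (h1.trans_le hs.1) le_rfl hρ.le fun hcon => hx ?_
    have hs0 : 0 ≤ s := (h1.trans_le hs.1).le
    have e1 : |v * s| ≤ |v| * t₂ := by
      rw [abs_mul, abs_of_nonneg hs0]
      exact mul_le_mul_of_nonneg_left hs.2 (abs_nonneg v)
    have e2 : ρ * width a v * Real.sqrt s ≤ ρ * width a v * Real.sqrt t₂ :=
      mul_le_mul_of_nonneg_left (Real.sqrt_le_sqrt hs.2) (by positivity)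
    have := abs_le.1 e1
    exact ⟨by linarith [hcon.1, this.1], by linarith [hcon.2, this.2]⟩
  constructor
  · intro x
    by_cases hx : x ∈ Icc (-X) X
    · rw [indicator_of_mem hx]
      exact (hB₁ (s, x) ⟨hs, hx⟩).trans ((le_max_left _ _).trans (le_max_right _ _))
    · rw [indicator_of_notMem hx, packet_eq, (hsupp _ (hout x hx)).1]
      simp
  · intro x
    by_cases hx : x ∈ Icc (-X) X
    · rw [indicator_of_mem hx]
      exact (hB₂ (s, x) ⟨hs, hx⟩).trans ((le_max_right _ _).trans (le_max_right _ _))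
    · rw [indicator_of_notMem hx, packetDt, (hsupp _ (hout x hx)).1, (hsupp _ (hout x hx)).2]
      simp

theorem memLp_indicator_Icc (X B : ℝ) :
    MemLp ((Icc (-X) X).indicator fun _ : ℝ => B) 2 volume :=
  memLp_indicator_const 2 measurableSet_Icc B (Or.inr (by simp))

theorem IsDispersive.continuous_packet (ha : IsDispersive a) (hχ : ContDiff ℝ ∞ χ) {s : ℝ}
    (hs : 0 < s) (v : ℝ) : Continuous (packet a χ v s) :=
  (ha.continuousOn_packet hχ).1.comp_continuous (f := fun x => (v, s, x)) (by fun_prop) fun _ => hs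

theorem IsDispersive.continuous_packetDt (ha : IsDispersive a) (hχ : ContDiff ℝ ∞ χ) {s : ℝ}
    (hs : 0 < s) (v : ℝ) : Continuous (packetDt a χ v s) :=
  (ha.continuousOn_packet hχ).2.comp_continuous (f := fun x => (v, s, x)) (by fun_prop) fun _ => hs

theorem IsDispersive.integrable_mul_packet (ha : IsDispersive a) (hχ : ContDiff ℝ ∞ χ)
    (hχc : HasCompactSupport χ) {s : ℝ} (hs : 0 < s) (v : ℝ) {f : ℝ → ℂ} (hf : MemLp f 2 volume) :
    Integrable (fun x => f x * (starRingEnd ℂ) (packet a χ v s x)) ∧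
      Integrable fun x => f x * (starRingEnd ℂ) (packetDt a χ v s x) := by
  obtain ⟨X, B, hB, h⟩ := ha.exists_packet_support hχ hχc (t₂ := s) hs v
  have hb := h s ⟨le_rfl, le_rfl⟩
  have hc := Complex.continuous_conj
  have key : ∀ {p : ℝ → ℂ}, Continuous p →
      (∀ x, ‖p x‖ ≤ (Icc (-X) X).indicator (fun _ => B) x) →
      Integrable fun x => f x * (starRingEnd ℂ) (p x) := by
    intro p cp hp
    have hm : MemLp (fun x => (starRingEnd ℂ) (p x)) 2 volume :=
      (memLp_indicator_Icc X B).mono (hc.comp cp).aestronglyMeasurable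
        (Filter.Eventually.of_forall fun x => by
          rw [RCLike.norm_conj]; exact (hp x).trans (le_abs_self _))
    exact hf.integrable_mul hm
  exact ⟨key (ha.continuous_packet hχ hs v) hb.1, key (ha.continuous_packetDt hχ hs v) hb.2⟩

theorem IsDispersive.hasDerivAt_integral_mul_packet (ha : IsDispersive a) (hχ : ContDiff ℝ ∞ χ)
    (hχc : HasCompactSupport χ) {t : ℝ} (ht : 0 < t) (v : ℝ) {f : ℝ → ℂ} (hf : MemLp f 2 volume) :
    HasDerivAt (fun s => ∫ x, f x * (starRingEnd ℂ) (packet a χ v s x))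
      (∫ x, f x * (starRingEnd ℂ) (packetDt a χ v t x)) t := by
  obtain ⟨X, B, hB, h⟩ := ha.exists_packet_support hχ hχc (t₁ := t / 2) (t₂ := 2 * t)
    (half_pos ht) v
  have hpos : ∀ s ∈ Icc (t / 2) (2 * t), 0 < s := fun s hs => (half_pos ht).trans_le hs.1
  have hnb : Icc (t / 2) (2 * t) ∈ nhds t := Icc_mem_nhds (by linarith) (by linarith)
  refine (hasDerivAt_integral_of_dominated_loc_of_deriv_le (μ := volume)
    (F := fun s x => f x * (starRingEnd ℂ) (packet a χ v s x))
    (F' := fun s x => f x * (starRingEnd ℂ) (packetDt a χ v s x))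
    (bound := fun x => ‖f x‖ * (Icc (-X) X).indicator (fun _ => B) x) hnb ?_ ?_ ?_ ?_ ?_ ?_).2
  · filter_upwards [hnb] with s hs
    exact (ha.integrable_mul_packet hχ hχc (hpos s hs) v hf).1.1
  · exact (ha.integrable_mul_packet hχ hχc ht v hf).1
  · exact (ha.integrable_mul_packet hχ hχc ht v hf).2.1
  · refine Filter.Eventually.of_forall fun x s hs => ?_
    rw [norm_mul, RCLike.norm_conj]
    exact mul_le_mul_of_nonneg_left ((h s hs).2 x) (norm_nonneg _)
  · exact hf.norm.integrable_mul (memLp_indicator_Icc X B)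
  · refine Filter.Eventually.of_forall fun x s hs => ?_
    exact (ha.hasDerivAt_packet hχ (hpos s hs) v x).star.const_mul (f x)

/-- Uniformity in s makes the pairing of the moving packet with an o(s - t) remainder in L² again
o(s - t). -/
theorem IsDispersive.exists_integral_mul_packet_le (ha : IsDispersive a) (hχ : ContDiff ℝ ∞ χ)
    (hχc : HasCompactSupport χ) {t₁ t₂ : ℝ} (h1 : 0 < t₁) (v : ℝ) :
    ∃ C : ℝ, ∀ s ∈ Icc t₁ t₂, ∀ f : L2,
      ‖∫ x, f x * (starRingEnd ℂ) (packet a χ v s x)‖ ≤ C * ‖f‖ := by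
  obtain ⟨X, B, hB, h⟩ := ha.exists_packet_support hχ hχc (t₂ := t₂) h1 v
  have hI := memLp_indicator_Icc X B
  refine ⟨‖hI.toLp‖, fun s hs f => ?_⟩
  have hs0 : 0 < s := h1.trans_le hs.1
  have hm : MemLp (packet a χ v s) 2 volume :=
    hI.mono (ha.continuous_packet hχ hs0 v).aestronglyMeasurable
      (Filter.Eventually.of_forall fun x => ((h s hs).1 x).trans (le_abs_self _))
  have e1 : ∫ x, f x * (starRingEnd ℂ) (packet a χ v s x) = inner ℂ (hm.toLp : L2) f := by
    rw [L2.inner_def]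
    refine integral_congr_ae ?_
    filter_upwards [hm.coeFn_toLp] with x hx
    rw [hx, RCLike.inner_apply]
  rw [e1]
  refine (norm_inner_le_norm _ _).trans ?_
  gcongr
  rw [Lp.norm_toLp, Lp.norm_toLp]
  refine ENNReal.toReal_mono hI.2.ne (eLpNorm_mono_real fun x => ?_)
  exact (h s hs).1 x

/-- The time derivative of the asymptotic profile. -/
theorem IsDispersive.hasDerivAt_profile (ha : IsDispersive a) (hχ : ContDiff ℝ ∞ χ)
    (hχc : HasCompactSupport χ) {t : ℝ} (ht : 0 < t) (v : ℝ) {u : ℝ → L2} {du : L2}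
    (hu : HasDerivAt u du t) :
    HasDerivAt (fun s => profile a χ u s v)
      ((∫ x, du x * (starRingEnd ℂ) (packet a χ v t x)) +
        ∫ x, u t x * (starRingEnd ℂ) (packetDt a χ v t x)) t := by
  have hnb : Icc (t / 2) (2 * t) ∈ nhds t := Icc_mem_nhds (by linarith) (by linarith)
  have hpos : ∀ s ∈ Icc (t / 2) (2 * t), 0 < s := fun s hs => (half_pos ht).trans_le hs.1
  obtain ⟨C, hC⟩ := ha.exists_integral_mul_packet_le hχ hχc (t₂ := 2 * t) (half_pos ht) v
  -- Here u(s) is split as its first order remainder, plus (s - t) du, plus u(t). The remainder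
  -- contributes derivative zero; in the other two terms the L² function is fixed and only the
  -- packet moves.
  have d1 : HasDerivAt (fun s => ∫ x, (u s - u t - (s - t) • du) x *
      (starRingEnd ℂ) (packet a χ v s x)) 0 t := by
    rw [hasDerivAt_iff_isLittleO]
    have h0 := (hasDerivAt_iff_isLittleO.1 hu)
    refine (Asymptotics.IsBigO.of_bound C ?_).trans_isLittleO h0
    filter_upwards [hnb] with s hs
    have e0 : ∫ x, (u t - u t - (t - t) • du) x * (starRingEnd ℂ) (packet a χ v t x) = 0 := by
      have hz := hC t ⟨by linarith, by linarith⟩ (u t - u t - (t - t) • du)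
      rw [sub_self, sub_self, zero_smul, sub_zero, norm_zero, mul_zero] at hz
      rw [sub_self, sub_self, zero_smul, sub_zero]
      exact norm_le_zero_iff.1 hz
    rw [e0, sub_zero, smul_zero, sub_zero]
    exact hC s hs _
  have d2 := (((hasDerivAt_id t).sub_const t).ofReal_comp).mul
    (ha.hasDerivAt_integral_mul_packet hχ hχc ht v (Lp.memLp du))
  have d3 := ha.hasDerivAt_integral_mul_packet hχ hχc ht v (Lp.memLp (u t))
  refine (((d1.add d2).add d3).congr_of_eventuallyEq ?_).congr_deriv ?_
  · filter_upwards [hnb] with s hs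
    have i1 := (ha.integrable_mul_packet hχ hχc (hpos s hs) v
      (Lp.memLp (u s - u t - (s - t) • du))).1
    have i2 := (ha.integrable_mul_packet hχ hχc (hpos s hs) v (Lp.memLp du)).1
    have i3 := (ha.integrable_mul_packet hχ hχc (hpos s hs) v (Lp.memLp (u t))).1
    simp only [Pi.add_apply, Pi.mul_apply, id]
    have i12 : Integrable fun x => (u s - u t - (s - t) • du) x * (starRingEnd ℂ) (packet a χ v s x) +
        ((s - t : ℝ) : ℂ) * (du x * (starRingEnd ℂ) (packet a χ v s x)) :=
      i1.add (i2.const_mul ((s - t : ℝ) : ℂ))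
    rw [← integral_const_mul, ← integral_add i1 (i2.const_mul _), ← integral_add i12 i3, profile]
    refine integral_congr_ae ?_
    filter_upwards [Lp.coeFn_sub (u s - u t) ((s - t) • du), Lp.coeFn_sub (u s) (u t),
      Lp.coeFn_smul (s - t) du] with x h1 h2 h3
    rw [h1, Pi.sub_apply, h2, Pi.sub_apply, h3, Pi.smul_apply, Complex.real_smul]
    ring
  · simp

/-- Integrals against the wave packets depend measurably on the velocity. -/
theorem IsDispersive.aestronglyMeasurable_integral_mul_packet (ha : IsDispersive a)
    (hχ : ContDiff ℝ ∞ χ) {t : ℝ} (ht : 0 < t) (f : L2) :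
    AEStronglyMeasurable (fun v => ∫ x, f x * (starRingEnd ℂ) (packet a χ v t x)) volume ∧
      AEStronglyMeasurable (fun v => ∫ x, f x * (starRingEnd ℂ) (packetDt a χ v t x)) volume := by
  have hc := Complex.continuous_conj
  obtain ⟨c1, c2⟩ := ha.continuousOn_packet hχ
  have hf : AEStronglyMeasurable (fun z : ℝ × ℝ => f z.2) (volume.prod volume) :=
    ((Lp.stronglyMeasurable f).comp_measurable measurable_snd).aestronglyMeasurable
  have hp : Continuous fun z : ℝ × ℝ => packet a χ z.1 t z.2 :=
    c1.comp_continuous (f := fun z : ℝ × ℝ => (z.1, t, z.2)) (by fun_prop) fun _ => ht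
  have hp' : Continuous fun z : ℝ × ℝ => packetDt a χ z.1 t z.2 :=
    c2.comp_continuous (f := fun z : ℝ × ℝ => (z.1, t, z.2)) (by fun_prop) fun _ => ht
  exact ⟨(hf.mul (hc.comp hp).aestronglyMeasurable).integral_prod_right',
    (hf.mul (hc.comp hp').aestronglyMeasurable).integral_prod_right'⟩

/-- The error term in the asymptotic equation for the profile. -/
noncomputable def profileError (a : ℝ → ℝ) (q : ℝ → ℝ → ℝ → ℂ) (χ : ℝ → ℂ) (u : ℝ → L2)
    (t v : ℝ) : ℂ :=
  deriv (fun s => profile a χ u s v) t + Complex.I * q (freq a v) (freq a v) (freq a v) *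
    (t : ℂ)⁻¹ * profile a χ u t v * ((‖profile a χ u t v‖ ^ 2 : ℝ) : ℂ)

variable {q : ℝ → ℝ → ℝ → ℂ}

theorem IsDispersive.hasDerivAt_profile_error (ha : IsDispersive a) (hχ : ContDiff ℝ ∞ χ)
    (hχc : HasCompactSupport χ) {T : ℝ} {u : ℝ → L2} (hsol : IsSolution a q T u) {t : ℝ}
    (ht : t ∈ Ioo 0 T) (v : ℝ) :
    HasDerivAt (fun s => profile a χ u s v)
      (-(Complex.I * q (freq a v) (freq a v) (freq a v) * (t : ℂ)⁻¹ * profile a χ u t v *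
        ((‖profile a χ u t v‖ ^ 2 : ℝ) : ℂ)) + profileError a q χ u t v) t := by
  obtain ⟨du, -, -, hdu, -⟩ := hsol t ht
  refine (ha.hasDerivAt_profile hχ hχc ht.1 v hdu).differentiableAt.hasDerivAt.congr_deriv ?_
  rw [profileError]
  ring

theorem IsDispersive.aestronglyMeasurable_profileError (ha : IsDispersive a)
    (hq : IsCubicSymbol q) (hχ : ContDiff ℝ ∞ χ)
    (hχc : HasCompactSupport χ) {T : ℝ} {u : ℝ → L2} (hsol : IsSolution a q T u) {t : ℝ}
    (ht : t ∈ Ioo 0 T) : AEStronglyMeasurable (profileError a q χ u t) volume := by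
  obtain ⟨du, -, -, hdu, -⟩ := hsol t ht
  have h1 := (ha.aestronglyMeasurable_integral_mul_packet hχ ht.1 du).1
  obtain ⟨h2, h3⟩ := ha.aestronglyMeasurable_integral_mul_packet hχ ht.1 (u t)
  have hfc := ha.continuous_freq
  have hqc : Continuous fun v => q (freq a v) (freq a v) (freq a v) :=
    hq.smooth.continuous.comp (by fun_prop : Continuous fun v : ℝ => (freq a v, freq a v, freq a v))
  have h4 : AEStronglyMeasurable (fun v => deriv (fun s => profile a χ u s v) t) volume := by
    refine (h1.add h3).congr (Filter.Eventually.of_forall fun v => ?_)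
    exact ((ha.hasDerivAt_profile hχ hχc ht.1 v hdu).deriv).symm
  have h5 : AEStronglyMeasurable (fun v => profile a χ u t v) volume := h2
  have h6 : AEStronglyMeasurable (fun v => ((‖profile a χ u t v‖ ^ 2 : ℝ) : ℂ)) volume :=
    Complex.continuous_ofReal.comp_aestronglyMeasurable (h5.norm.pow 2)
  exact h4.add ((((hqc.aestronglyMeasurable.const_mul Complex.I).mul_const _).mul h5).mul h6)

end

/-! ### Error bounds for uniformly dispersive a -/

section

variable {a : ℝ → ℝ} {χ : ℝ → ℂ} {q : ℝ → ℝ → ℝ → ℂ}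

theorem FreqLocalized.mono {R R' : ℝ} {u : L2} (h : FreqLocalized R u) (hR : R ≤ R') :
    FreqLocalized R' u := by
  filter_upwards [h] with ξ hξ hR'
  exact hξ (hR.trans_lt hR')

theorem eq_neg_I_smul {du Au Qu : L2} (h : Complex.I • du - Au = Qu) :
    du =ᵐ[volume] fun x => -(Complex.I * (Au x + Qu x)) := by
  have h1 : du = (-Complex.I) • (Au + Qu) := by
    rw [← h, add_sub_cancel, smul_smul]
    simp
  rw [h1]
  filter_upwards [Lp.coeFn_smul (-Complex.I) (Au + Qu), Lp.coeFn_add Au Qu] with x e1 e2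
  rw [e1, Pi.smul_apply, e2, Pi.add_apply, smul_eq_mul, neg_mul]

theorem sqrt_mul_sqrt_eq_rpow {t : ℝ} (ht : 0 < t) :
    Real.sqrt (Real.sqrt t) * ((Real.sqrt t)⁻¹ * t⁻¹) = t ^ (-(5 / 4) : ℝ) := by
  rw [Real.sqrt_eq_rpow, Real.sqrt_eq_rpow, ← Real.rpow_mul ht.le, ← Real.rpow_neg ht.le,
    ← Real.rpow_neg_one t, ← Real.rpow_add ht, ← Real.rpow_add ht]
  norm_num

theorem inv_sqrt_mul_inv_eq_rpow {t : ℝ} (ht : 0 < t) :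
    (Real.sqrt t)⁻¹ * t⁻¹ = t ^ (-(3 / 2) : ℝ) := by
  rw [Real.sqrt_eq_rpow, ← Real.rpow_neg ht.le, ← Real.rpow_neg_one t, ← Real.rpow_add ht]
  norm_num

/-- Bounds for the error term in the asymptotic equation, for uniformly dispersive `a`. -/
theorem IsDispersive.exists_profileError_bound (ha : IsDispersive a)
    (hu : IsUniformlyDispersive a) (hq : IsCubicSymbol q) (hχ : ContDiff ℝ ∞ χ)
    (hχc : HasCompactSupport χ) (hχ1 : ∫ y : ℝ, χ y = 1) (R : ℝ) :
    ∃ C : ℝ, 0 ≤ C ∧ ∀ (T t N : ℝ) (u : ℝ → L2), 1 ≤ t → t < T → IsSolution a q T u →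
      FreqLocalized R (u t) → 0 ≤ N → xNorm a t (u t) ≤ ENNReal.ofReal N →
      (∀ v, ‖profileError a q χ u t v‖ ≤ C * (N + N ^ 3) * t ^ (-(5 / 4) : ℝ)) ∧
      eLpNorm (profileError a q χ u t) 2 volume ≤
        ENNReal.ofReal (C * (N + N ^ 3) * t ^ (-(3 / 2) : ℝ)) := by
  -- R may be negative; enlarging the band to `max R 0` keeps the localization valid.
  have hR : 0 ≤ max R 0 := le_max_right _ _
  obtain ⟨ρ, M, κ₀, κ₁, hb⟩ := exists_packetBounds hu hχ hχc
  obtain ⟨k, s, hkc, hs, hs7, hk, hrep⟩ := hq.exists_characters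
  obtain ⟨C₁, hC₁, hlin⟩ := ha.exists_linear_bound hu hχ hχc hb hR
  obtain ⟨C₂, hC₂, hcub⟩ := ha.exists_cubic_bound hu hχ hχ1 hb hq hkc hs hs7 hk hrep hR
  have hki : Integrable k := (integrable_norm_iff hkc.aestronglyMeasurable).1
    (by simpa using hk 0)
  have hρ := hb.ρ_pos
  have hκ1 := hb.κ₁_pos
  set S := Real.sqrt (2 * (ρ * κ₁)) + 2 * (ρ * κ₁) with hS
  have hS1 : Real.sqrt (2 * (ρ * κ₁)) ≤ S := by
    have : 0 ≤ 2 * (ρ * κ₁) := by positivity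
    linarith
  have hS2 : 2 * (ρ * κ₁) ≤ S := by linarith [Real.sqrt_nonneg (2 * (ρ * κ₁))]
  have hS0 : 0 ≤ S := (Real.sqrt_nonneg _).trans hS1
  refine ⟨S * (C₁ + C₂), by positivity, ?_⟩
  intro T t N u ht htT hsol hloc hN0 hX
  have ht0 : 0 < t := by linarith
  have hst := Real.sqrt_pos.2 ht0
  obtain ⟨h, ℓ, H, hh, hN, hN'⟩ := exists_freqData hR (hloc.mono (le_max_left R 0)) hX
  obtain ⟨du, Au, Qu, hdu, hAu, hQu, heq⟩ := hsol t ⟨ht0, htT⟩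
  have hhi := H.integrable
  obtain ⟨F₁, bF₁, hF₁⟩ := hlin t N h ℓ ht H hN0 hN hN'
  obtain ⟨F₂, bF₂, hF₂⟩ := hcub t N h ℓ ht H hN0 hN hN'
  have hahi : Integrable fun ξ => (a ξ : ℂ) * h ξ :=
    integrable_continuous_mul (Complex.continuous_ofReal.comp ha.smooth.continuous) hhi H.supp
  have eu : u t =ᵐ[volume] synth h := coeFn_eq_synth hh hhi
  have eA : Au =ᵐ[volume] synth fun ξ => (a ξ : ℂ) * h ξ := by
    refine coeFn_eq_synth ?_ hahi
    filter_upwards [hAu, hh] with ξ h1 h2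
    rw [h1, h2]
  have eQ : Qu =ᵐ[volume] cubicSum k s (synth h) := coeFn_eq_cubicSum hki hs hrep hq hh hhi hQu
  have hγ : ∀ v, profile a χ u t v = ∫ x, synth h x * (starRingEnd ℂ) (packet a χ v t x) :=
    fun v => integral_congr_ae (by filter_upwards [eu] with x hx; rw [hx])
  -- Substituting the equation for ∂_t u separates the error into the linear and the cubic
  -- expression already estimated.
  have herr : ∀ v, profileError a q χ u t v =
      (∫ x, (-(Complex.I * synth (fun ξ => a ξ * h ξ) x) * (starRingEnd ℂ) (packet a χ v t x) +
        synth h x * (starRingEnd ℂ) (packetDt a χ v t x))) + -Complex.I *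
      ((∫ x, cubicSum k s (synth h) x * (starRingEnd ℂ) (packet a χ v t x)) -
        (t : ℂ)⁻¹ * (q (freq a v) (freq a v) (freq a v) *
          (((‖∫ x, synth h x * (starRingEnd ℂ) (packet a χ v t x)‖ ^ 2 : ℝ) : ℂ) *
            ∫ x, synth h x * (starRingEnd ℂ) (packet a χ v t x)))) := by
    intro v
    rw [profileError, (ha.hasDerivAt_profile hχ hχc ht0 v hdu).deriv, hγ v]
    have i1 := (ha.integrable_mul_packet hχ hχc ht0 v (Lp.memLp Au)).1
    have i2 := (ha.integrable_mul_packet hχ hχc ht0 v (Lp.memLp Qu)).1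
    have i3 := (ha.integrable_mul_packet hχ hχc ht0 v (Lp.memLp (u t))).2
    have e1 : ∫ x, du x * (starRingEnd ℂ) (packet a χ v t x) =
        -Complex.I * (∫ x, Au x * (starRingEnd ℂ) (packet a χ v t x)) +
          -Complex.I * ∫ x, Qu x * (starRingEnd ℂ) (packet a χ v t x) := by
      rw [← mul_add, ← integral_add i1 i2, ← integral_const_mul]
      refine integral_congr_ae ?_
      filter_upwards [eq_neg_I_smul heq] with x hx
      rw [hx]
      ring
    have e2 : ∫ x, (-(Complex.I * synth (fun ξ => a ξ * h ξ) x) *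
        (starRingEnd ℂ) (packet a χ v t x) +
        synth h x * (starRingEnd ℂ) (packetDt a χ v t x)) =
        -Complex.I * (∫ x, Au x * (starRingEnd ℂ) (packet a χ v t x)) +
          ∫ x, u t x * (starRingEnd ℂ) (packetDt a χ v t x) := by
      rw [← integral_const_mul, ← integral_add (i1.const_mul _) i3]
      refine integral_congr_ae ?_
      filter_upwards [eA, eu] with x h1 h2
      rw [h1, h2]
      ring
    have e3 : ∫ x, cubicSum k s (synth h) x * (starRingEnd ℂ) (packet a χ v t x) =
        ∫ x, Qu x * (starRingEnd ℂ) (packet a χ v t x) :=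
      integral_congr_ae (by filter_upwards [eQ] with x hx; rw [hx])
    rw [e1, e2, e3]
    ring
  set δ := ρ * κ₁ * Real.sqrt t with hδ
  have hδ0 : 0 ≤ δ := by positivity
  have bF := bF₁.norm_add bF₂ (by positivity) (by positivity)
  set Φ : ℝ → ℂ := fun x => ((‖F₁ x‖ + ‖F₂ x‖ : ℝ) : ℂ) with hΦ
  have bF' : L2Bound Φ ((Real.sqrt t)⁻¹ * t⁻¹ * ((C₁ + C₂) * (N + N ^ 3))) := by
    refine bF.mono ?_
    rw [← mul_add]
    have : 0 ≤ N ^ 3 := by positivity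
    gcongr
    nlinarith [mul_nonneg hC₁ this, mul_nonneg hC₂ hN0]
  have hle : ∀ v, ‖profileError a q χ u t v‖ ≤ window Φ t δ v := by
    intro v
    rw [herr v, hΦ, window_norm_add bF₁.memLp bF₂.memLp]
    refine (norm_add_le _ _).trans (add_le_add (hF₁ v) ?_)
    rw [norm_mul, norm_neg, Complex.norm_I, one_mul]
    exact hF₂ v
  constructor
  · intro v
    refine (hle v).trans ((window_le bF' (by positivity) hδ0 t v).trans ?_)
    -- The square root of the window size yields t^{1/4}, to be combined with t^{-3/2}.
    have e1 : Real.sqrt (2 * δ) = Real.sqrt (2 * (ρ * κ₁)) * Real.sqrt (Real.sqrt t) := by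
      rw [hδ, ← Real.sqrt_mul (by positivity)]
      ring_nf
    rw [e1, ← sqrt_mul_sqrt_eq_rpow ht0]
    calc _ = Real.sqrt (2 * (ρ * κ₁)) * (C₁ + C₂) * (N + N ^ 3) *
          (Real.sqrt (Real.sqrt t) * ((Real.sqrt t)⁻¹ * t⁻¹)) := by ring
      _ ≤ _ := by gcongr
  · refine (eLpNorm_mono_real hle).trans
      ((eLpNorm_window_le bF' (by positivity) hδ0 ht0).trans (ENNReal.ofReal_le_ofReal ?_))
    rw [← inv_sqrt_mul_inv_eq_rpow ht0]
    -- The window size √t cancels the scaling factor t^{-1/2} of the L²_v norm.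
    have e1 : δ * t ^ (-(1 / 2) : ℝ) = ρ * κ₁ := by
      rw [hδ, Real.rpow_neg ht0.le, ← Real.sqrt_eq_rpow]
      field_simp
    calc _ = 2 * (δ * t ^ (-(1 / 2) : ℝ)) * (C₁ + C₂) * (N + N ^ 3) *
          ((Real.sqrt t)⁻¹ * t⁻¹) := by ring
      _ ≤ _ := by rw [e1]; gcongr

/-- The polynomially growing bound for the `X` norm, in terms of `t ^ (3 C² ε)`. -/
theorem exists_growth_bound (A M : ℝ) :
    ∃ P : ℝ, 0 ≤ P ∧ ∀ C ε t N : ℝ, 0 < C → 0 < ε → ε ≤ 1 → C * ε ≤ M → 1 ≤ t →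
      N = |A| * ε * Real.sqrt (1 + t ^ 2) ^ (C ^ 2 * ε ^ 2) →
      N + N ^ 3 ≤ P * ε * t ^ (3 * C ^ 2 * ε) := by
  set D := |A| * 2 ^ (M ^ 2) with hD
  have hD0 : 0 ≤ D := by positivity
  refine ⟨D + D ^ 3, by positivity, ?_⟩
  intro C ε t N hC hε hε1 hM ht hN
  have ht0 : 0 < t := by linarith
  -- The factor 2 is raised to the power C²ε² ≤ M²; only here does the bound Cε ≤ M matter.
  have hs : Real.sqrt (1 + t ^ 2) ≤ 2 * t := Real.sqrt_le_iff.2 ⟨by linarith, by nlinarith⟩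
  have he0 : 0 ≤ C ^ 2 * ε ^ 2 := by positivity
  have heM : C ^ 2 * ε ^ 2 ≤ M ^ 2 := by
    rw [← mul_pow]
    exact pow_le_pow_left₀ (by positivity) hM 2
  have h1 : N ≤ D * ε * t ^ (C ^ 2 * ε ^ 2) := by
    calc N ≤ |A| * ε * (2 * t) ^ (C ^ 2 * ε ^ 2) := by rw [hN]; gcongr
      _ = |A| * ε * (2 ^ (C ^ 2 * ε ^ 2) * t ^ (C ^ 2 * ε ^ 2)) := by
        rw [Real.mul_rpow (by norm_num) ht0.le]
      _ ≤ |A| * ε * (2 ^ (M ^ 2) * t ^ (C ^ 2 * ε ^ 2)) := by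
        gcongr
        norm_num
      _ = _ := by rw [hD]; ring
  have hN0 : 0 ≤ N := by rw [hN]; positivity
  have hε2 : ε ^ 2 ≤ ε := by nlinarith
  have h2 : t ^ (C ^ 2 * ε ^ 2) ≤ t ^ (3 * C ^ 2 * ε) := by
    refine Real.rpow_le_rpow_of_exponent_le ht ?_
    nlinarith [sq_nonneg C, mul_le_mul_of_nonneg_left hε2 (sq_nonneg C),
      mul_nonneg (sq_nonneg C) hε.le]
  -- The cube produces the exponent 3C²ε², at most 3C²ε because ε ≤ 1.
  have h3 : (t ^ (C ^ 2 * ε ^ 2)) ^ 3 ≤ t ^ (3 * C ^ 2 * ε) := by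
    rw [← Real.rpow_natCast, ← Real.rpow_mul ht0.le]
    refine Real.rpow_le_rpow_of_exponent_le ht ?_
    push_cast
    nlinarith [mul_le_mul_of_nonneg_left hε2 (sq_nonneg C)]
  have h4 : ε ^ 3 ≤ ε := by nlinarith [mul_le_mul_of_nonneg_left hε2 hε.le]
  have h5 : N ^ 3 ≤ D ^ 3 * ε * t ^ (3 * C ^ 2 * ε) := by
    calc N ^ 3 ≤ (D * ε * t ^ (C ^ 2 * ε ^ 2)) ^ 3 := pow_le_pow_left₀ hN0 h1 3
      _ = D ^ 3 * ε ^ 3 * (t ^ (C ^ 2 * ε ^ 2)) ^ 3 := by ring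
      _ ≤ _ := by gcongr
  have h6 : D * ε * t ^ (C ^ 2 * ε ^ 2) ≤ D * ε * t ^ (3 * C ^ 2 * ε) := by gcongr
  linarith

end

/-! ### Extending a to a uniformly dispersive relation -/

theorem contDiff_integral {b : ℝ → ℝ} (hb : ContDiff ℝ ∞ b) (c : ℝ) :
    ContDiff ℝ ∞ fun x => c + ∫ s in (0 : ℝ)..x, b s := by
  have hd : ∀ x, HasDerivAt (fun x => c + ∫ s in (0 : ℝ)..x, b s) (b x) x := fun x =>
    (intervalIntegral.integral_hasDerivAt_right (hb.continuous.intervalIntegrable _ _)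
      (hb.continuous.stronglyMeasurableAtFilter _ _) hb.continuous.continuousAt).const_add c
  refine contDiff_infty_iff_deriv.2 ⟨fun x => (hd x).differentiableAt, ?_⟩
  rwa [show deriv (fun x => c + ∫ s in (0 : ℝ)..x, b s) = b from funext fun x => (hd x).deriv]

theorem hasDerivAt_integral {b : ℝ → ℝ} (hb : Continuous b) (c x : ℝ) :
    HasDerivAt (fun x => c + ∫ s in (0 : ℝ)..x, b s) (b x) x :=
  (intervalIntegral.integral_hasDerivAt_right (hb.intervalIntegrable _ _)
      (hb.stronglyMeasurableAtFilter _ _) hb.continuousAt).const_add c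

theorem eq_add_integral {f g g' : ℝ → ℝ} {N : ℝ} (hg : ∀ x, HasDerivAt g (g' x) x)
    (hg' : Continuous g') (h : ∀ x, |x| ≤ N → f x = g' x) {x : ℝ} (hx : |x| ≤ N) :
    g 0 + ∫ s in (0 : ℝ)..x, f s = g x := by
  have h1 : ∫ s in (0 : ℝ)..x, f s = ∫ s in (0 : ℝ)..x, g' s := by
    refine intervalIntegral.integral_congr fun s hs => h s ?_
    have := abs_sub_left_of_mem_uIcc hs
    simp only [sub_zero] at this
    exact this.trans hx
  rw [h1, intervalIntegral.integral_eq_sub_of_hasDerivAt (fun x _ => hg x)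
    (hg'.intervalIntegrable _ _)]
  ring

/-- A function with second derivative bounded below by `c > 0` in absolute value has a bijective
first derivative. -/
theorem bijective_of_deriv_ge {f f' : ℝ → ℝ} (hf : ∀ x, HasDerivAt f (f' x) x) {c σ : ℝ}
    (hσ : σ = 1 ∨ σ = -1) (hc : 0 < c) (h : ∀ x, c ≤ σ * f' x) : Function.Bijective f := by
  have hg : ∀ x, HasDerivAt (fun x => σ * f x) (σ * f' x) x := fun x => (hf x).const_mul σ
  have hgd : Differentiable ℝ fun x => σ * f x := fun x => (hg x).differentiableAt
  have hmono : StrictMono fun x => σ * f x :=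
    strictMono_of_deriv_pos fun x => by rw [(hg x).deriv]; exact hc.trans_le (h x)
  have hlow : ∀ x y, x ≤ y → c * (y - x) ≤ σ * f y - σ * f x := fun x y hxy =>
    mul_sub_le_image_sub_of_le_deriv hgd (fun z => by rw [(hg z).deriv]; exact h z) hxy
  have htop : Filter.Tendsto (fun x => σ * f x) Filter.atTop Filter.atTop := by
    refine Filter.tendsto_atTop_mono' _ ?_
      (Filter.tendsto_atTop_add_const_right _ (σ * f 0) (Filter.tendsto_id.const_mul_atTop hc))
    filter_upwards [Filter.eventually_ge_atTop 0] with x hx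
    have := hlow 0 x hx
    simp only [id] at this ⊢
    linarith
  have hbot : Filter.Tendsto (fun x => σ * f x) Filter.atBot Filter.atBot := by
    refine Filter.tendsto_atBot_mono' _ ?_
      (Filter.tendsto_atBot_add_const_right _ (σ * f 0) (Filter.tendsto_id.const_mul_atBot hc))
    filter_upwards [Filter.eventually_le_atBot 0] with x hx
    have := hlow x 0 hx
    simp only [id] at this ⊢
    linarith
  have hsurj := hgd.continuous.surjective htop hbot
  have hσ2 : σ * σ = 1 := by rcases hσ with rfl | rfl <;> norm_num
  constructor
  · intro x y hxy
    exact hmono.injective (by simp only [hxy])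
  · intro y
    obtain ⟨x, hx⟩ := hsurj (σ * y)
    refine ⟨x, ?_⟩
    have : σ * (σ * f x) = σ * (σ * y) := congrArg (σ * ·) hx
    rwa [← mul_assoc, ← mul_assoc, hσ2, one_mul, one_mul] at this

/-- Every dispersion relation agrees on a given bounded interval with a uniformly dispersive one. -/
theorem IsDispersive.exists_uniform_extension {a : ℝ → ℝ} (ha : IsDispersive a) (N : ℝ) :
    ∃ b : ℝ → ℝ, IsDispersive b ∧ IsUniformlyDispersive b ∧ ∀ ξ, |ξ| ≤ N →
      b ξ = a ξ ∧ deriv b ξ = deriv a ξ ∧ deriv (deriv b) ξ = deriv (deriv a) ξ := by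
  obtain ⟨σ, hσ, hpos⟩ : ∃ σ : ℝ, (σ = 1 ∨ σ = -1) ∧ ∀ ξ, 0 < σ * deriv (deriv a) ξ := by
    rcases ha.sign with h | h
    · exact ⟨1, Or.inl rfl, fun ξ => by rw [one_mul]; exact h ξ⟩
    · exact ⟨-1, Or.inr rfl, fun ξ => by linarith [h ξ]⟩
  have hσ2 : σ * σ = 1 := by rcases hσ with rfl | rfl <;> norm_num
  have hσa : ∀ y, |σ * y| = |y| := fun y => by rcases hσ with rfl | rfl <;> simp
  set a₂ := deriv (deriv a) with ha₂
  have hsm : ContDiff ℝ ∞ a₂ :=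
    (contDiff_infty_iff_deriv.1 (contDiff_infty_iff_deriv.1 ha.smooth).2).2
  let η : ContDiffBump (0 : ℝ) := ⟨max N 1, max N 1 + 1, by positivity, by linarith⟩
  set g : ℝ → ℝ := fun ξ => η ξ * (a₂ ξ - σ) with hg
  have gs : ContDiff ℝ ∞ g := η.contDiff.mul (hsm.sub contDiff_const)
  have gc : HasCompactSupport g := η.hasCompactSupport.mul_right
  -- The second derivative is a convex combination of a'' and the constant σ of the same sign: it
  -- stays away from zero, agrees with a'' on the given interval, and is constant far out, so all
  -- its derivatives are bounded. Two integrations recover b.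
  set b₂ : ℝ → ℝ := fun ξ => σ + g ξ with hb₂
  have b₂s : ContDiff ℝ ∞ b₂ := contDiff_const.add gs
  set b₁ : ℝ → ℝ := fun x => deriv a 0 + ∫ s in (0 : ℝ)..x, b₂ s with hb₁
  have b₁s : ContDiff ℝ ∞ b₁ := contDiff_integral b₂s _
  set b : ℝ → ℝ := fun x => a 0 + ∫ s in (0 : ℝ)..x, b₁ s with hb
  have bs : ContDiff ℝ ∞ b := contDiff_integral b₁s _
  have d1 : deriv b = b₁ := funext fun x => (hasDerivAt_integral b₁s.continuous _ x).deriv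
  have d2 : deriv b₁ = b₂ := funext fun x => (hasDerivAt_integral b₂s.continuous _ x).deriv
  obtain ⟨c, hc0, hc⟩ : ∃ c : ℝ, 0 < c ∧ ∀ ξ, c ≤ σ * b₂ ξ := by
    obtain ⟨x₀, hx₀, hmin⟩ := (isCompact_closedBall (0 : ℝ) (max N 1 + 1)).exists_isMinOn
      ⟨0, by simp; positivity⟩ (hsm.continuous.const_mul σ |>.continuousOn)
    -- A convex combination of 1 and σa'' is at least the smaller of the two, the latter minimized
    -- over the support of the bump.
    refine ⟨min 1 (σ * a₂ x₀), lt_min one_pos (hpos _), fun ξ => ?_⟩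
    have e1 : σ * b₂ ξ = (1 - η ξ) + η ξ * (σ * a₂ ξ) := by
      simp only [hb₂, hg]
      linear_combination (1 - η ξ) * hσ2
    have n0 : 0 ≤ η ξ := η.nonneg
    have n1 : η ξ ≤ 1 := η.le_one
    rw [e1]
    by_cases hξ : ξ ∈ Metric.closedBall (0 : ℝ) (max N 1 + 1)
    · have h2 : σ * a₂ x₀ ≤ σ * a₂ ξ := hmin hξ
      have h3 := min_le_left 1 (σ * a₂ x₀)
      have h4 := (min_le_right 1 (σ * a₂ x₀)).trans h2
      nlinarith
    · have : η ξ = 0 := η.zero_of_le_dist (by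
        rw [Metric.mem_closedBall, not_le] at hξ; exact hξ.le)
      rw [this]
      simp
  have hagree2 : ∀ ξ, |ξ| ≤ N → b₂ ξ = a₂ ξ := by
    intro ξ hξ
    have : η ξ = 1 := η.one_of_mem_closedBall (by
      rw [mem_closedBall_zero_iff, Real.norm_eq_abs]; exact hξ.trans (le_max_left _ _))
    simp only [hb₂, hg, this]
    ring
  have hagree1 : ∀ ξ, |ξ| ≤ N → b₁ ξ = deriv a ξ := fun ξ hξ =>
    eq_add_integral ha.hasDerivAt_deriv ha.continuous_deriv2 hagree2 hξ
  have hagree0 : ∀ ξ, |ξ| ≤ N → b ξ = a ξ := fun ξ hξ =>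
    eq_add_integral ha.hasDerivAt ha.continuous_deriv hagree1 hξ
  refine ⟨b, ⟨bs, ?_, fun ξ => ?_⟩, ⟨⟨c, hc0, fun ξ => ?_⟩, fun j hj => ?_⟩, fun ξ hξ =>
    ⟨hagree0 ξ hξ, ?_, ?_⟩⟩
  · rw [d1]
    exact bijective_of_deriv_ge (hasDerivAt_integral b₂s.continuous _) hσ hc0 hc
  · rw [d1, d2]
    intro h0
    have := hc ξ
    rw [h0, mul_zero] at this
    linarith
  · rw [d1, d2, ← hσa]
    exact (hc ξ).trans (le_abs_self _)
  · obtain ⟨i, rfl⟩ := Nat.exists_eq_add_of_le' hj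
    have e1 : iteratedDeriv (i + 2) b = iteratedDeriv i b₂ := by
      rw [iteratedDeriv_succ', iteratedDeriv_succ', d1, d2]
    rw [e1]
    have e2 : ∀ ξ, iteratedDeriv i b₂ ξ = iteratedDeriv i (fun _ => σ) ξ + iteratedDeriv i g ξ :=
      fun ξ => iteratedDeriv_fun_add (contDiff_const.contDiffAt) (gs.of_le (by
        exact_mod_cast le_top)).contDiffAt
    have hgi : ∃ B, ∀ ξ, ‖iteratedDeriv i g ξ‖ ≤ B := by
      have h1 : HasCompactSupport (iteratedDeriv i g) := by
        rw [iteratedDeriv_eq_equiv_comp]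
        exact (gc.iteratedFDeriv i).comp_left (map_zero _)
      exact (gs.continuous_iteratedDeriv i (by exact_mod_cast le_top)).bounded_above_of_compact_support h1
    obtain ⟨B, hB⟩ := hgi
    refine ⟨|σ| + B, fun ξ => ?_⟩
    rw [e2]
    refine (abs_add_le _ _).trans (add_le_add ?_ (hB ξ))
    rw [iteratedDeriv_const]
    split_ifs
    · exact le_rfl
    · simp
  · rw [d1]; exact hagree1 ξ hξ
  · rw [d1, d2]; exact hagree2 ξ hξ

/-! ### Reduction of compact sets of velocities to the uniformly dispersive case -/

section

theorem isMultiplier_congr {m m' : ℝ → ℝ} {R : ℝ} {u : L2} (hu : FreqLocalized R u)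
    (h : ∀ ξ, |ξ| ≤ R → m ξ = m' ξ) (g : L2) : IsMultiplier m u g ↔ IsMultiplier m' u g := by
  have he : (fun ξ => (m ξ : ℂ) * hat u ξ) =ᵐ[volume] fun ξ => (m' ξ : ℂ) * hat u ξ := by
    filter_upwards [hu] with ξ hξ
    by_cases hR : R < |ξ|
    · rw [hξ hR, mul_zero, mul_zero]
    · rw [h ξ (not_lt.1 hR)]
  exact ⟨fun hg => hg.trans he, fun hg => hg.trans he.symm⟩

variable {a b : ℝ → ℝ} {χ : ℝ → ℂ} {q : ℝ → ℝ → ℝ → ℂ}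

theorem IsSolution.congr {R T : ℝ} {u : ℝ → L2} (hsol : IsSolution a q T u)
    (hu : ∀ t ∈ Ioo 0 T, FreqLocalized R (u t)) (h : ∀ ξ, |ξ| ≤ R → a ξ = b ξ) :
    IsSolution b q T u := by
  intro t ht
  obtain ⟨du, Au, Qu, h1, h2, h3⟩ := hsol t ht
  exact ⟨du, Au, Qu, h1, (isMultiplier_congr (hu t ht) h Au).1 h2, h3⟩

theorem xNorm_congr {R : ℝ} {u : L2} (hu : FreqLocalized R u)
    (h : ∀ ξ, |ξ| ≤ R → deriv a ξ = deriv b ξ) (t : ℝ) : xNorm a t u = xNorm b t u := by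
  unfold xNorm
  refine iInf_congr fun g => ?_
  rw [isMultiplier_congr hu h g]

/-- The frequency ξ_v of a also solves b'(ξ) = v, and b' is injective. -/
theorem IsDispersive.freq_congr (ha : IsDispersive a) (hb : IsDispersive b) {N v : ℝ}
    (h : ∀ ξ, |ξ| ≤ N → b ξ = a ξ ∧ deriv b ξ = deriv a ξ ∧
      deriv (deriv b) ξ = deriv (deriv a) ξ) (hv : |freq a v| ≤ N) : freq b v = freq a v := by
  have := (h _ hv).2.1
  rw [ha.deriv_freq] at this
  rw [← hb.freq_deriv (freq a v), this]

/-- Over a compact set of velocities and for times bounded below, the wave packets only depend on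
the dispersion relation on a bounded interval. -/
theorem IsDispersive.exists_packet_congr (ha : IsDispersive a) (hχ : ContDiff ℝ ∞ χ)
    (hχc : HasCompactSupport χ) {K : Set ℝ} (hK : IsCompact K) :
    ∃ N : ℝ, ∀ b : ℝ → ℝ, IsDispersive b → (∀ ξ, |ξ| ≤ N → b ξ = a ξ ∧ deriv b ξ = deriv a ξ ∧
      deriv (deriv b) ξ = deriv (deriv a) ξ) →
      ∀ v ∈ K, freq b v = freq a v ∧ ∀ s : ℝ, 1 / 4 < s → packet a χ v s = packet b χ v s := by
  obtain ⟨ρ, M, hρ, -, hsupp, -, -⟩ := exists_bump_bounds hχ hχc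
  obtain ⟨V, hV⟩ := hK.exists_bound_of_continuousOn continuousOn_id
  obtain ⟨W, hW⟩ := hK.exists_bound_of_continuousOn ha.continuous_width.continuousOn
  obtain ⟨N, hN⟩ := (isCompact_Icc (a := -(V + 2 * (ρ * W)))
    (b := V + 2 * (ρ * W))).exists_bound_of_continuousOn ha.continuous_freq.continuousOn
  refine ⟨N, fun b hb h v hv => ?_⟩
  have hvV : |v| ≤ V := hV v hv
  have hw0 := ha.width_pos v
  have hwW : width a v ≤ W := (le_abs_self _).trans (hW v hv)
  have hρW : 0 ≤ ρ * W := mul_nonneg hρ.le (hw0.le.trans hwW)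
  have hfN : ∀ y, |y| ≤ V + 2 * (ρ * W) → |freq a y| ≤ N := fun y hy => hN y (abs_le.1 hy)
  have hfv : freq b v = freq a v := ha.freq_congr hb h (hfN v (by linarith))
  have hwe : width b v = width a v := by
    rw [width, width, hfv, (h _ (hfN v (by linarith))).2.2]
  refine ⟨hfv, fun s hs => funext fun x => ?_⟩
  have hs0 : 0 < s := by linarith
  have hse : scaled b v s x = scaled a v s x := by rw [scaled, scaled, hwe]
  rw [packet_eq, packet_eq, hwe, hse]
  by_cases hx : ρ < |scaled a v s x|
  · rw [(hsupp _ hx).1]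
    simp
  · have hst : 1 / 2 < Real.sqrt s := by
      rw [Real.lt_sqrt (by norm_num)]
      linarith
    have hp : 0 < Real.sqrt s * width a v := by positivity
    have h1 : |x - v * s| ≤ ρ * (Real.sqrt s * width a v) := by
      rwa [not_lt, scaled, abs_div, abs_of_pos hp, div_le_iff₀ hp] at hx
    have h2 : |x / s - v| ≤ 2 * (ρ * W) := by
      have e1 : x / s - v = (x - v * s) / s := by field_simp
      rw [e1, abs_div, abs_of_pos hs0, div_le_iff₀ hs0]
      refine h1.trans ?_
      have e2 : Real.sqrt s ≤ 2 * s := by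
        nlinarith [Real.mul_self_sqrt hs0.le, Real.sqrt_nonneg s]
      calc ρ * (Real.sqrt s * width a v) ≤ ρ * (2 * s * W) := by gcongr
        _ = _ := by ring
    have h3 : |x / s| ≤ V + 2 * (ρ * W) := by
      have := abs_add_le v (x / s - v)
      rw [add_sub_cancel] at this
      linarith
    have h4 := hfN _ h3
    rw [carrier, carrier, phase, phase, ha.freq_congr hb h h4, (h _ h4).1]

/-- The error contains a time derivative, so agreement of the packets is needed on a neighbourhood
of t ≥ 1 and not just at t; the threshold 1/4 leaves room for it. -/
theorem profileError_congr {u : ℝ → L2} {v t : ℝ} (ht : 1 ≤ t) (hf : freq b v = freq a v)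
    (h : ∀ s : ℝ, 1 / 4 < s → packet a χ v s = packet b χ v s) :
    profileError a q χ u t v = profileError b q χ u t v := by
  have h1 : ∀ s : ℝ, 1 / 4 < s → profile a χ u s v = profile b χ u s v := fun s hs => by
    simp only [profile, h s hs]
  have h2 : (fun s => profile a χ u s v) =ᶠ[nhds t] fun s => profile b χ u s v := by
    filter_upwards [lt_mem_nhds (show (1 / 4 : ℝ) < t by linarith)] with s hs
    exact h1 s hs
  rw [profileError, profileError, h2.deriv_eq, h1 t (by linarith), hf]

/-- Bounds for the error term in the asymptotic equation, over a set `K` of velocities. -/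
theorem IsDispersive.exists_profileError_bound_on (ha : IsDispersive a)
    (hq : IsCubicSymbol q) (hχ : ContDiff ℝ ∞ χ) (hχc : HasCompactSupport χ)
    (hχ1 : ∫ y : ℝ, χ y = 1) {K : Set ℝ} (hK : IsCompact K ∨ IsUniformlyDispersive a) (R : ℝ) :
    ∃ C : ℝ, 0 ≤ C ∧ ∀ (T t N : ℝ) (u : ℝ → L2), 1 ≤ t → t < T → IsSolution a q T u →
      (∀ s ∈ Ioo 0 T, FreqLocalized R (u s)) → 0 ≤ N → xNorm a t (u t) ≤ ENNReal.ofReal N →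
      (∀ v ∈ K, ‖profileError a q χ u t v‖ ≤ C * (N + N ^ 3) * t ^ (-(5 / 4) : ℝ)) ∧
      eLpNorm (profileError a q χ u t) 2 (volume.restrict K) ≤
        ENNReal.ofReal (C * (N + N ^ 3) * t ^ (-(3 / 2) : ℝ)) := by
  rcases hK with hK | hu
  · obtain ⟨N₀, hN₀⟩ := ha.exists_packet_congr hχ hχc hK
    -- The interval must cover the frequencies seen by packets with velocities in K and the
    -- frequency band of u, so that packets, equation and X norm all remain the same.
    obtain ⟨b, hb, hbu, hab⟩ := ha.exists_uniform_extension (max N₀ R)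
    obtain ⟨C, hC, h⟩ := hb.exists_profileError_bound hbu hq hχ hχc hχ1 R
    refine ⟨C, hC, fun T t N u ht htT hsol hloc hN hX => ?_⟩
    have hR : ∀ ξ, |ξ| ≤ R → b ξ = a ξ ∧ deriv b ξ = deriv a ξ ∧
        deriv (deriv b) ξ = deriv (deriv a) ξ := fun ξ hξ => hab ξ (hξ.trans (le_max_right _ _))
    have hloct := hloc t ⟨by linarith, htT⟩
    rw [xNorm_congr hloct (fun ξ hξ => (hR ξ hξ).2.1.symm)] at hX
    obtain ⟨h1, h2⟩ := h T t N u ht htT (hsol.congr hloc fun ξ hξ => (hR ξ hξ).1.symm) hloct hN hX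
    have he : ∀ v ∈ K, profileError a q χ u t v = profileError b q χ u t v := by
      intro v hv
      obtain ⟨hf, hp⟩ := hN₀ b hb (fun ξ hξ => hab ξ (hξ.trans (le_max_left _ _))) v hv
      exact profileError_congr ht hf hp
    refine ⟨fun v hv => by rw [he v hv]; exact h1 v, ?_⟩
    rw [eLpNorm_congr_ae (ae_restrict_of_forall_mem hK.measurableSet he)]
    exact (eLpNorm_mono_measure _ Measure.restrict_le_self).trans h2
  · obtain ⟨C, hC, h⟩ := ha.exists_profileError_bound hu hq hχ hχc hχ1 R
    refine ⟨C, hC, fun T t N u ht htT hsol hloc hN hX => ?_⟩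
    obtain ⟨h1, h2⟩ := h T t N u ht htT hsol (hloc t ⟨by linarith, htT⟩) hN hX
    exact ⟨fun v _ => h1 v, (eLpNorm_mono_measure _ Measure.restrict_le_self).trans h2⟩

end

end WavePacket

/-! ### The asymptotic equation for the profile -/

theorem propositionp
    (a : ℝ → ℝ) (ha : WavePacket.IsDispersive a)
    (q : ℝ → ℝ → ℝ → ℂ) (hq : WavePacket.IsCubicSymbol q)
    (χ : ℝ → ℂ) (hχ : ContDiff ℝ ∞ χ) (hχc : HasCompactSupport χ) (hχ1 : ∫ y : ℝ, χ y = 1)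
    (K : Set ℝ) (hK : IsCompact K ∨ WavePacket.IsUniformlyDispersive a)
    (R A M : ℝ) :
    ∃ B : ℝ, ∀ C ε : ℝ, 0 < C → 0 < ε → ε ≤ 1 → C * ε ≤ M →
      ∀ (T : ℝ) (u : ℝ → WavePacket.L2),
        (∀ t ∈ Ioo (0 : ℝ) T, WavePacket.FreqLocalized R (u t)) →
        WavePacket.IsSolution a q T u →
        (∀ t ∈ Ico (1 : ℝ) T, WavePacket.xNorm a t (u t) ≤
          ENNReal.ofReal (A * ε * Real.sqrt (1 + t ^ 2) ^ (C ^ 2 * ε ^ 2))) →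
        ∃ f : ℝ → ℝ → ℂ, ∀ t ∈ Ico (1 : ℝ) T,
          (∀ v : ℝ, HasDerivAt (fun s => WavePacket.profile a χ u s v)
            (-(Complex.I * q (WavePacket.freq a v) (WavePacket.freq a v) (WavePacket.freq a v) *
                (t : ℂ)⁻¹ * WavePacket.profile a χ u t v *
                ((‖WavePacket.profile a χ u t v‖ ^ 2 : ℝ) : ℂ)) + f t v) t) ∧
          (∀ v ∈ K, ‖f t v‖ ≤ B * ε * t ^ (-(5 / 4) + 3 * C ^ 2 * ε)) ∧
          AEStronglyMeasurable (f t) volume ∧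
          eLpNorm (f t) 2 (volume.restrict K) ≤
            ENNReal.ofReal (B * ε * t ^ (-(3 / 2) + 3 * C ^ 2 * ε)) := by
  obtain ⟨B, hB, hbound⟩ := ha.exists_profileError_bound_on hq hχ hχc hχ1 hK R
  obtain ⟨P, hP, hgrowth⟩ := WavePacket.exists_growth_bound A M
  refine ⟨B * P, fun C ε hC hε hε1 hM T u hloc hsol hX => ?_⟩
  -- f is the defect in the limiting equation, so the differential identity needs only
  -- differentiability of the profile; the content is in the bounds.
  refine ⟨WavePacket.profileError a q χ u, fun t ht => ?_⟩
  have ht0 : 0 < t := by linarith [ht.1]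
  have htT : t ∈ Ioo 0 T := ⟨ht0, ht.2⟩
  -- A may be negative; |A| keeps N nonnegative and the X norm bound valid.
  obtain ⟨N, hN⟩ : ∃ N, N = |A| * ε * Real.sqrt (1 + t ^ 2) ^ (C ^ 2 * ε ^ 2) := ⟨_, rfl⟩
  have hN0 : 0 ≤ N := by rw [hN]; positivity
  have hXN : WavePacket.xNorm a t (u t) ≤ ENNReal.ofReal N := by
    refine (hX t ht).trans (ENNReal.ofReal_le_ofReal ?_)
    rw [hN]
    gcongr
    exact le_abs_self A
  have hPN := hgrowth C ε t N hC hε hε1 hM ht.1 hN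
  obtain ⟨h1, h2⟩ := hbound T t N u ht.1 ht.2 hsol hloc hN0 hXN
  have hexp : ∀ r : ℝ, B * (N + N ^ 3) * t ^ r ≤ B * P * ε * t ^ (r + 3 * C ^ 2 * ε) := by
    intro r
    rw [Real.rpow_add ht0]
    calc B * (N + N ^ 3) * t ^ r ≤ B * (P * ε * t ^ (3 * C ^ 2 * ε)) * t ^ r := by gcongr
      _ = _ := by ring
  exact ⟨fun v => ha.hasDerivAt_profile_error hχ hχc hsol htT v,
    fun v hv => (h1 v hv).trans (hexp _),
    ha.aestronglyMeasurable_profileError hq hχ hχc hsol htT,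
    h2.trans (ENNReal.ofReal_le_ofReal (hexp _))⟩
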